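/- Let $c>0$ and let $M=S^3\times\mathbb R^4=\{(x,a)\in\mathbb H^2:\|x\|=1\}$ carry the Bryant–Salamon $G_2$-structure $$\varphi_c=3\sqrt3\,c\,e_1\wedge e_2\wedge e_3+2\sqrt3\,d\big(r^2\textstyle\sum_i e_i\wedge f_i\big),\qquad r=\|a\|,$$ where $(e_i)$ and $(f_i)$ are the left-invariant coframes of the unit quaternions $x$ and $q=a/\|a\|$ with $de_i=2e_j\wedge e_k$, $df_i=2f_j\wedge f_k$ for $(i,j,k)$ cyclic ($\varphi_c$ extends smoothly over the zero section $\{a=0\}$). Let $T^2\times SU(2)=U(1)\times U(1)\times Sp(1)$ act on $M$ by $(\lambda_1,\lambda_2,\gamma)(x,a)=(\lambda_1x\bar\gamma,\lambda_2a\bar\gamma)$, the $U(1)$s being generated by $i$. Let $M_P$ be the principal set of this action and let $\mathcal S_d$ be the set of points with $d$-dimensional stabilizer, so that $M$ is the disjoint union of $M_P,\mathcal S_1,\mathcal S_2,\mathcal S_3,\mathcal S_4$. Let $U_1=(ix,0)$, $U_2=(0,ia)$ and $V_l=\tfrac12(xe_l,ae_l)$, with $(e_1,e_2,e_3)=(i,j,k)$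 the imaginary units, be generators of the action, and let $\mu:M\to\mathbb R^3$, $\mu_k=-{*}\varphi_c(U_1,U_2,V_i,V_j)$ with $(i,j,k)$ cyclic, be the multi-moment map, which satisfies $d\mu_k={*}\varphi_c(U_1,U_2,V_k,\cdot)$. Then the following hold. 1. Let $v=\bar x i x$, $w=\bar q i q$ be the images of $x$ and $q$ under the Hopf map $S^3\to S^2$, and let $\cos\theta=\langle v,w\rangle$. The map $(\theta,r)$ identifies $B=M_P/(T^2\times SU(2))$ with $(0,\pi)\times\mathbb R^+$, and on it $|\mu|=3r^2(c+r^2)^{1/3}\sin\theta$. There is a smooth fibre bundle $M_P\to\mathbb R^+\times SO(3)$ whose fibres are $T^2$-invariant associative submanifolds diffeomorphic to $T^2\times\mathbb R$. The fibre over $(h,A)$ is the preimage in $M_P$ of a horizontal lift to $M_P/T^2$ of the level set $\{|\mu|=h\}\subset B$, with respect to any connection on the principal bundle $M_P/T^2\to B$ for which $U_1\times U_2$ is horizontal; the connection induced by the metric is one such. These associatives are closed in $M$ and do not intersect the zero section. 2. $\mathcal S_1$ admits a smooth fibration over the disjoint union $S^2\cup S^2$ whose fibres are totally geodesic $T^2$-invariant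 associatives diffeomorphic to $T^2\times\mathbb R$. The closure of each fibre in $M$ is a smooth associative submanifold diffeomorphic to $S^1\times\mathbb R^2$. 3. $\mathcal S_2$ is the zero section. It is a $T^2$-invariant totally geodesic associative, it is a single $T^2\times SU(2)$-orbit, and it is diffeomorphic to $S^3$. 4. $\mathcal S_3=\mathcal S_4=\emptyset$. -/

import Mathlib

open scoped Quaternion ContDiff Topology InnerProductSpace

noncomputable section

namespace BryantSalamon

/-! ### Smooth maps between subsets of normed spaces

Manifolds appear as subsets of finite dimensional normed spaces. -/

section Smooth

variable {E F N : Type*} [NormedAddCommGroup E] [NormedSpace ℝ E]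
  [NormedAddCommGroup F] [NormedSpace ℝ F] [NormedAddCommGroup N] [NormedSpace ℝ N]

/-- `A` and `B` are diffeomorphic (there are mutually inverse smooth maps between them). -/
def Diffeomorphic (A : Set E) (B : Set F) : Prop :=
  ∃ (f : E → F) (g : F → E), ContDiffOn ℝ ∞ f A ∧ ContDiffOn ℝ ∞ g B ∧
    Set.MapsTo f A B ∧ Set.MapsTo g B A ∧ Set.LeftInvOn g f A ∧ Set.RightInvOn g f B

/-- `L` is a `k`-dimensional embedded submanifold: it is locally diffeomorphic to open subsets
of `ℝ^k`. -/
def IsEmbeddedSubmanifold (k : ℕ) (L : Set E) : Prop :=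
  ∀ m ∈ L, ∃ (U : Set E) (V : Set (EuclideanSpace ℝ (Fin k))),
    IsOpen U ∧ m ∈ U ∧ IsOpen V ∧ Diffeomorphic V (L ∩ U)

/-- The tangent space of `L` at `m`, spanned by the velocities of smooth curves in `L`. -/
def tangentTo (L : Set E) (m : E) : Submodule ℝ E :=
  Submodule.span ℝ {X | ∃ γ : ℝ → E, ContDiffAt ℝ ∞ γ 0 ∧ (∀ᶠ t in 𝓝 (0 : ℝ), γ t ∈ L) ∧
    γ 0 = m ∧ deriv γ 0 = X}

/-- `π : X → Y` is a smooth (locally trivial) fibre bundle with typical fibre `P`: over a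
neighbourhood `W` of each point of `Y` there is a diffeomorphism
`m ↦ (π m, f m)` of `X ∩ π⁻¹ W` onto `(Y ∩ W) × P`, with inverse `g`. -/
def IsSmoothFibreBundle (π : E → F) (X : Set E) (Y : Set F) (P : Set N) : Prop :=
  ContDiffOn ℝ ∞ π X ∧ Set.MapsTo π X Y ∧
  ∀ y ∈ Y, ∃ W : Set F, IsOpen W ∧ y ∈ W ∧ ∃ (f : E → N) (g : F × N → E),
    ContDiffOn ℝ ∞ f (X ∩ π ⁻¹' W) ∧ ContDiffOn ℝ ∞ g ((Y ∩ W) ×ˢ P) ∧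
    Set.MapsTo f (X ∩ π ⁻¹' W) P ∧ Set.MapsTo g ((Y ∩ W) ×ˢ P) (X ∩ π ⁻¹' W) ∧
    (∀ m ∈ X ∩ π ⁻¹' W, g (π m, f m) = m) ∧
    (∀ b ∈ Y ∩ W, ∀ n ∈ P, π (g (b, n)) = b ∧ f (g (b, n)) = n)

end Smooth

/-- `T² × ℝ`. -/
def torusLine : Set (ℂ × ℂ × ℝ) := {p | ‖p.1‖ = 1 ∧ ‖p.2.1‖ = 1}

/-- `S¹ × ℝ²`. -/
def circlePlane : Set (ℂ × ℂ) := {p | ‖p.1‖ = 1}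

/-- The unit sphere `S^k` in `ℝ^(k+1)`. -/
def unitSphere (k : ℕ) : Set (EuclideanSpace ℝ (Fin (k + 1))) := Metric.sphere 0 1

/-- The disjoint union `S² ∪ S²`, realised as `{1, -1} × S²`. -/
def twoSpheres : Set (ℝ × EuclideanSpace ℝ (Fin 3)) := {1, -1} ×ˢ unitSphere 2

/-- `ℝ⁺ × SO(3)`, a rotation being given by its matrix entries. -/
def posRotations : Set (ℝ × (Fin 3 → Fin 3 → ℝ)) :=
  {b | 0 < b.1 ∧ Matrix.of b.2 ∈ Matrix.specialOrthogonalGroup (Fin 3) ℝ}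

/-! ### The linear model `ℝ⁷ = ℝ³ ⊕ ℝ⁴` -/

/-- `ℝ⁷ = ℝ³ ⊕ ℝ⁴` with coordinates `(x₁, x₂, x₃)` and `(a₀, a₁, a₂, a₃)`. -/
abbrev R7 : Type := (Fin 3 → ℝ) × (Fin 4 → ℝ)

/-- The standard anti-self-dual forms `Ω_i = da₀ ∧ da_i - da_j ∧ da_k`, with `(i, j, k)` cyclic. -/
def Omega (i : Fin 3) (X Y : R7) : ℝ :=
  (X.2 0 * Y.2 i.succ - X.2 i.succ * Y.2 0) -
    (X.2 (i + 1).succ * Y.2 (i + 2).succ - X.2 (i + 2).succ * Y.2 (i + 1).succ)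

/-- `φ₀ = dx₁ ∧ dx₂ ∧ dx₃ + ∑ i, dx_i ∧ Ω_i`. -/
def phi0 (X Y Z : R7) : ℝ :=
  Matrix.det !![X.1 0, X.1 1, X.1 2; Y.1 0, Y.1 1, Y.1 2; Z.1 0, Z.1 1, Z.1 2] +
    ∑ i : Fin 3, (X.1 i * Omega i Y Z + Y.1 i * Omega i Z X + Z.1 i * Omega i X Y)

/-- `dx_j ∧ dx_k`, with `(i, j, k)` cyclic. -/
def dxdx (i : Fin 3) (X Y : R7) : ℝ := X.1 (i + 1) * Y.1 (i + 2) - X.1 (i + 2) * Y.1 (i + 1)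

/-- `*φ₀ = da₀ ∧ da₁ ∧ da₂ ∧ da₃ - ∑ i, dx_j ∧ dx_k ∧ Ω_i`. -/
def starPhi0 (X Y Z W : R7) : ℝ :=
  Matrix.det (Matrix.of ![X.2, Y.2, Z.2, W.2]) -
    ∑ i : Fin 3, (dxdx i X Y * Omega i Z W - dxdx i X Z * Omega i Y W + dxdx i X W * Omega i Y Z
      + dxdx i Y Z * Omega i X W - dxdx i Y W * Omega i X Z + dxdx i Z W * Omega i X Y)

/-! ### The Bryant–Salamon manifold -/

/-- The ambient space `ℍ²`, with points `(x, a)`. -/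
abbrev H2 : Type := ℍ[ℝ] × ℍ[ℝ]

/-- The manifold `S³ × ℝ⁴ = {(x, a) ∈ ℍ² : ‖x‖ = 1}`. -/
def M : Set H2 := {m | ‖m.1‖ = 1}

/-- The zero section `S³ × {0}`. -/
def zeroSection : Set H2 := {m | m ∈ M ∧ m.2 = 0}

/-- The tangent space of `M` at `m ∈ M`. -/
def TM (m : H2) : Submodule ℝ H2 where
  carrier := {X | ⟪m.1, X.1⟫_ℝ = 0}
  add_mem' {X Y} hX hY := by
    simp only [Set.mem_ofPred_eq, Prod.fst_add, inner_add_right] at *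
    rw [hX, hY, add_zero]
  zero_mem' := by simp
  smul_mem' r X hX := by
    simp only [Set.mem_ofPred_eq, Prod.smul_fst, inner_smul_right] at *
    rw [hX, mul_zero]

/-- The imaginary units `i, j, k`. -/
def unit (l : Fin 3) : ℍ[ℝ] := ![⟨0, 1, 0, 0⟩, ⟨0, 0, 1, 0⟩, ⟨0, 0, 0, 1⟩] l

/-- The left-invariant coframe `e_l` of `S³`, dual to `E_l = -x e_l`, with
`de_i = 2 e_j ∧ e_k` on `S³`. -/
def eForm (l : Fin 3) (m X : H2) : ℝ := -⟪m.1 * unit l, X.1⟫_ℝ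

/-- The one-form `r² f_l` on `ℍ`, where `r = ‖a‖` and `f_l` is the pull-back by
`a ↦ a / ‖a‖` of the left-invariant coframe of `S³`: since `da = dr q + r dq` for `a = r q`, one
has `r² f_l = -⟨a e_l, da⟩`, also for `a = 0`. -/
def alphaForm (l : Fin 3) (m X : H2) : ℝ := -⟪m.2 * unit l, X.2⟫_ℝ

/-- The exterior derivative of the one-form `r² f_l` on `ℍ`. -/
def dAlphaForm (l : Fin 3) (X Y : H2) : ℝ := 2 * ⟪X.2, Y.2 * unit l⟫_ℝ

/-- The Bryant–Salamon three-form
`φ_c = 3√3 c e₁ ∧ e₂ ∧ e₃ + 2√3 d (r² ∑ i, e_i ∧ f_i)` at `m`, on tangent vectors of `M`, the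
differential being expanded as
`d (e_i ∧ r² f_i) = 2 e_j ∧ e_k ∧ r² f_i - e_i ∧ d (r² f_i)` with `(i, j, k)` cyclic. -/
def phi (c : ℝ) (m X Y Z : H2) : ℝ :=
  3 * √3 * c * Matrix.det !![eForm 0 m X, eForm 1 m X, eForm 2 m X;
      eForm 0 m Y, eForm 1 m Y, eForm 2 m Y; eForm 0 m Z, eForm 1 m Z, eForm 2 m Z] +
  2 * √3 * ∑ i : Fin 3,
    (2 * Matrix.det !![eForm (i + 1) m X, eForm (i + 2) m X, alphaForm i m X;
        eForm (i + 1) m Y, eForm (i + 2) m Y, alphaForm i m Y;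
        eForm (i + 1) m Z, eForm (i + 2) m Z, alphaForm i m Z] -
      (eForm i m X * dAlphaForm i Y Z + eForm i m Y * dAlphaForm i Z X +
        eForm i m Z * dAlphaForm i X Y))

/-- The vertical `ℍ`-valued one-form `da - (1/2) a x̄ dx`. -/
def vert (m X : H2) : ℍ[ℝ] := X.2 - (1 / 2 : ℝ) • (m.2 * star m.1 * X.1)

/-- The adapted coframe `T_m M → ℝ⁷`. It identifies `phi c m` with `phi0`
(`phi_eq_phi0_coframe`) and is injective on `T_m M` (`coframe_injOn`), so it is the inverse of an
isomorphism `p : ℝ⁷ → T_m M` with `p^* φ_c = φ₀`. -/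
def coframe (c : ℝ) (m X : H2) : R7 :=
  (fun l => √3 * (c + ‖m.2‖ ^ 2) ^ (1 / 3 : ℝ) * eForm l m X,
   fun l => 2 * (c + ‖m.2‖ ^ 2) ^ (-(1 / 6) : ℝ) *
     ![(vert m X).re, (vert m X).imI, (vert m X).imJ, (vert m X).imK] l)

/-- The Riemannian metric induced by `φ_c`, for which the adapted coframe is orthonormal. -/
def metric (c : ℝ) (m X Y : H2) : ℝ :=
  ∑ l, (coframe c m X).1 l * (coframe c m Y).1 l + ∑ l, (coframe c m X).2 l * (coframe c m Y).2 l

/-- The Hodge dual four-form `*φ_c`. -/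
def starPhi (c : ℝ) (m X Y Z W : H2) : ℝ :=
  starPhi0 (coframe c m X) (coframe c m Y) (coframe c m Z) (coframe c m W)

/-- `W` is the cross product `X × Y = φ_c(X, Y, ·)^♯` in `T_m M`. -/
def IsCross (c : ℝ) (m X Y W : H2) : Prop :=
  W ∈ TM m ∧ ∀ Z ∈ TM m, metric c m W Z = phi c m X Y Z

/-! ### Associative and totally geodesic submanifolds -/

/-- `P` is an associative plane of `T_m M`: it is `3`-dimensional and `φ_c` restricts to its
volume form, for one of its two orientations. -/
def IsAssociativePlane (c : ℝ) (m : H2) (P : Submodule ℝ H2) : Prop :=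
  P ≤ TM m ∧ Module.finrank ℝ P = 3 ∧
  ∀ X : Fin 3 → H2, (∀ l, X l ∈ P) →
    (∀ l n, metric c m (X l) (X n) = if l = n then 1 else 0) → |phi c m (X 0) (X 1) (X 2)| = 1

/-- `L` is an associative submanifold of `M`. -/
def IsAssociative (c : ℝ) (L : Set H2) : Prop :=
  L ⊆ M ∧ IsEmbeddedSubmanifold 3 L ∧ ∀ m ∈ L, IsAssociativePlane c m (tangentTo L m)

/-- The Koszul expression for `2 g(∇_X Y, Z)` at `m`, for vector fields `X, Y, Z` tangent to `M`
and the Levi-Civita connection `∇` of the metric. -/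
def koszul (c : ℝ) (X Y Z : H2 → H2) (m : H2) : ℝ :=
  fderiv ℝ (fun p => metric c p (Y p) (Z p)) m (X m)
    + fderiv ℝ (fun p => metric c p (X p) (Z p)) m (Y m)
    - fderiv ℝ (fun p => metric c p (X p) (Y p)) m (Z m)
    + metric c m (VectorField.lieBracket ℝ X Y m) (Z m)
    - metric c m (VectorField.lieBracket ℝ X Z m) (Y m)
    - metric c m (VectorField.lieBracket ℝ Y Z m) (X m)

/-- The submanifold `L` of `M` is totally geodesic: `∇_X Y` is tangent to `L` along `L` whenever
`X` and `Y` are. -/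
def IsTotallyGeodesic (c : ℝ) (L : Set H2) : Prop :=
  ∀ X Y Z : H2 → H2, ContDiff ℝ ∞ X → ContDiff ℝ ∞ Y → ContDiff ℝ ∞ Z →
    (∀ m ∈ M, X m ∈ TM m ∧ Y m ∈ TM m ∧ Z m ∈ TM m) →
    (∀ m ∈ L, X m ∈ tangentTo L m ∧ Y m ∈ tangentTo L m) →
    ∀ m ∈ L, (∀ W ∈ tangentTo L m, metric c m (Z m) W = 0) → koszul c X Y Z m = 0

/-! ### The action of `T² × SU(2)` and its stratification -/

/-- The group `T² × SU(2) = U(1) × U(1) × Sp(1)`. -/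
abbrev G : Type := Circle × Circle × unitary ℍ[ℝ]

/-- The action `(λ₁, λ₂, γ)(x, a) = (λ₁ x γ̄, λ₂ a γ̄)`. -/
def act (g : G) : H2 →ₗ[ℝ] H2 where
  toFun m := (((g.1 : ℂ) : ℍ[ℝ]) * m.1 * star (g.2.2 : ℍ[ℝ]),
    ((g.2.1 : ℂ) : ℍ[ℝ]) * m.2 * star (g.2.2 : ℍ[ℝ]))
  map_add' m n := by simp [mul_add, add_mul]
  map_smul' r m := by simp

/-- The orbit of `m` under `T² × SU(2)`. -/
def orbit (m : H2) : Set H2 := Set.range fun g : G => act g m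

/-- The stabilizer of `m` in `T² × SU(2)`. -/
def stab (m : H2) : Set G := {g | act g m = m}

/-- `L` is invariant under `T² = T² × {1}`. -/
def IsT2Invariant (L : Set H2) : Prop := ∀ l₁ l₂ : Circle, ∀ m ∈ L, act (l₁, l₂, 1) m ∈ L

/-- The element `w₁ i + w₂ j + w₃ k` of `su(2) = Im ℍ`. -/
def imQ (w : Fin 3 → ℝ) : ℍ[ℝ] := ⟨0, w 0, w 1, w 2⟩

theorem exp_imQ_mem (w : Fin 3 → ℝ) : NormedSpace.exp (imQ w) ∈ unitary ℍ[ℝ] := by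
  have h : Quaternion.normSq (NormedSpace.exp (imQ w)) = 1 := by
    rw [Quaternion.normSq_exp]
    simp [imQ]
  rw [Unitary.mem_iff, Quaternion.star_mul_self, Quaternion.self_mul_star, h]
  simp

/-- The exponential map of `T² × SU(2)`, on its Lie algebra `ℝ ⊕ ℝ ⊕ Im ℍ`. -/
def expG (ξ : ℝ × ℝ × (Fin 3 → ℝ)) : G :=
  (Circle.exp ξ.1, Circle.exp ξ.2.1, ⟨NormedSpace.exp (imQ ξ.2.2), exp_imQ_mem ξ.2.2⟩)

/-- The Lie algebra of the stabilizer of `m`. -/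
def stabLie (m : H2) : Submodule ℝ (ℝ × ℝ × (Fin 3 → ℝ)) :=
  Submodule.span ℝ {ξ | ∀ t : ℝ, expG (t • ξ) ∈ stab m}

/-- The principal set `M_P`: the points of `M` whose stabilizer is, up to conjugation, contained
in the stabilizer of every point of `M`. -/
def principalSet : Set H2 :=
  {m | m ∈ M ∧ ∀ n ∈ M, ∃ g : G, ∀ h ∈ stab m, g * h * g⁻¹ ∈ stab n}

/-- The stratum `S_d`, the points of `M` with `d`-dimensional stabilizer. -/
def stratum (d : ℕ) : Set H2 := {m | m ∈ M ∧ Module.finrank ℝ (stabLie m) = d}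

/-! ### Generators and multi-moment map -/

/-- The first generator of the `T²`-action. -/
def U₁ (m : H2) : H2 := (unit 0 * m.1, 0)

/-- The second generator of the `T²`-action. -/
def U₂ (m : H2) : H2 := (0, unit 0 * m.2)

/-- The generators of the `SU(2)`-action, with `[V_i, V_j] = V_k` for `(i, j, k)` cyclic. -/
def V (l : Fin 3) (m : H2) : H2 := ((1 / 2 : ℝ) • (m.1 * unit l), (1 / 2 : ℝ) • (m.2 * unit l))

/-- The tangent space of the `T²`-orbit of `m`. -/
def torusTangent (m : H2) : Submodule ℝ H2 := Submodule.span ℝ {U₁ m, U₂ m}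

/-- The tangent space of the `T² × SU(2)`-orbit of `m`. -/
def orbitTangent (m : H2) : Submodule ℝ H2 :=
  Submodule.span ℝ ({U₁ m, U₂ m} ∪ Set.range fun l => V l m)

/-- The multi-moment map `μ` for `*φ_c`, normalised by
`μ_k = -*φ_c(U₁, U₂, V_i, V_j)` with `(i, j, k)` cyclic. -/
def mu (c : ℝ) (m : H2) : EuclideanSpace ℝ (Fin 3) :=
  WithLp.toLp 2 fun k => -starPhi c m (U₁ m) (U₂ m) (V (k + 1) m) (V (k + 2) m)

/-- The defining property `dμ_i = *φ_c(U₁, U₂, V_i, ·)` on `M` of a multi-moment map. -/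
def IsMultiMomentMap (c : ℝ) (f : H2 → EuclideanSpace ℝ (Fin 3)) : Prop :=
  ∀ m ∈ M, DifferentiableAt ℝ f m ∧ ∀ X ∈ TM m, ∀ i,
    fderiv ℝ f m X i = starPhi c m (U₁ m) (U₂ m) (V i m) X

/-! ### The base `B` and horizontal lifts -/

/-- The Hopf map `p ↦ p̄ i p`. -/
def hopf (p : ℍ[ℝ]) : ℍ[ℝ] := star p * unit 0 * p

/-- The angle `θ ∈ [0, π]` with `cos θ = ⟨v, w⟩`, where `v` and `w` are the images of `x` and
`a / ‖a‖` under the Hopf map. -/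
def theta (m : H2) : ℝ := Real.arccos ⟪hopf m.1, hopf (‖m.2‖⁻¹ • m.2)⟫_ℝ

/-- The map `(θ, r)`, where `r = ‖a‖`. -/
def proj (m : H2) : ℝ × ℝ := (theta m, ‖m.2‖)

/-- `B = (0, π) × ℝ⁺`. -/
def B : Set (ℝ × ℝ) := Set.Ioo 0 Real.pi ×ˢ Set.Ioi 0

/-- The function `3 r² (c + r²)^(1/3) sin θ` on `B`. -/
def muNorm (c : ℝ) (b : ℝ × ℝ) : ℝ := 3 * b.2 ^ 2 * (c + b.2 ^ 2) ^ (1 / 3 : ℝ) * Real.sin b.1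

/-- `H` is a connection on the principal bundle `M_P / T² → M_P / (T² × SU(2))` for which
`U₁ × U₂` is horizontal. It is given by the preimage in `T M_P` of its horizontal
distribution: `H` is smooth, invariant, and a complement to the tangent spaces of the
`T² × SU(2)`-orbits modulo those of the `T²`-orbits. -/
def IsConnection (c : ℝ) (H : H2 → Submodule ℝ H2) : Prop :=
  (∃ P : H2 → H2 →L[ℝ] H2, ContDiffOn ℝ ∞ P principalSet ∧
    ∀ m ∈ principalSet, H m = LinearMap.range (P m : H2 →ₗ[ℝ] H2)) ∧
  ∀ m ∈ principalSet, H m ⊓ orbitTangent m = torusTangent m ∧ H m ⊔ orbitTangent m = TM m ∧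
    (∀ g : G, (H m).map (act g) = H (act g m)) ∧ ∀ W, IsCross c m (U₁ m) (U₂ m) W → W ∈ H m

/-- The connection induced by the metric: a vector is horizontal if it is orthogonal to
the `T² × SU(2)`-orbit up to a vector tangent to the `T²`-orbit. -/
def metricConnection (c : ℝ) (m : H2) : Submodule ℝ H2 :=
  torusTangent m ⊔
    Submodule.span ℝ {X | X ∈ TM m ∧ ∀ Y ∈ orbitTangent m, metric c m X Y = 0}

/-- The `T²`-invariant set `L` is (the preimage in `M_P` of) a horizontal lift to `M_P / T²` of
the curve `C` in `B`, with respect to `H`. -/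
def IsHorizontalLift (H : H2 → Submodule ℝ H2) (C : Set (ℝ × ℝ)) (L : Set H2) : Prop :=
  L ⊆ principalSet ∧ IsT2Invariant L ∧ proj '' L = C ∧
  (∀ m ∈ L, ∀ n ∈ L, proj m = proj n → ∃ l₁ l₂ : Circle, n = act (l₁, l₂, 1) m) ∧
  ∀ m ∈ L, tangentTo L m ≤ H m

/-! ### The three-form and its adapted coframe -/

theorem inner_expand (p q : ℍ[ℝ]) :
    ⟪p, q⟫_ℝ = p.re * q.re + p.imI * q.imI + p.imJ * q.imJ + p.imK * q.imK := by
  rw [Quaternion.inner_def]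
  simp

theorem star_mul_self_of_mem {m : H2} (hm : m ∈ M) : star m.1 * m.1 = 1 := by
  rw [Quaternion.star_mul_self, Quaternion.normSq_eq_norm_mul_self, (show ‖m.1‖ = 1 from hm)]
  simp

theorem self_mul_star_of_mem {m : H2} (hm : m ∈ M) : m.1 * star m.1 = 1 := by
  rw [Quaternion.self_mul_star, Quaternion.normSq_eq_norm_mul_self, (show ‖m.1‖ = 1 from hm)]
  simp

theorem exists_tangent {m : H2} (hm : m ∈ M) {X : H2} (hX : X ∈ TM m) :
    ∃ p : ℍ[ℝ], X.1 = m.1 * p ∧ p.re = 0 := by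
  refine ⟨star m.1 * X.1, ?_, ?_⟩
  · rw [← mul_assoc, self_mul_star_of_mem hm, one_mul]
  · have h : ⟪m.1, X.1⟫_ℝ = 0 := hX
    rw [inner_expand] at h
    simp
    linarith

theorem eForm_tangent {m : H2} (hm : m ∈ M) {X : H2} {p : ℍ[ℝ]} (hX : X.1 = m.1 * p) (l : Fin 3) :
    eForm l m X = -⟪unit l, p⟫_ℝ := by
  have h : ∀ q : ℍ[ℝ], ⟪m.1 * q, m.1 * p⟫_ℝ = ⟪q, p⟫_ℝ := fun q => by
    rw [Quaternion.inner_def, Quaternion.inner_def, StarMul.star_mul, mul_assoc, ← mul_assoc q]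
    have e : ∀ z : ℍ[ℝ], (m.1 * (z * star m.1)).re = z.re := fun z => by
      have h1 : Quaternion.normSq m.1 = 1 := by
        rw [Quaternion.normSq_eq_norm_mul_self, (show ‖m.1‖ = 1 from hm)]
        norm_num
      rw [Quaternion.normSq_def'] at h1
      simp
      linear_combination z.re * h1
    exact e _
  rw [eForm, hX, h]

theorem vert_tangent {m : H2} (hm : m ∈ M) {X : H2} {p : ℍ[ℝ]} (hX : X.1 = m.1 * p) :
    vert m X = X.2 - (1 / 2 : ℝ) • (m.2 * p) := by
  rw [vert, hX, ← mul_assoc, mul_assoc m.2, star_mul_self_of_mem hm, mul_one]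

theorem unit_components :
    ((unit 0).re = 0 ∧ (unit 0).imI = 1 ∧ (unit 0).imJ = 0 ∧ (unit 0).imK = 0) ∧
    ((unit 1).re = 0 ∧ (unit 1).imI = 0 ∧ (unit 1).imJ = 1 ∧ (unit 1).imK = 0) ∧
    ((unit 2).re = 0 ∧ (unit 2).imI = 0 ∧ (unit 2).imJ = 0 ∧ (unit 2).imK = 1) :=
  ⟨⟨rfl, rfl, rfl, rfl⟩, ⟨rfl, rfl, rfl, rfl⟩, ⟨rfl, rfl, rfl, rfl⟩⟩

theorem phi0_scale (A D : ℝ) (x y z : Fin 3 → ℝ) (a b d : Fin 4 → ℝ) :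
    phi0 (fun l => A * x l, fun l => D * a l) (fun l => A * y l, fun l => D * b l)
      (fun l => A * z l, fun l => D * d l) =
    A ^ 3 * Matrix.det !![x 0, x 1, x 2; y 0, y 1, y 2; z 0, z 1, z 2] +
      A * D ^ 2 * ∑ i : Fin 3, (x i * Omega i (y, b) (z, d) + y i * Omega i (z, d) (x, a) +
        z i * Omega i (x, a) (y, b)) := by
  simp only [phi0, Omega, Matrix.det_fin_three, Fin.sum_univ_three]
  simp
  ring

/-- The adapted coframe identifies `φ_c` with `φ₀`. -/
theorem phi_eq_phi0_coframe {c : ℝ} (hc : 0 < c) {m : H2} (hm : m ∈ M) {X Y Z : H2}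
    (hX : X ∈ TM m) (hY : Y ∈ TM m) (hZ : Z ∈ TM m) :
    phi c m X Y Z = phi0 (coframe c m X) (coframe c m Y) (coframe c m Z) := by
  obtain ⟨p, hp, hp0⟩ := exists_tangent hm hX
  obtain ⟨q, hq, hq0⟩ := exists_tangent hm hY
  obtain ⟨s, hs, hs0⟩ := exists_tangent hm hZ
  have hR : 0 < c + ‖m.2‖ ^ 2 := by positivity
  have hn : ‖m.2‖ ^ 2 = m.2.re ^ 2 + m.2.imI ^ 2 + m.2.imJ ^ 2 + m.2.imK ^ 2 := by
    rw [pow_two, ← Quaternion.normSq_eq_norm_mul_self, Quaternion.normSq_def']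
  have h3 : √3 ^ 2 = (3 : ℝ) := Real.sq_sqrt (by norm_num)
  obtain ⟨A, hA⟩ : ∃ A, A = √3 * (c + ‖m.2‖ ^ 2) ^ (1 / 3 : ℝ) := ⟨_, rfl⟩
  obtain ⟨D, hD⟩ : ∃ D, D = 2 * (c + ‖m.2‖ ^ 2) ^ (-(1 / 6) : ℝ) := ⟨_, rfl⟩
  have hA3 : A ^ 3 = 3 * √3 * (c + ‖m.2‖ ^ 2) := by
    rw [hA, mul_pow, ← Real.rpow_natCast (_ ^ (1 / 3 : ℝ)), ← Real.rpow_mul hR.le]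
    norm_num
    left
    linear_combination √3 * h3
  have hAD : A * D ^ 2 = 4 * √3 := by
    rw [hA, hD, mul_pow, ← Real.rpow_natCast (_ ^ (-(1 / 6) : ℝ)), ← Real.rpow_mul hR.le,
      mul_assoc, mul_left_comm (_ ^ (1 / 3 : ℝ)), ← Real.rpow_add hR]
    norm_num
    ring
  simp only [coframe, ← hA, ← hD]
  rw [phi0_scale, hA3, hAD, hn]
  simp only [phi, Omega, Matrix.det_fin_three, Fin.sum_univ_three, eForm_tangent hm hp,
    eForm_tangent hm hq, eForm_tangent hm hs, vert_tangent hm hp, vert_tangent hm hq,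
    vert_tangent hm hs, alphaForm, dAlphaForm, inner_expand]
  simp [hp0, hq0, hs0, unit_components]
  ring

theorem coframe_injOn {c : ℝ} (hc : 0 < c) {m : H2} (hm : m ∈ M) :
    Set.InjOn (coframe c m) (TM m) := by
  intro X hX Y hY h
  obtain ⟨p, hp, hp0⟩ := exists_tangent hm hX
  obtain ⟨q, hq, hq0⟩ := exists_tangent hm hY
  have hR : 0 < c + ‖m.2‖ ^ 2 := by positivity
  have h1 : √3 * (c + ‖m.2‖ ^ 2) ^ (1 / 3 : ℝ) ≠ 0 := by positivity
  have h2 : 2 * (c + ‖m.2‖ ^ 2) ^ (-(1 / 6) : ℝ) ≠ 0 := by positivity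
  have ha : ∀ l, eForm l m X = eForm l m Y := fun l =>
    mul_left_cancel₀ h1 (congrFun (congrArg Prod.fst h) l)
  have hb := fun l => mul_left_cancel₀ h2 (congrFun (congrArg Prod.snd h) l)
  have hpq : p = q := by
    simp only [eForm_tangent hm hp, eForm_tangent hm hq, inner_expand, unit] at ha
    have a0 := ha 0
    have a1 := ha 1
    have a2 := ha 2
    simp at a0 a1 a2
    exact Quaternion.ext _ _ (hp0.trans hq0.symm) a0 a1 a2
  have hv : vert m X = vert m Y := Quaternion.ext _ _ (hb 0) (hb 1) (hb 2) (hb 3)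
  rw [vert_tangent hm hp, vert_tangent hm hq, hpq, sub_left_inj] at hv
  exact Prod.ext (by rw [hp, hq, hpq]) hv

end BryantSalamon

end

open BryantSalamon

noncomputable section

namespace BryantSalamon

/-! ### Quaternions -/

/-! The proof reads everything off the Hopf map `hopf p = p̄ i p`. A complex unit on the left
commutes with `i` and cancels, while a factor γ̄ on the right conjugates the value by γ. So T² ×
SU(2) acts on v = `hopf x` and r²w = `hopf a` by simultaneous rotation (`hopf_act`). The inner
product r² cos θ (`hopfInner`) and r are invariants, and on the principal set they separate the
orbits (`mem_orbit_of_invariants`). The cross product n = v × r²w (`hopfCross`) decides the stratum.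
If n ≠ 0, a stabilizing γ commutes with two independent imaginary quaternions, hence is real, and
the element acts trivially. If n = 0, then a = 0 or w = ±v, and an involution (i, ±i, v) fixes the
point. The linear equations of the infinitesimal stabilizer then give the dimensions 0, 1 and 2
only. In the adapted coframe μ = 3(c + r²)^(1/3) n (`mu_apply`), which gives |μ| on B.

The zero section, and the closures of the fibres of S₁, are fixed point sets of isometric
involutions in the group, namely of (x, a) ↦ (x, -a) and of (i, ±i, v). Every term of the Koszul
expression is odd under such an involution, so these sets are totally geodesic
(`isTotallyGeodesic_of_fixed`). Associativity is tested on any frame of a plane by φ² = det(Gram)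
(`isAssociativePlane_of_gram`).

On the principal set, U₁ × U₂ is orthogonal to the orbits, so it is a combination of `angularField`
and `radialField`; `crossField` is a positive multiple of it. The associatives are the torus orbits
swept along its integral curves. Along these |μ| and ν = n/|n| are constant, and v, w turn in the
fixed plane orthogonal to ν. With t = cot θ as parameter, the level set |μ| = 3 exp k is a graph
over all t (`logRadius`), and v turns through an angle given by an integral depending only on k and
t (`fibreAngle`). Turning v back by this angle gives a vector u constant along the curve, and (|μ|;
u, ν × u, ν) is the fibration `principalMap` onto ℝ⁺ × SO(3).

Lifting the rotation locally to a unit quaternion parametrizes each fibre by T² × ℝ (`fibrePoint`,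
with inverse `fibreCoord`). Differentiating (`hasDerivAt_fibrePoint`) identifies the tangent spaces
as the span of U₁, U₂ and U₁ × U₂. This span is associative, and it is horizontal for every
connection of the kind considered because those three vectors are. -/

@[simp] theorem imQ_re (w : Fin 3 → ℝ) : (imQ w).re = 0 := rfl
@[simp] theorem imQ_imI (w : Fin 3 → ℝ) : (imQ w).imI = w 0 := rfl
@[simp] theorem imQ_imJ (w : Fin 3 → ℝ) : (imQ w).imJ = w 1 := rfl
@[simp] theorem imQ_imK (w : Fin 3 → ℝ) : (imQ w).imK = w 2 := rfl

section Smoothness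

variable {n : ℕ∞ω}

@[fun_prop] theorem contDiff_re : ContDiff ℝ n (fun q : ℍ[ℝ] => q.re) :=
  (LinearMap.toContinuousLinearMap (E := ℍ[ℝ]) (F' := ℝ)
    { toFun := fun q => q.re, map_add' := fun _ _ => rfl, map_smul' := fun _ _ => rfl }).contDiff

@[fun_prop] theorem contDiff_imI : ContDiff ℝ n (fun q : ℍ[ℝ] => q.imI) :=
  (LinearMap.toContinuousLinearMap (E := ℍ[ℝ]) (F' := ℝ)
    { toFun := fun q => q.imI, map_add' := fun _ _ => rfl, map_smul' := fun _ _ => rfl }).contDiff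

@[fun_prop] theorem contDiff_imJ : ContDiff ℝ n (fun q : ℍ[ℝ] => q.imJ) :=
  (LinearMap.toContinuousLinearMap (E := ℍ[ℝ]) (F' := ℝ)
    { toFun := fun q => q.imJ, map_add' := fun _ _ => rfl, map_smul' := fun _ _ => rfl }).contDiff

@[fun_prop] theorem contDiff_imK : ContDiff ℝ n (fun q : ℍ[ℝ] => q.imK) :=
  (LinearMap.toContinuousLinearMap (E := ℍ[ℝ]) (F' := ℝ)
    { toFun := fun q => q.imK, map_add' := fun _ _ => rfl, map_smul' := fun _ _ => rfl }).contDiff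

@[fun_prop] theorem contDiff_star_quaternion : ContDiff ℝ n (fun q : ℍ[ℝ] => star q) :=
  (LinearMap.toContinuousLinearMap (E := ℍ[ℝ]) (F' := ℍ[ℝ])
    { toFun := fun q => star q, map_add' := star_add, map_smul' := fun _ _ => by simp }).contDiff

@[fun_prop] theorem contDiff_coeComplex : ContDiff ℝ n (fun z : ℂ => (z : ℍ[ℝ])) :=
  (LinearMap.toContinuousLinearMap (E := ℂ) (F' := ℍ[ℝ])
    { toFun := fun z => (z : ℍ[ℝ]), map_add' := fun _ _ => by simp
      map_smul' := fun _ _ => by ext <;> simp }).contDiff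

@[fun_prop] theorem contDiff_imQ : ContDiff ℝ n imQ :=
  (LinearMap.toContinuousLinearMap (E := Fin 3 → ℝ) (F' := ℍ[ℝ])
    { toFun := imQ, map_add' := fun _ _ => by ext <;> simp
      map_smul' := fun _ _ => by ext <;> simp }).contDiff

@[fun_prop] theorem contDiff_inner_quaternion :
    ContDiff ℝ n (fun p : ℍ[ℝ] × ℍ[ℝ] => ⟪p.1, p.2⟫_ℝ) := contDiff_inner

@[fun_prop] theorem contDiff_act (g : G) : ContDiff ℝ n (act g) :=
  (LinearMap.toContinuousLinearMap (act g)).contDiff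

end Smoothness

/-! ### Norms and inner products of quaternions -/

theorem normSq_expand (p : ℍ[ℝ]) : ‖p‖ ^ 2 = p.re ^ 2 + p.imI ^ 2 + p.imJ ^ 2 + p.imK ^ 2 := by
  rw [pow_two, ← Quaternion.normSq_eq_norm_mul_self, Quaternion.normSq_def']

theorem star_mul_self_eq (p : ℍ[ℝ]) : star p * p = ((‖p‖ ^ 2 : ℝ) : ℍ[ℝ]) := by
  rw [Quaternion.star_mul_self, Quaternion.normSq_eq_norm_mul_self, pow_two]

theorem self_mul_star_eq (p : ℍ[ℝ]) : p * star p = ((‖p‖ ^ 2 : ℝ) : ℍ[ℝ]) := by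
  rw [Quaternion.self_mul_star, Quaternion.normSq_eq_norm_mul_self, pow_two]

theorem star_mul_of_norm_one {p : ℍ[ℝ]} (h : ‖p‖ = 1) : star p * p = 1 := by
  rw [star_mul_self_eq, h]; simp

theorem mul_star_of_norm_one {p : ℍ[ℝ]} (h : ‖p‖ = 1) : p * star p = 1 := by
  rw [self_mul_star_eq, h]; simp

theorem norm_unitary (γ : unitary ℍ[ℝ]) : ‖(γ : ℍ[ℝ])‖ = 1 := CStarRing.norm_coe_unitary γ

theorem mem_unitary_of_norm {p : ℍ[ℝ]} (h : ‖p‖ = 1) : p ∈ unitary ℍ[ℝ] :=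
  Unitary.mem_iff.2 ⟨star_mul_of_norm_one h, mul_star_of_norm_one h⟩

theorem norm_coeComplex (z : ℂ) : ‖(z : ℍ[ℝ])‖ = ‖z‖ := by
  rw [← sq_eq_sq₀ (norm_nonneg _) (norm_nonneg _), normSq_expand, Complex.sq_norm,
    Complex.normSq_apply]
  simp; ring

theorem norm_coeCircle (z : Circle) : ‖(((z : ℂ)) : ℍ[ℝ])‖ = 1 := by
  rw [norm_coeComplex, Circle.norm_coe]

@[simp] theorem unit_zero_re : (unit 0).re = 0 := rfl
@[simp] theorem unit_zero_imI : (unit 0).imI = 1 := rfl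
@[simp] theorem unit_zero_imJ : (unit 0).imJ = 0 := rfl
@[simp] theorem unit_zero_imK : (unit 0).imK = 0 := rfl
@[simp] theorem unit_one_re : (unit 1).re = 0 := rfl
@[simp] theorem unit_one_imI : (unit 1).imI = 0 := rfl
@[simp] theorem unit_one_imJ : (unit 1).imJ = 1 := rfl
@[simp] theorem unit_one_imK : (unit 1).imK = 0 := rfl
@[simp] theorem unit_two_re : (unit 2).re = 0 := rfl
@[simp] theorem unit_two_imI : (unit 2).imI = 0 := rfl
@[simp] theorem unit_two_imJ : (unit 2).imJ = 0 := rfl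
@[simp] theorem unit_two_imK : (unit 2).imK = 1 := rfl

theorem unit_re (l : Fin 3) : (unit l).re = 0 := by fin_cases l <;> rfl

theorem norm_unit (l : Fin 3) : ‖unit l‖ = 1 := by
  rw [← sq_eq_sq₀ (norm_nonneg _) zero_le_one, normSq_expand]
  fin_cases l <;> simp

theorem inner_mul_left_mul_left (p q s : ℍ[ℝ]) : ⟪p * q, p * s⟫_ℝ = ‖p‖ ^ 2 * ⟪q, s⟫_ℝ := by
  rw [inner_expand, inner_expand, normSq_expand]
  simp; ring

theorem inner_mul_right_mul_right (p q s : ℍ[ℝ]) : ⟪q * p, s * p⟫_ℝ = ‖p‖ ^ 2 * ⟪q, s⟫_ℝ := by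
  rw [inner_expand, inner_expand, normSq_expand]
  simp; ring

/-- A quaternion commuting with `i` is a complex number. -/
theorem eq_coeComplex_of_commute {p : ℍ[ℝ]} (h : unit 0 * p = p * unit 0) :
    p = ((⟨p.re, p.imI⟩ : ℂ) : ℍ[ℝ]) := by
  have h2 := congrArg QuaternionAlgebra.imJ h
  have h3 := congrArg QuaternionAlgebra.imK h
  simp at h2 h3
  ext <;> simp <;> linarith

theorem unit_mul_coeComplex (z : ℂ) : unit 0 * (z : ℍ[ℝ]) = (z : ℍ[ℝ]) * unit 0 := by
  ext <;> simp

/-- If `x` and `y` intertwine `i` with the same `v`, then `x ȳ` is a complex number. -/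
theorem exists_coeComplex_of_intertwine {x y v : ℍ[ℝ]} (hv : star v = -v)
    (hx : unit 0 * x = x * v) (hy : unit 0 * y = y * v) :
    ∃ z : ℂ, x * star y = (z : ℍ[ℝ]) := by
  refine ⟨_, eq_coeComplex_of_commute ?_⟩
  have hu : star (unit 0) = -unit 0 := by ext <;> simp
  have h := congrArg star hy
  rw [star_mul, star_mul, hu, hv] at h
  rw [← mul_assoc, hx, mul_assoc, mul_assoc]
  congr 1
  rw [mul_neg, neg_mul] at h
  rw [neg_inj.1 h]

theorem star_eq_neg {p : ℍ[ℝ]} (h : p.re = 0) : star p = -p := by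
  ext <;> simp [h]

/-! ### The Hopf map -/

@[fun_prop] theorem contDiff_hopf {n : ℕ∞ω} : ContDiff ℝ n hopf := by
  unfold hopf; fun_prop

@[simp] theorem hopf_re (p : ℍ[ℝ]) : (hopf p).re = 0 := by
  simp [hopf]; ring

theorem star_hopf (p : ℍ[ℝ]) : star (hopf p) = -hopf p := star_eq_neg (hopf_re p)

theorem norm_hopf (p : ℍ[ℝ]) : ‖hopf p‖ = ‖p‖ ^ 2 := by
  rw [hopf, norm_mul, norm_mul, norm_unit, Quaternion.norm_star]; ring

theorem hopf_smul (r : ℝ) (p : ℍ[ℝ]) : hopf (r • p) = (r ^ 2) • hopf p := by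
  simp [hopf, smul_smul, pow_two]

/-- The intertwining relation between `i` and the Hopf image, freed of denominators so that it also
holds at p = 0. -/
theorem mul_hopf (p : ℍ[ℝ]) : p * hopf p = (‖p‖ ^ 2) • (unit 0 * p) := by
  rw [hopf, mul_assoc, ← mul_assoc, self_mul_star_eq, Quaternion.coe_mul_eq_smul]

/-- The relation i p = p v is linear in p. It replaces the quadratic condition on the Hopf image
throughout, so that fibres of the Hopf map become pieces of linear subspaces. -/
theorem hopf_eq_of_intertwine {p v : ℍ[ℝ]} (h : unit 0 * p = p * v) :
    hopf p = (‖p‖ ^ 2) • v := by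
  rw [hopf, mul_assoc, h, ← mul_assoc, star_mul_self_eq, Quaternion.coe_mul_eq_smul]

theorem intertwine_hopf {p : ℍ[ℝ]} (h : ‖p‖ = 1) : unit 0 * p = p * hopf p := by
  rw [mul_hopf, h]; simp

/-- The circle element commutes with `i` and cancels against its conjugate; the factor on the right
survives as a conjugation. -/
theorem hopf_act (l : Circle) (p : ℍ[ℝ]) {γ : ℍ[ℝ]} :
    hopf (((l : ℂ) : ℍ[ℝ]) * p * star γ) = γ * hopf p * star γ := by
  have h : star ((l : ℂ) : ℍ[ℝ]) * (unit 0 * ((l : ℂ) : ℍ[ℝ])) = unit 0 := by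
    rw [unit_mul_coeComplex, ← mul_assoc, star_mul_of_norm_one (norm_coeCircle l), one_mul]
  simp only [hopf, star_mul, star_star]
  calc _ = γ * (star p * (star ((l : ℂ) : ℍ[ℝ]) * (unit 0 * ((l : ℂ) : ℍ[ℝ]))) * p) * star γ := by
        simp only [mul_assoc]
    _ = _ := by rw [h]

/-! ### The action -/

theorem act_fst (g : G) (m : H2) :
    (act g m).1 = ((g.1 : ℂ) : ℍ[ℝ]) * m.1 * star (g.2.2 : ℍ[ℝ]) := rfl

theorem act_snd (g : G) (m : H2) :
    (act g m).2 = ((g.2.1 : ℂ) : ℍ[ℝ]) * m.2 * star (g.2.2 : ℍ[ℝ]) := rfl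

theorem norm_act_fst (g : G) (m : H2) : ‖(act g m).1‖ = ‖m.1‖ := by
  rw [act_fst, norm_mul, norm_mul, norm_coeCircle, Quaternion.norm_star, norm_unitary]; ring

theorem norm_act_snd (g : G) (m : H2) : ‖(act g m).2‖ = ‖m.2‖ := by
  rw [act_snd, norm_mul, norm_mul, norm_coeCircle, Quaternion.norm_star, norm_unitary]; ring

theorem act_mem_M {m : H2} (hm : m ∈ M) (g : G) : act g m ∈ M := (norm_act_fst g m).trans hm

theorem act_mul (g h : G) (m : H2) : act (g * h) m = act g (act h m) := by
  ext1
  · simp only [act_fst]; simp [mul_assoc]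
  · simp only [act_snd]; simp [mul_assoc]

theorem act_one (m : H2) : act 1 m = m := by
  ext1
  · simp only [act_fst]; simp
  · simp only [act_snd]; simp

theorem act_inv_act (g : G) (m : H2) : act g⁻¹ (act g m) = m := by
  rw [← act_mul, inv_mul_cancel, act_one]

theorem act_act_inv (g : G) (m : H2) : act g (act g⁻¹ m) = m := by
  rw [← act_mul, mul_inv_cancel, act_one]

theorem mem_TM {m X : H2} : X ∈ TM m ↔ ⟪m.1, X.1⟫_ℝ = 0 := Iff.rfl

theorem act_mem_TM {m X : H2} (g : G) (hX : X ∈ TM m) : act g X ∈ TM (act g m) := by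
  rw [mem_TM, act_fst, act_fst, inner_mul_right_mul_right, inner_mul_left_mul_left,
    mem_TM.1 hX]
  simp

theorem sum_inner_unit (p q : ℍ[ℝ]) :
    ∑ l, ⟪unit l, p⟫_ℝ * ⟪unit l, q⟫_ℝ = p.imI * q.imI + p.imJ * q.imJ + p.imK * q.imK := by
  simp [Fin.sum_univ_three, inner_expand]

theorem inner_mul_unit (p q : ℍ[ℝ]) (l : Fin 3) : ⟪p * unit l, q⟫_ℝ = ⟪unit l, star p * q⟫_ℝ := by
  rw [inner_expand, inner_expand]
  simp; ring

theorem inner_imaginary (p q : ℍ[ℝ]) :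
    p.imI * q.imI + p.imJ * q.imJ + p.imK * q.imK = ⟪p, q⟫_ℝ - p.re * q.re := by
  rw [inner_expand]; ring

/-- A coordinate-free expression of the metric. -/
theorem metric_eq (c : ℝ) (m X Y : H2) : metric c m X Y =
    (√3 * (c + ‖m.2‖ ^ 2) ^ (1 / 3 : ℝ)) ^ 2 *
      (⟪star m.1 * X.1, star m.1 * Y.1⟫_ℝ - (star m.1 * X.1).re * (star m.1 * Y.1).re) +
    (2 * (c + ‖m.2‖ ^ 2) ^ (-(1 / 6) : ℝ)) ^ 2 * ⟪vert m X, vert m Y⟫_ℝ := by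
  rw [← inner_imaginary, ← sum_inner_unit, inner_expand]
  simp only [metric, coframe, eForm, inner_mul_unit, Fin.sum_univ_three, Fin.sum_univ_four]
  simp
  ring

theorem vert_act (g : G) (m X : H2) :
    vert (act g m) (act g X) = ((g.2.1 : ℂ) : ℍ[ℝ]) * vert m X * star (g.2.2 : ℍ[ℝ]) := by
  simp only [vert, act_fst, act_snd, star_mul, star_star, mul_sub, sub_mul, mul_smul_comm,
    smul_mul_assoc]
  congr 2
  calc _ = ((g.2.1 : ℂ) : ℍ[ℝ]) * m.2 * (star (g.2.2 : ℍ[ℝ]) * g.2.2) * star m.1 *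
        (star ((g.1 : ℂ) : ℍ[ℝ]) * ((g.1 : ℂ) : ℍ[ℝ])) * X.1 * star (g.2.2 : ℍ[ℝ]) := by
        simp only [mul_assoc]
    _ = _ := by
        rw [star_mul_of_norm_one (norm_unitary _), star_mul_of_norm_one (norm_coeCircle _)]
        simp only [mul_assoc, mul_one]

/-- The form `x̄ X` is conjugated by γ and the vertical form is multiplied by units on both sides,
neither of which affects inner products or real parts. The point m is not required to lie on M: the
metric is later differentiated along straight lines that leave M. -/
theorem metric_act (c : ℝ) (g : G) (m X Y : H2) :
    metric c (act g m) (act g X) (act g Y) = metric c m X Y := by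
  have h : ∀ Z : H2, star (act g m).1 * (act g Z).1 =
      (g.2.2 : ℍ[ℝ]) * (star m.1 * Z.1) * star (g.2.2 : ℍ[ℝ]) := fun Z => by
    rw [act_fst, act_fst, star_mul, star_mul, star_star]
    calc _ = (g.2.2 : ℍ[ℝ]) * star m.1 * (star ((g.1 : ℂ) : ℍ[ℝ]) * ((g.1 : ℂ) : ℍ[ℝ])) * Z.1 *
          star (g.2.2 : ℍ[ℝ]) := by simp only [mul_assoc]
      _ = _ := by
          rw [star_mul_of_norm_one (norm_coeCircle _)]
          simp only [mul_assoc, mul_one]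
  have hre : ∀ q : ℍ[ℝ], ((g.2.2 : ℍ[ℝ]) * q * star (g.2.2 : ℍ[ℝ])).re = q.re := fun q => by
    have hn := normSq_expand (g.2.2 : ℍ[ℝ])
    rw [norm_unitary] at hn
    simp
    linear_combination -q.re * hn
  rw [metric_eq, metric_eq, h, h, vert_act, vert_act, norm_act_snd, hre, hre]
  simp only [inner_mul_right_mul_right, inner_mul_left_mul_left, Quaternion.norm_star,
    norm_unitary, norm_coeCircle]
  ring

/-! ### The invariants of the action -/

/-- `⟨v, r² w⟩`, where `v` and `w` are the Hopf images of `x` and `a / ‖a‖`. -/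
def hopfInner (m : H2) : ℝ := ⟪hopf m.1, hopf m.2⟫_ℝ

/-- The cross product `v × r² w`, where `v` and `w` are the Hopf images of `x` and `a / ‖a‖`. -/
def hopfCross (m : H2) : ℍ[ℝ] := hopf m.1 * hopf m.2 + (hopfInner m : ℍ[ℝ])

@[fun_prop] theorem contDiff_hopfInner {n : ℕ∞ω} : ContDiff ℝ n hopfInner := by
  unfold hopfInner; fun_prop

theorem hopfCross_eq (m : H2) : hopfCross m =
    hopf m.1 * hopf m.2 + (⟪hopf m.1, hopf m.2⟫_ℝ) • (1 : ℍ[ℝ]) := by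
  rw [hopfCross, hopfInner, ← Quaternion.coe_mul_eq_smul, mul_one]

@[fun_prop] theorem contDiff_hopfCross {n : ℕ∞ω} : ContDiff ℝ n hopfCross := by
  rw [funext hopfCross_eq]; fun_prop

theorem hopfInner_expand (m : H2) : hopfInner m = (hopf m.1).imI * (hopf m.2).imI +
    (hopf m.1).imJ * (hopf m.2).imJ + (hopf m.1).imK * (hopf m.2).imK := by
  simp [hopfInner, inner_expand]

@[simp] theorem hopfCross_re (m : H2) : (hopfCross m).re = 0 := by
  simp [hopfCross, hopfInner_expand]

theorem hopfCross_imI (m : H2) : (hopfCross m).imI =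
    (hopf m.1).imJ * (hopf m.2).imK - (hopf m.1).imK * (hopf m.2).imJ := by
  simp [hopfCross]

theorem hopfCross_imJ (m : H2) : (hopfCross m).imJ =
    (hopf m.1).imK * (hopf m.2).imI - (hopf m.1).imI * (hopf m.2).imK := by
  simp [hopfCross]; ring

theorem hopfCross_imK (m : H2) : (hopfCross m).imK =
    (hopf m.1).imI * (hopf m.2).imJ - (hopf m.1).imJ * (hopf m.2).imI := by
  simp [hopfCross]

/-- Lagrange's identity for the vectors v and r²w, of lengths 1 and r². -/
theorem norm_hopfCross_sq_add {m : H2} (hm : m ∈ M) :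
    ‖hopfCross m‖ ^ 2 + hopfInner m ^ 2 = ‖m.2‖ ^ 4 := by
  have h1 := congrArg (· ^ 2) (norm_hopf m.1)
  have h2 := congrArg (· ^ 2) (norm_hopf m.2)
  simp only [normSq_expand (hopf _), (show ‖m.1‖ = 1 from hm), hopf_re] at h1 h2
  rw [normSq_expand, hopfCross_re, hopfCross_imI, hopfCross_imJ, hopfCross_imK, hopfInner_expand]
  linear_combination ‖m.2‖ ^ 4 * h1 + ((hopf m.1).imI ^ 2 + (hopf m.1).imJ ^ 2 +
    (hopf m.1).imK ^ 2) * h2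

theorem hopfInner_act (g : G) (m : H2) : hopfInner (act g m) = hopfInner m := by
  rw [hopfInner, act_fst, act_snd, hopf_act, hopf_act, inner_mul_right_mul_right,
    inner_mul_left_mul_left, Quaternion.norm_star, norm_unitary, hopfInner]
  ring

theorem snd_ne_zero {m : H2} (h : hopfCross m ≠ 0) : m.2 ≠ 0 := by
  rintro h0
  apply h
  simp [hopfCross, hopfInner, h0, hopf]

/-- If `v × r² w = 0` then `w = ± v`. -/
theorem exists_sign_of_hopfCross_eq_zero {m : H2} (hm : m ∈ M) (h : hopfCross m = 0) :
    ∃ e : ℝ, (e = 1 ∨ e = -1) ∧ unit 0 * m.2 = e • (m.2 * hopf m.1) := by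
  rcases eq_or_ne m.2 0 with h0 | h0
  · exact ⟨1, Or.inl rfl, by simp [h0]⟩
  have hr : ‖m.2‖ ^ 2 ≠ 0 := by simpa using h0
  have hv : hopf m.1 * hopf m.1 = -1 := by
    have := star_mul_of_norm_one (p := hopf m.1) (by rw [norm_hopf, (show ‖m.1‖ = 1 from hm)]; simp)
    rw [star_hopf, neg_mul] at this
    rw [← this, neg_neg]
  have hw : hopf m.2 = hopfInner m • hopf m.1 := by
    have := congrArg (hopf m.1 * ·) h
    simp only [hopfCross, mul_add, ← mul_assoc, hv, mul_zero, Quaternion.mul_coe_eq_smul] at this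
    rw [neg_mul, one_mul, neg_add_eq_zero] at this
    exact this
  refine ⟨hopfInner m / ‖m.2‖ ^ 2, ?_, ?_⟩
  · have h2 := norm_hopfCross_sq_add hm
    rw [h, norm_zero] at h2
    have : (hopfInner m - ‖m.2‖ ^ 2) * (hopfInner m + ‖m.2‖ ^ 2) = 0 := by linear_combination h2
    rcases mul_eq_zero.1 this with h3 | h3
    · left; rw [sub_eq_zero.1 h3, div_self hr]
    · right; rw [eq_neg_of_add_eq_zero_left h3, neg_div, div_self hr]
  · have h3 := mul_hopf m.2
    rw [hw, mul_smul_comm] at h3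
    rw [div_eq_inv_mul, ← smul_smul, h3, smul_smul, inv_mul_cancel₀ hr, one_smul]

/-- The factor e may be any real number here; this is used with a ratio of Lie algebra components in
`finrank_stabLie_principal`. -/
theorem hopfCross_eq_zero_of_sign {m : H2} {e : ℝ}
    (h : unit 0 * m.2 = e • (m.2 * hopf m.1)) : hopfCross m = 0 := by
  have h1 : hopf m.2 = (‖m.2‖ ^ 2) • (e • hopf m.1) :=
    hopf_eq_of_intertwine (by rw [h, mul_smul_comm])
  ext
  · simp
  · rw [hopfCross_imI, h1]; simp; ring
  · rw [hopfCross_imJ, h1]; simp; ring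
  · rw [hopfCross_imK, h1]; simp; ring

/-! ### Involutions in the group -/

/-- The element `± i` of the circle. -/
def signedI (e : ℝ) (he : e = 1 ∨ e = -1) : Circle :=
  ⟨(e : ℂ) * Complex.I, by rcases he with rfl | rfl <;> simp [Submonoid.unitSphere]⟩

theorem coe_signedI (e : ℝ) (he : e = 1 ∨ e = -1) :
    (((signedI e he : Circle) : ℂ) : ℍ[ℝ]) = e • unit 0 := by
  ext <;> simp [signedI]

/-- The element `(i, ± i, v)` of the group, for a unit imaginary quaternion `v`. -/
def involution (e : ℝ) (he : e = 1 ∨ e = -1) (v : ℍ[ℝ]) (hv : ‖v‖ = 1) : G :=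
  (signedI 1 (Or.inl rfl), signedI e he, ⟨v, mem_unitary_of_norm hv⟩)

theorem act_involution_eq_iff {e : ℝ} (he : e = 1 ∨ e = -1) {v : ℍ[ℝ]} (hv : ‖v‖ = 1) (X : H2) :
    act (involution e he v hv) X = X ↔
      unit 0 * X.1 = X.1 * v ∧ unit 0 * X.2 = e • (X.2 * v) := by
  have key : ∀ p q : ℍ[ℝ], p * star v = q ↔ p = q * v := fun p q => by
    constructor
    · rintro rfl; rw [mul_assoc, star_mul_of_norm_one hv, mul_one]
    · rintro rfl; rw [mul_assoc, mul_star_of_norm_one hv, mul_one]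
  rw [Prod.ext_iff, act_fst, act_snd]
  simp only [involution, coe_signedI, one_smul, key, smul_mul_assoc]
  refine and_congr_right fun _ => ?_
  have hee : e * e = 1 := by rcases he with rfl | rfl <;> norm_num
  rw [← smul_mul_assoc, ← smul_mul_assoc, key]
  constructor
  · intro h; rw [← h, smul_mul_assoc, smul_smul, hee, one_smul]
  · intro h; rw [smul_mul_assoc, h, smul_smul, hee, one_smul]

/-- Each of the three components squares to -1, and the signs cancel in pairs. -/
theorem act_involution_involution {e : ℝ} (he : e = 1 ∨ e = -1) {v : ℍ[ℝ]} (hv : ‖v‖ = 1)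
    (hv0 : v.re = 0) (X : H2) :
    act (involution e he v hv) (act (involution e he v hv) X) = X := by
  have hee : e * e = 1 := by rcases he with rfl | rfl <;> norm_num
  have hu : ∀ p : ℍ[ℝ], unit 0 * (unit 0 * p) = -p := fun p => by ext <;> simp
  have hvv : ∀ p : ℍ[ℝ], p * star v * star v = -p := fun p => by
    have h := star_mul_of_norm_one hv
    rw [star_eq_neg hv0, neg_mul] at h
    have h' : v * v = -1 := by rw [← h, neg_neg]
    simp [star_eq_neg hv0, mul_assoc, h']
  ext1
  · simp only [act_fst]
    simp only [involution, coe_signedI, one_smul]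
    rw [← mul_assoc, hvv, hu, neg_neg]
  · simp only [act_snd]
    simp only [involution, coe_signedI, smul_mul_assoc, mul_smul_comm]
    rw [← mul_assoc, hvv, smul_smul, hee, hu, neg_neg, one_smul]

/-! ### The principal set -/

/-- A vector parallel to both p and q vanishes when p × q = m is nonzero. The proof shows that every
product of a coordinate of u with a coordinate of m is zero. -/
theorem eq_zero_of_cross_eq_zero {u m : Fin 3 → ℝ} {p q : Fin 3 → ℝ}
    (hm0 : m 0 = p 1 * q 2 - p 2 * q 1) (hm1 : m 1 = p 2 * q 0 - p 0 * q 2)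
    (hm2 : m 2 = p 0 * q 1 - p 1 * q 0)
    (hp : ∀ a b, u a * p b = u b * p a) (hq : ∀ a b, u a * q b = u b * q a) (hm : m ≠ 0) :
    u = 0 := by
  have h01 : u 0 * m 1 = 0 := by
    rw [hm1]; linear_combination q 0 * hp 0 2 - p 0 * hq 0 2
  have h02 : u 0 * m 2 = 0 := by
    rw [hm2]; linear_combination p 0 * hq 0 1 - q 0 * hp 0 1
  have h10 : u 1 * m 0 = 0 := by
    rw [hm0]; linear_combination p 1 * hq 1 2 - q 1 * hp 1 2
  have h12 : u 1 * m 2 = 0 := by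
    rw [hm2]; linear_combination q 1 * hp 1 0 - p 1 * hq 1 0
  have h20 : u 2 * m 0 = 0 := by
    rw [hm0]; linear_combination q 2 * hp 2 1 - p 2 * hq 2 1
  have h21 : u 2 * m 1 = 0 := by
    rw [hm1]; linear_combination p 2 * hq 2 0 - q 2 * hp 2 0
  -- The diagonal products are reached only through their pairwise sums, and three vanishing
  -- pairwise sums force each term to vanish.
  have e1 : u 0 * m 0 + u 1 * m 1 = 0 := by
    rw [hm0, hm1]; linear_combination q 2 * hp 0 1 - p 2 * hq 0 1
  have e2 : u 0 * m 0 + u 2 * m 2 = 0 := by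
    rw [hm0, hm2]; linear_combination p 1 * hq 0 2 - q 1 * hp 0 2
  have e3 : u 1 * m 1 + u 2 * m 2 = 0 := by
    rw [hm1, hm2]; linear_combination q 0 * hp 1 2 - p 0 * hq 1 2
  have h00 : u 0 * m 0 = 0 := by linarith
  have h11 : u 1 * m 1 = 0 := by linarith
  have h22 : u 2 * m 2 = 0 := by linarith
  obtain ⟨a, ha⟩ : ∃ a, m a ≠ 0 := by
    by_contra! hh
    exact hm (funext hh)
  have h : ∀ b, u b * m a = 0 := by
    intro b; fin_cases a <;> fin_cases b <;> assumption
  exact funext fun b => (mul_eq_zero.1 (h b)).resolve_right ha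

/-- A quaternion commuting with two independent imaginary quaternions is real. -/
theorem im_eq_zero_of_commute {m : H2} (h : hopfCross m ≠ 0) {γ : ℍ[ℝ]}
    (h1 : γ * hopf m.1 = hopf m.1 * γ) (h2 : γ * hopf m.2 = hopf m.2 * γ) :
    γ = (γ.re : ℍ[ℝ]) := by
  have key : ∀ p : ℍ[ℝ], γ * p = p * γ → ∀ a b : Fin 3, ![γ.imI, γ.imJ, γ.imK] a *
      ![p.imI, p.imJ, p.imK] b = ![γ.imI, γ.imJ, γ.imK] b * ![p.imI, p.imJ, p.imK] a := by
    intro p hp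
    have hi := congrArg QuaternionAlgebra.imI hp
    have hj := congrArg QuaternionAlgebra.imJ hp
    have hk := congrArg QuaternionAlgebra.imK hp
    simp at hi hj hk
    intro a b
    fin_cases a <;> fin_cases b <;> simp <;> linarith
  have := eq_zero_of_cross_eq_zero (m := ![(hopfCross m).imI, (hopfCross m).imJ, (hopfCross m).imK])
    (p := ![(hopf m.1).imI, (hopf m.1).imJ, (hopf m.1).imK])
    (q := ![(hopf m.2).imI, (hopf m.2).imJ, (hopf m.2).imK])
    (hopfCross_imI m) (hopfCross_imJ m) (hopfCross_imK m) (key _ h1) (key _ h2) (fun h0 => h (by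
      have e0 := congrFun h0 0
      have e1 := congrFun h0 1
      have e2 := congrFun h0 2
      ext <;> simp_all))
  have e0 := congrFun this 0
  have e1 := congrFun this 1
  have e2 := congrFun this 2
  ext <;> simp_all

theorem act_eq_self_iff {g : G} {m : H2} : act g m = m ↔
    ((g.1 : ℂ) : ℍ[ℝ]) * m.1 = m.1 * (g.2.2 : ℍ[ℝ]) ∧
      ((g.2.1 : ℂ) : ℍ[ℝ]) * m.2 = m.2 * (g.2.2 : ℍ[ℝ]) := by
  have key : ∀ p q : ℍ[ℝ], p * star (g.2.2 : ℍ[ℝ]) = q ↔ p = q * (g.2.2 : ℍ[ℝ]) := fun p q => by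
    constructor
    · rintro rfl; rw [mul_assoc, star_mul_of_norm_one (norm_unitary _), mul_one]
    · rintro rfl; rw [mul_assoc, mul_star_of_norm_one (norm_unitary _), mul_one]
  rw [Prod.ext_iff, act_fst, act_snd, key, key]

theorem commute_hopf_of_mem_stab {g : G} {m : H2} (hg : act g m = m) :
    (g.2.2 : ℍ[ℝ]) * hopf m.1 = hopf m.1 * (g.2.2 : ℍ[ℝ]) ∧
      (g.2.2 : ℍ[ℝ]) * hopf m.2 = hopf m.2 * (g.2.2 : ℍ[ℝ]) := by
  have key : ∀ p : ℍ[ℝ], (g.2.2 : ℍ[ℝ]) * p * star (g.2.2 : ℍ[ℝ]) = p →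
      (g.2.2 : ℍ[ℝ]) * p = p * (g.2.2 : ℍ[ℝ]) := fun p hp => by
    rw [← mul_one ((g.2.2 : ℍ[ℝ]) * p), ← star_mul_of_norm_one (norm_unitary g.2.2),
      ← mul_assoc, hp]
  constructor <;> apply key
  · rw [← hopf_act g.1, ← act_fst, hg]
  · rw [← hopf_act g.2.1, ← act_snd, hg]

theorem real_of_mem_stab {m : H2} (h : hopfCross m ≠ 0) {g : G} (hg : act g m = m) :
    (g.2.2 : ℍ[ℝ]) = ((g.2.2 : ℍ[ℝ]).re : ℍ[ℝ]) :=
  im_eq_zero_of_commute h (commute_hopf_of_mem_stab hg).1 (commute_hopf_of_mem_stab hg).2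

/-- With γ real, the two fixed point equations give λ₁ = γ = λ₂, so the element acts trivially on
all of ℍ². -/
theorem stab_subset {m : H2} (hm : m ∈ M) (h : hopfCross m ≠ 0) (n : H2) : stab m ⊆ stab n := by
  intro g hg
  have hg : act g m = m := hg
  have hr := real_of_mem_stab h hg
  rw [act_eq_self_iff, hr, ← Quaternion.coe_commutes, ← Quaternion.coe_commutes] at hg
  have h1 : m.1 ≠ 0 := by
    intro h0
    have : ‖m.1‖ = 1 := hm
    simp [h0] at this
  change act g n = n
  rw [act_eq_self_iff, mul_right_cancel₀ h1 hg.1, mul_right_cancel₀ (snd_ne_zero h) hg.2, hr]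
  simp [Quaternion.coe_commutes]

theorem exists_hopfCross_ne_zero : ∃ n ∈ M, hopfCross n ≠ 0 := by
  -- The Hopf images of 1 and 1 + j are i and 2k, which are independent.
  refine ⟨(1, 1 + unit 1), by simp [M], fun h => ?_⟩
  have := congrArg QuaternionAlgebra.imJ h
  rw [hopfCross_imJ] at this
  simp [hopf] at this

/-- Where n = 0, the stabilizer contains an involution (i, ±i, v) whose SU(2)-component is an
imaginary unit. Conjugation keeps it imaginary, so no conjugate lies in the stabilizer of a point
with n ≠ 0, where this component is real. Conversely, where n ≠ 0 the stabilizer lies in every other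
one, without conjugation. -/
theorem principalSet_eq : principalSet = {m | m ∈ M ∧ hopfCross m ≠ 0} := by
  ext m
  constructor
  · rintro ⟨hm, h⟩
    refine ⟨hm, fun h0 => ?_⟩
    obtain ⟨e, he, h1⟩ := exists_sign_of_hopfCross_eq_zero hm h0
    have hv : ‖hopf m.1‖ = 1 := by rw [norm_hopf, (show ‖m.1‖ = 1 from hm)]; simp
    obtain ⟨n, hn, hn0⟩ := exists_hopfCross_ne_zero
    obtain ⟨g, hg⟩ := h n hn
    have h2 := real_of_mem_stab hn0 (hg (involution e he _ hv)
      ((act_involution_eq_iff he hv m).2 ⟨intertwine_hopf hm, h1⟩))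
    have h3 : ((g * involution e he _ hv * g⁻¹).2.2 : ℍ[ℝ]) =
      (g.2.2 : ℍ[ℝ]) * hopf m.1 * star (g.2.2 : ℍ[ℝ]) := rfl
    have h4 : ((g.2.2 : ℍ[ℝ]) * hopf m.1 * star (g.2.2 : ℍ[ℝ])).re = 0 := by
      simp; ring
    rw [h3, h4] at h2
    have h5 := congrArg norm h2
    rw [norm_mul, norm_mul, Quaternion.norm_star, norm_unitary, hv] at h5
    simp at h5
  · rintro ⟨hm, h⟩
    exact ⟨hm, fun n _ => ⟨1, fun g hg => by simpa using stab_subset hm h n hg⟩⟩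

theorem mem_principalSet {m : H2} : m ∈ principalSet ↔ m ∈ M ∧ hopfCross m ≠ 0 := by
  rw [principalSet_eq]; rfl

/-! ### Infinitesimal stabilizers -/

theorem coe_circle_exp (s : ℝ) :
    (((Circle.exp s : Circle) : ℂ) : ℍ[ℝ]) = NormedSpace.exp (s • unit 0) := by
  rw [Quaternion.exp_of_re_eq_zero _ (by simp), norm_smul, norm_unit, mul_one, Real.norm_eq_abs,
    Real.cos_abs]
  have h : Real.sin |s| / |s| * s = Real.sin s := by
    rcases eq_or_ne s 0 with rfl | hs
    · simp
    · rcases abs_cases s with ⟨h, _⟩ | ⟨h, _⟩ <;> rw [h]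
      · field_simp
      · rw [Real.sin_neg]; field_simp
  rw [smul_smul, h]
  ext <;> simp [Circle.coe_exp, Complex.exp_re, Complex.exp_im]

theorem hasDerivAt_exp_smul (q : ℍ[ℝ]) :
    HasDerivAt (fun t : ℝ => NormedSpace.exp (t • q)) q 0 := by
  simpa using hasDerivAt_exp_smul_const (𝕂 := ℝ) q (0 : ℝ)

/-- One direction differentiates at t = 0. For the other, when x ≠ 0 the two exponents are conjugate
by x, and exp commutes with conjugation. -/
theorem exp_mul_eq_iff (s : ℝ) (x w : ℍ[ℝ]) :
    (∀ t : ℝ, NormedSpace.exp ((t * s) • unit 0) * x = x * NormedSpace.exp (t • w)) ↔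
      s • (unit 0 * x) = x * w := by
  constructor
  · intro h
    have h1 := (hasDerivAt_exp_smul (s • unit 0)).mul_const x
    have h2 := (hasDerivAt_exp_smul w).const_mul x
    simp only [smul_smul, h] at h1
    simpa using h1.unique h2
  · intro h t
    rcases eq_or_ne x 0 with rfl | hx
    · simp
    have h1 : (t * s) • unit 0 = x * (t • w) * x⁻¹ := by
      rw [mul_smul_comm, ← h, smul_smul, smul_mul_assoc, mul_assoc, mul_inv_cancel₀ hx, mul_one]
    let +nondep : NormedAlgebra ℚ ℍ[ℝ] := .restrictScalars ℚ ℝ ℍ[ℝ]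
    rw [h1, NormedSpace.exp_conj _ _ hx, mul_assoc, inv_mul_cancel₀ hx, mul_one]

theorem expG_mem_stab_iff (m : H2) (ξ : ℝ × ℝ × (Fin 3 → ℝ)) :
    (∀ t : ℝ, expG (t • ξ) ∈ stab m) ↔ ξ.1 • (unit 0 * m.1) = m.1 * imQ ξ.2.2 ∧
      ξ.2.1 • (unit 0 * m.2) = m.2 * imQ ξ.2.2 := by
  rw [← exp_mul_eq_iff, ← exp_mul_eq_iff, ← forall_and]
  refine forall_congr' fun t => ?_
  have hq : imQ (t • ξ.2.2) = t • imQ ξ.2.2 := by ext <;> simp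
  change act _ m = m ↔ _
  rw [act_eq_self_iff]
  simp only [expG, coe_circle_exp, Prod.smul_fst, Prod.smul_snd, smul_eq_mul, hq]

/-- The equations of the Lie algebra of the stabilizer. -/
def stabEquations (m : H2) : Submodule ℝ (ℝ × ℝ × (Fin 3 → ℝ)) where
  carrier := {ξ | ξ.1 • (unit 0 * m.1) = m.1 * imQ ξ.2.2 ∧
    ξ.2.1 • (unit 0 * m.2) = m.2 * imQ ξ.2.2}
  add_mem' {ξ η} hξ hη := by
    have h : imQ (ξ.2.2 + η.2.2) = imQ ξ.2.2 + imQ η.2.2 := by ext <;> simp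
    constructor
    · simp only [Prod.fst_add, Prod.snd_add, add_smul, h, mul_add, hξ.1, hη.1]
    · simp only [Prod.fst_add, Prod.snd_add, add_smul, h, mul_add, hξ.2, hη.2]
  zero_mem' := by
    have h : imQ 0 = 0 := by ext <;> simp
    constructor <;> simp [h]
  smul_mem' r ξ hξ := by
    have h : imQ (r • ξ.2.2) = r • imQ ξ.2.2 := by ext <;> simp
    constructor
    · simp only [Prod.smul_fst, Prod.smul_snd, smul_eq_mul, h, mul_smul_comm, ← hξ.1, smul_smul]
    · simp only [Prod.smul_fst, Prod.smul_snd, smul_eq_mul, h, mul_smul_comm, ← hξ.2, smul_smul]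

theorem stabLie_eq (m : H2) : stabLie m = stabEquations m := by
  have : {ξ | ∀ t : ℝ, expG (t • ξ) ∈ stab m} = (stabEquations m : Set _) := by
    ext ξ; exact expG_mem_stab_iff m ξ
  rw [stabLie, this, Submodule.span_eq]

/-- The coordinates of an imaginary quaternion. -/
def imCoord (q : ℍ[ℝ]) : Fin 3 → ℝ := ![q.imI, q.imJ, q.imK]

theorem imQ_imCoord {q : ℍ[ℝ]} (h : q.re = 0) : imQ (imCoord q) = q := by
  ext <;> simp [imCoord, h]

theorem imQ_injective : Function.Injective imQ := by
  intro u v h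
  have h0 := congrArg QuaternionAlgebra.imI h
  have h1 := congrArg QuaternionAlgebra.imJ h
  have h2 := congrArg QuaternionAlgebra.imK h
  funext l
  fin_cases l <;> assumption

/-- Since i x = x v and x is invertible, the SU(2)-component of an infinitesimal stabilizer is
determined by the first circle component: it is a multiple of v. -/
theorem first_equation_iff {m : H2} (hm : m ∈ M) (s : ℝ) (w : Fin 3 → ℝ) :
    s • (unit 0 * m.1) = m.1 * imQ w ↔ w = s • imCoord (hopf m.1) := by
  have h1 : imQ (s • imCoord (hopf m.1)) = s • hopf m.1 := by
    ext <;> simp [imCoord]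
  have h2 : m.1 ≠ 0 := by
    intro h0
    have : ‖m.1‖ = 1 := hm
    simp [h0] at this
  rw [intertwine_hopf hm, ← mul_smul_comm, (mul_right_injective₀ h2).eq_iff, ← h1,
    imQ_injective.eq_iff]
  exact eq_comm

/-- For a = 0 the second equation is void, so both circle components are free and determine the
rest. -/
theorem finrank_stabLie_zeroSection {m : H2} (hm : m ∈ M) (h : m.2 = 0) :
    Module.finrank ℝ (stabLie m) = 2 := by
  let f : ℝ × ℝ →ₗ[ℝ] ℝ × ℝ × (Fin 3 → ℝ) :=
    { toFun := fun p => (p.1, p.2, p.1 • imCoord (hopf m.1))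
      map_add' := fun p q => by simp [add_smul]
      map_smul' := fun r p => by simp [smul_smul] }
  have hf : Function.Injective f := fun p q hpq =>
    by
    have h := Prod.ext_iff.1 hpq
    exact Prod.ext h.1 (Prod.ext_iff.1 h.2).1
  have : stabLie m = LinearMap.range f := by
    rw [stabLie_eq]
    ext ξ
    change (_ ∧ _) ↔ _
    rw [first_equation_iff hm, h]
    simp only [mul_zero, smul_zero, zero_mul, and_true, LinearMap.mem_range]
    constructor
    · intro hξ; exact ⟨(ξ.1, ξ.2.1), by ext1; rfl; ext1; rfl; exact hξ.symm⟩
    · rintro ⟨p, rfl⟩; rfl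
  rw [this, LinearMap.finrank_range_of_inj hf]
  simp

theorem second_equation_iff {m : H2} (hm : m ∈ M) (ξ : ℝ × ℝ × (Fin 3 → ℝ)) :
    ξ ∈ stabEquations m ↔ ξ.2.2 = ξ.1 • imCoord (hopf m.1) ∧
      ξ.2.1 • (unit 0 * m.2) = ξ.1 • (m.2 * hopf m.1) := by
  change (_ ∧ _) ↔ _
  rw [first_equation_iff hm]
  refine and_congr_right fun h => ?_
  have h1 : imQ (ξ.1 • imCoord (hopf m.1)) = ξ.1 • hopf m.1 := by
    ext <;> simp [imCoord]
  rw [h, h1, mul_smul_comm]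

/-- With w = ev the second equation only ties the second circle component to the first, leaving the
line through (1, e, v). -/
theorem finrank_stabLie_singular {m : H2} (hm : m ∈ M) (h0 : m.2 ≠ 0) (h : hopfCross m = 0) :
    Module.finrank ℝ (stabLie m) = 1 := by
  obtain ⟨e, he, h1⟩ := exists_sign_of_hopfCross_eq_zero hm h
  have hv : m.2 * hopf m.1 ≠ 0 := by
    rw [mul_ne_zero_iff, ← norm_ne_zero_iff (a := hopf m.1), norm_hopf,
      (show ‖m.1‖ = 1 from hm)]
    exact ⟨h0, by simp⟩
  have hee : e * e = 1 := by rcases he with rfl | rfl <;> norm_num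
  have : stabLie m = Submodule.span ℝ {(1, e, imCoord (hopf m.1))} := by
    rw [stabLie_eq]
    ext ξ
    rw [second_equation_iff hm, Submodule.mem_span_singleton, h1, smul_smul,
      (smul_left_injective ℝ hv).eq_iff]
    constructor
    · rintro ⟨h2, h3⟩
      refine ⟨ξ.1, ?_⟩
      ext1
      · simp
      · ext1
        · simp only [Prod.smul_snd, Prod.smul_fst, smul_eq_mul, ← h3]
          rw [mul_assoc, hee, mul_one]
        · exact h2.symm
    · rintro ⟨a, rfl⟩
      refine ⟨by simp, ?_⟩
      simp only [Prod.smul_snd, Prod.smul_fst, smul_eq_mul, mul_one]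
      rw [mul_assoc, hee, mul_one]
  rw [this, finrank_span_singleton]
  intro h2
  exact one_ne_zero (congrArg Prod.fst h2)

/-- A solution with nonzero second component would make w parallel to v; if that component vanishes,
a ≠ 0 kills the first one, and with it the SU(2)-component. -/
theorem finrank_stabLie_principal {m : H2} (hm : m ∈ M) (h : hopfCross m ≠ 0) :
    Module.finrank ℝ (stabLie m) = 0 := by
  have h0 := snd_ne_zero h
  have : stabLie m = ⊥ := by
    rw [stabLie_eq, eq_bot_iff]
    intro ξ hξ
    rw [second_equation_iff hm] at hξ
    have h1 : ξ.2.1 = 0 := by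
      by_contra h1
      refine h (hopfCross_eq_zero_of_sign (e := ξ.1 / ξ.2.1) ?_)
      rw [div_eq_inv_mul, ← smul_smul, ← hξ.2, smul_smul, inv_mul_cancel₀ h1, one_smul]
    have hv : m.2 * hopf m.1 ≠ 0 := by
      rw [mul_ne_zero_iff, ← norm_ne_zero_iff (a := hopf m.1), norm_hopf,
        (show ‖m.1‖ = 1 from hm)]
      exact ⟨h0, by simp⟩
    have h2 : ξ.1 = 0 := by
      have := hξ.2
      rw [h1, zero_smul] at this
      exact (smul_eq_zero.1 this.symm).resolve_right hv
    have h3 : ξ.2.2 = 0 := by rw [hξ.1, h2, zero_smul]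
    exact Prod.ext h2 (Prod.ext h1 h3)
  rw [this]
  simp

theorem trichotomy {m : H2} (hm : m ∈ M) :
    (hopfCross m ≠ 0 ∧ Module.finrank ℝ (stabLie m) = 0) ∨
      (m.2 ≠ 0 ∧ hopfCross m = 0 ∧ Module.finrank ℝ (stabLie m) = 1) ∨
      (m.2 = 0 ∧ hopfCross m = 0 ∧ Module.finrank ℝ (stabLie m) = 2) := by
  by_cases h : hopfCross m = 0
  · by_cases h0 : m.2 = 0
    · exact Or.inr (Or.inr ⟨h0, h, finrank_stabLie_zeroSection hm h0⟩)
    · exact Or.inr (Or.inl ⟨h0, h, finrank_stabLie_singular hm h0 h⟩)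
  · exact Or.inl ⟨h, finrank_stabLie_principal hm h⟩

theorem stratum_one_eq : stratum 1 = {m | m ∈ M ∧ m.2 ≠ 0 ∧ hopfCross m = 0} := by
  ext m
  refine and_congr_right fun hm => ?_
  rcases trichotomy hm with h | h | h <;> simp [h]

theorem stratum_two_eq : stratum 2 = zeroSection := by
  ext m
  refine and_congr_right fun hm => ?_
  rcases trichotomy hm with h | h | h
  · simp [h, snd_ne_zero h.1]
  · simp [h]
  · simp [h]

theorem stratum_three_eq : stratum 3 = ∅ := by
  ext m
  refine iff_of_false (fun ⟨hm, h3⟩ => ?_) id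
  rcases trichotomy hm with h | h | h <;> simp_all

theorem stratum_four_eq : stratum 4 = ∅ := by
  ext m
  refine iff_of_false (fun ⟨hm, h3⟩ => ?_) id
  rcases trichotomy hm with h | h | h <;> simp_all

theorem M_eq_union :
    M = principalSet ∪ (stratum 1 ∪ stratum 2 ∪ stratum 3 ∪ stratum 4) ∧
      Disjoint principalSet (stratum 1 ∪ stratum 2 ∪ stratum 3 ∪ stratum 4) := by
  rw [principalSet_eq, stratum_one_eq, stratum_two_eq, stratum_three_eq, stratum_four_eq,
    Set.union_empty, Set.union_empty]
  constructor
  · ext m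
    constructor
    · intro hm
      rcases trichotomy hm with h | h | h
      · exact Or.inl ⟨hm, h.1⟩
      · exact Or.inr (Or.inl ⟨hm, h.1, h.2.1⟩)
      · exact Or.inr (Or.inr ⟨hm, h.1⟩)
    · rintro (h | h | h) <;> exact h.1
  · rw [Set.disjoint_left]
    rintro m ⟨_, h⟩ (h' | h')
    · exact h h'.2.2
    · exact snd_ne_zero h h'.2

/-! ### Curves in `M` -/

/-- A curve in `M` through `m` with velocity `X`. -/
def curveM (m X : H2) (t : ℝ) : H2 :=
  (((1 + t ^ 2 * ‖X.1‖ ^ 2) ^ (-(1 / 2) : ℝ)) • (m.1 + t • X.1), m.2 + t • X.2)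

theorem one_add_sq_pos (X : H2) (t : ℝ) : 0 < 1 + t ^ 2 * ‖X.1‖ ^ 2 := by positivity

theorem contDiff_curveM (m X : H2) : ContDiff ℝ ∞ (curveM m X) := by
  unfold curveM
  fun_prop (disch := exact fun t => (one_add_sq_pos X t).ne')

theorem curveM_zero (m X : H2) : curveM m X 0 = m := by
  simp [curveM]

theorem curveM_mem {m X : H2} (hm : m ∈ M) (hX : X ∈ TM m) (t : ℝ) : curveM m X t ∈ M := by
  have h : ‖m.1 + t • X.1‖ ^ 2 = 1 + t ^ 2 * ‖X.1‖ ^ 2 := by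
    rw [norm_add_sq_real, inner_smul_right, mem_TM.1 hX, norm_smul, (show ‖m.1‖ = 1 from hm),
      mul_pow, Real.norm_eq_abs, sq_abs]
    ring
  have h0 := one_add_sq_pos X t
  change ‖_ • _‖ = 1
  rw [norm_smul, ← sq_eq_sq₀ (by positivity) zero_le_one, mul_pow, h, Real.norm_eq_abs, sq_abs,
    ← Real.rpow_natCast (_ ^ (-(1 / 2) : ℝ)), ← Real.rpow_mul h0.le]
  norm_num
  rw [Real.rpow_neg_one, inv_mul_cancel₀ h0.ne']

theorem hasDerivAt_curveM (m X : H2) : HasDerivAt (curveM m X) X 0 := by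
  have h1 : HasDerivAt (fun t : ℝ => (1 + t ^ 2 * ‖X.1‖ ^ 2)) 0 0 := by
    simpa using (((hasDerivAt_id (0 : ℝ)).pow 2).mul_const (‖X.1‖ ^ 2)).const_add 1
  have h2 := h1.rpow_const (p := -(1 / 2)) (Or.inl (by simp))
  have h3 : HasDerivAt (fun t : ℝ => m.1 + t • X.1) X.1 0 := by
    simpa using ((hasDerivAt_id (0 : ℝ)).smul_const X.1).const_add m.1
  have h4 : HasDerivAt (fun t : ℝ => m.2 + t • X.2) X.2 0 := by
    simpa using ((hasDerivAt_id (0 : ℝ)).smul_const X.2).const_add m.2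
  refine ((h2.smul h3).prodMk h4).congr_deriv ?_
  simp

/-- Two functions which agree on `M` have the same derivative along `M`. -/
theorem fderiv_eq_of_eqOn_M {F : Type*} [NormedAddCommGroup F] [NormedSpace ℝ F] {f g : H2 → F}
    {m X : H2} (hm : m ∈ M) (hX : X ∈ TM m) (hf : DifferentiableAt ℝ f m)
    (hg : DifferentiableAt ℝ g m) (h : Set.EqOn f g M) : fderiv ℝ f m X = fderiv ℝ g m X := by
  have e : f ∘ curveM m X = g ∘ curveM m X := funext fun t => h (curveM_mem hm hX t)
  have h1 : HasDerivAt (f ∘ curveM m X) (fderiv ℝ f m X) 0 :=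
    HasFDerivAt.comp_hasDerivAt 0 (by rw [curveM_zero]; exact hf.hasFDerivAt)
      (hasDerivAt_curveM m X)
  have h2 : HasDerivAt (g ∘ curveM m X) (fderiv ℝ g m X) 0 :=
    HasFDerivAt.comp_hasDerivAt 0 (by rw [curveM_zero]; exact hg.hasFDerivAt)
      (hasDerivAt_curveM m X)
  rw [e] at h1
  exact h1.unique h2

/-! ### The base -/

theorem theta_eq (m : H2) : theta m = Real.arccos (hopfInner m / ‖m.2‖ ^ 2) := by
  rw [theta, hopf_smul, inner_smul_right, hopfInner, inv_pow, div_eq_inv_mul]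

theorem abs_cos_lt_one {m : H2} (hm : m ∈ principalSet) :
    -1 < hopfInner m / ‖m.2‖ ^ 2 ∧ hopfInner m / ‖m.2‖ ^ 2 < 1 := by
  rw [mem_principalSet] at hm
  have hr : 0 < ‖m.2‖ ^ 2 := by have := norm_pos_iff.2 (snd_ne_zero hm.2); positivity
  have hS : 0 < ‖hopfCross m‖ ^ 2 := by have := norm_pos_iff.2 hm.2; positivity
  have h := norm_hopfCross_sq_add hm.1
  rw [lt_div_iff₀ hr, div_lt_iff₀ hr]
  have := abs_lt_of_sq_lt_sq' (show hopfInner m ^ 2 < (‖m.2‖ ^ 2) ^ 2 by nlinarith) hr.le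
  constructor <;> linarith

theorem cos_theta {m : H2} (hm : m ∈ principalSet) :
    Real.cos (theta m) = hopfInner m / ‖m.2‖ ^ 2 := by
  rw [theta_eq, Real.cos_arccos (abs_cos_lt_one hm).1.le (abs_cos_lt_one hm).2.le]

theorem sin_theta {m : H2} (hm : m ∈ principalSet) :
    Real.sin (theta m) = ‖hopfCross m‖ / ‖m.2‖ ^ 2 := by
  rw [mem_principalSet] at hm
  have hr : 0 < ‖m.2‖ ^ 2 := by have := norm_pos_iff.2 (snd_ne_zero hm.2); positivity
  have h := norm_hopfCross_sq_add hm.1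
  have hr' : ‖m.2‖ ≠ 0 := norm_ne_zero_iff.2 (snd_ne_zero hm.2)
  rw [theta_eq, Real.sin_arccos, ← Real.sqrt_sq (show 0 ≤ ‖hopfCross m‖ / ‖m.2‖ ^ 2 by positivity)]
  congr 1
  field_simp
  linear_combination -h

theorem proj_mem_B {m : H2} (hm : m ∈ principalSet) : proj m ∈ B := by
  refine ⟨⟨?_, ?_⟩, norm_pos_iff.2 (snd_ne_zero (mem_principalSet.1 hm).2)⟩
  · change 0 < theta m
    rw [theta_eq]
    exact Real.arccos_pos.2 (abs_cos_lt_one hm).2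
  · change theta m < Real.pi
    rw [theta_eq, Real.arccos_lt_pi]
    exact (abs_cos_lt_one hm).1

theorem contDiffAt_proj {m : H2} (hm : m ∈ principalSet) : ContDiffAt ℝ ∞ proj m := by
  have ha := snd_ne_zero (mem_principalSet.1 hm).2
  have hn : ContDiffAt ℝ ∞ (fun m : H2 => ‖m.2‖) m := contDiff_snd.contDiffAt.norm ℝ ha
  have hr : ‖m.2‖ ^ 2 ≠ 0 := by simpa using ha
  have h1 : ContDiffAt ℝ ∞ (fun m : H2 => hopfInner m / ‖m.2‖ ^ 2) m :=
    contDiff_hopfInner.contDiffAt.div (hn.pow 2) hr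
  have h2 : ContDiffAt ℝ ∞ theta m := by
    rw [funext theta_eq]
    exact ContDiffAt.comp (g := Real.arccos) m
      (Real.contDiffAt_arccos (abs_cos_lt_one hm).1.ne' (abs_cos_lt_one hm).2.ne) h1
  exact h2.prodMk hn

/-- For b = z + w j with z, w complex the value is |z|² - |w|². Together with |b|² it determines the
two moduli, which are the invariants of b under the torus. -/
theorem hopfInner_one (b : ℍ[ℝ]) :
    hopfInner (1, b) = b.re ^ 2 + b.imI ^ 2 - b.imJ ^ 2 - b.imK ^ 2 := by
  simp [hopfInner_expand, hopf]; ring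

theorem proj_image_principalSet : proj '' principalSet = B := by
  refine Set.Subset.antisymm (Set.image_subset_iff.2 fun m hm => proj_mem_B hm) ?_
  rintro ⟨t, r⟩ ⟨⟨ht0, htpi⟩, hr⟩
  simp only [Set.mem_Ioi] at ht0 htpi hr
  -- The preimage of (t, r) is the point (1, r(cos(t/2) + j sin(t/2))); the half angle compensates
  -- for the doubling of angles by the Hopf map.
  obtain ⟨b, b0, b1, b2, b3⟩ : ∃ b : ℍ[ℝ], b.re = r * Real.cos (t / 2) ∧ b.imI = 0 ∧
      b.imJ = r * Real.sin (t / 2) ∧ b.imK = 0 := ⟨⟨_, _, _, _⟩, rfl, rfl, rfl, rfl⟩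
  have hn : ‖b‖ = r := by
    rw [← sq_eq_sq₀ (norm_nonneg _) hr.le, normSq_expand, b0, b1, b2, b3]
    linear_combination r ^ 2 * Real.cos_sq_add_sin_sq (t / 2)
  have hC : hopfInner (1, b) =
      r ^ 2 * Real.cos t := by
    rw [hopfInner_one, show Real.cos t = Real.cos (2 * (t / 2)) by ring_nf, Real.cos_two_mul, b0, b1, b2, b3]
    linear_combination (-r ^ 2) * Real.cos_sq_add_sin_sq (t / 2)
  have hM : ((1, b) : H2) ∈ M := by simp [M]
  refine ⟨(1, b),
    mem_principalSet.2 ⟨hM, fun h => ?_⟩, ?_⟩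
  · have h1 := norm_hopfCross_sq_add hM
    rw [h, hC, hn, norm_zero] at h1
    have h2 : r ^ 4 * Real.sin t ^ 2 = 0 := by
      linear_combination -h1 + r ^ 4 * Real.cos_sq_add_sin_sq t
    have := Real.sin_pos_of_pos_of_lt_pi ht0 htpi
    have : 0 < r ^ 4 * Real.sin t ^ 2 := by positivity
    linarith
  · refine Prod.ext ?_ hn
    change theta _ = t
    rw [theta_eq, hn, hC, mul_div_cancel_left₀ _ (by positivity), Real.arccos_cos ht0.le htpi.le]

theorem proj_act (g : G) (m : H2) : proj (act g m) = proj m := by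
  rw [proj, proj, theta_eq, theta_eq, hopfInner_act, norm_act_snd]

theorem exists_circle_sq (z : Circle) : ∃ w : Circle, w * w = z :=
  ⟨Circle.exp (Complex.arg z / 2), by rw [← Circle.exp_add, add_halves, Circle.exp_arg]⟩

theorem exists_circle_mul {z w : ℂ} (hz : z ≠ 0) (h : ‖z‖ = ‖w‖) : ∃ l : Circle, (l : ℂ) * z = w :=
  ⟨⟨w / z, by simp [Submonoid.unitSphere, ← h, hz]⟩, div_mul_cancel₀ w hz⟩

/-- The `T²`-orbit of `b ∈ ℍ = ℂ ⊕ ℂ j`, for the action `b ↦ λ₂ b λ̄₁`. -/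
theorem exists_torus_eq {b b' : ℍ[ℝ]} (h1 : b.re ^ 2 + b.imI ^ 2 = b'.re ^ 2 + b'.imI ^ 2)
    (h2 : b.imJ ^ 2 + b.imK ^ 2 = b'.imJ ^ 2 + b'.imK ^ 2) (h10 : b.re ^ 2 + b.imI ^ 2 ≠ 0)
    (h20 : b.imJ ^ 2 + b.imK ^ 2 ≠ 0) :
    ∃ l₁ l₂ : Circle, ((l₂ : ℂ) : ℍ[ℝ]) * b * star ((l₁ : ℂ) : ℍ[ℝ]) = b' := by
  have hn : ∀ p q : ℝ, ‖(⟨p, q⟩ : ℂ)‖ ^ 2 = p ^ 2 + q ^ 2 := fun p q => by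
    rw [Complex.sq_norm, Complex.normSq_mk]; ring
  have hz : ∀ p q : ℝ, p ^ 2 + q ^ 2 ≠ 0 → (⟨p, q⟩ : ℂ) ≠ 0 := fun p q h h0 => by
    rw [← hn, h0] at h; simp at h
  obtain ⟨α, hα⟩ := exists_circle_mul (w := ⟨b'.re, b'.imI⟩) (hz _ _ h10) (by
    rw [← sq_eq_sq₀ (norm_nonneg _) (norm_nonneg _), hn, hn, h1])
  obtain ⟨β, hβ⟩ := exists_circle_mul (w := ⟨b'.imJ, b'.imK⟩) (hz _ _ h20) (by
    rw [← sq_eq_sq₀ (norm_nonneg _) (norm_nonneg _), hn, hn, h2])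
  -- On b = z + w j the action multiplies z by λ₂λ̄₁ and w by λ₂λ₁. Prescribing these factors as α
  -- and β forces λ₁² = β/α and λ₂ = αλ₁.
  obtain ⟨l, hl⟩ := exists_circle_sq (β / α)
  refine ⟨l, α * l, ?_⟩
  have hβ' : β = α * l * l := by rw [mul_assoc, hl, mul_div_cancel]
  have hl1 : (l : ℂ).re ^ 2 + (l : ℂ).im ^ 2 = 1 := by
    have h := Circle.normSq_coe l
    rw [Complex.normSq_apply] at h
    linarith
  rw [hβ'] at hβ
  have a1 := congrArg Complex.re hα
  have a2 := congrArg Complex.im hα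
  have b1 := congrArg Complex.re hβ
  have b2 := congrArg Complex.im hβ
  simp at a1 a2 b1 b2
  ext <;> simp
  · linear_combination a1 + ((α : ℂ).re * b.re - (α : ℂ).im * b.imI) * hl1
  · linear_combination a2 + ((α : ℂ).re * b.imI + (α : ℂ).im * b.re) * hl1
  · linear_combination b1
  · linear_combination b2

/-- The group element with γ = x moves the point to (1, a x̄). -/
theorem hopfInner_eq {m : H2} (hm : m ∈ M) : hopfInner m =
    (m.2 * star m.1).re ^ 2 + (m.2 * star m.1).imI ^ 2 - (m.2 * star m.1).imJ ^ 2 -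
      (m.2 * star m.1).imK ^ 2 := by
  rw [← hopfInner_one, ← hopfInner_act (1, 1, ⟨m.1, mem_unitary_of_norm hm⟩) m]
  congr 1
  ext1
  · rw [act_fst]; simp [mul_star_of_norm_one hm]
  · rw [act_snd]; simp

/-- Normalising x to 1 leaves the torus action b ↦ λ₂ b λ̄₁ on b = a x̄. The squares of the two
complex moduli of b are r²(1 ± cos θ)/2, nonzero on the principal set, so equal invariants give b in
the same torus orbit. -/
theorem mem_orbit_of_invariants {m n : H2} (hm : m ∈ principalSet) (hn : n ∈ M)
    (h : hopfInner m = hopfInner n) (hr : ‖m.2‖ = ‖n.2‖) : n ∈ orbit m := by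
  have hb := abs_cos_lt_one hm
  rw [mem_principalSet] at hm
  have hr0 : 0 < ‖m.2‖ ^ 2 := by have := norm_pos_iff.2 (snd_ne_zero hm.2); positivity
  rw [lt_div_iff₀ hr0, div_lt_iff₀ hr0] at hb
  have norm_b : ∀ {q : H2}, q ∈ M → ‖q.2 * star q.1‖ ^ 2 = ‖q.2‖ ^ 2 := fun {q} hq => by
    rw [norm_mul, Quaternion.norm_star, (show ‖q.1‖ = 1 from hq), mul_one]
  have nm := norm_b hm.1
  have nn := norm_b hn
  have cm := hopfInner_eq hm.1
  have cn := hopfInner_eq hn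
  rw [normSq_expand] at nm nn
  rw [← hr] at nn
  obtain ⟨l₁, l₂, hl⟩ := exists_torus_eq (b := m.2 * star m.1) (b' := n.2 * star n.1)
    (by linarith) (by linarith) (by apply ne_of_gt; linarith) (by apply ne_of_gt; linarith)
  -- The value of γ is forced by requiring that the first component of m be sent to that of n.
  refine ⟨(l₁, l₂, ⟨star n.1 * ((l₁ : ℂ) : ℍ[ℝ]) * m.1, mem_unitary_of_norm ?_⟩), ?_⟩
  · rw [norm_mul, norm_mul, Quaternion.norm_star, norm_coeCircle, (show ‖m.1‖ = 1 from hm.1),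
      (show ‖n.1‖ = 1 from hn)]
    norm_num
  · ext1
    · rw [act_fst]
      simp only [star_mul, star_star]
      calc _ = ((l₁ : ℂ) : ℍ[ℝ]) * (m.1 * star m.1) * star ((l₁ : ℂ) : ℍ[ℝ]) * n.1 := by
            simp only [mul_assoc]
        _ = _ := by
            rw [mul_star_of_norm_one hm.1, mul_one, mul_star_of_norm_one (norm_coeCircle _),
              one_mul]
    · rw [act_snd]
      simp only [star_mul, star_star]
      calc _ = ((l₂ : ℂ) : ℍ[ℝ]) * (m.2 * star m.1) * star ((l₁ : ℂ) : ℍ[ℝ]) * n.1 := by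
            simp only [mul_assoc]
        _ = _ := by rw [hl, mul_assoc, star_mul_of_norm_one hn, mul_one]

theorem proj_eq_iff_mem_orbit {m n : H2} (hm : m ∈ principalSet) (hn : n ∈ principalSet) :
    proj m = proj n ↔ n ∈ orbit m := by
  constructor
  · intro h
    have hr : ‖m.2‖ = ‖n.2‖ := congrArg Prod.snd h
    have ht : theta m = theta n := congrArg Prod.fst h
    have hc := cos_theta hm
    rw [ht, cos_theta hn, hr] at hc
    have hr0 : ‖n.2‖ ^ 2 ≠ 0 := by simpa using snd_ne_zero (mem_principalSet.1 hn).2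
    exact mem_orbit_of_invariants hm (mem_principalSet.1 hn).1 ((div_left_inj' hr0).1 hc).symm hr
  · rintro ⟨g, rfl⟩
    exact (proj_act g m).symm

theorem hasDerivAt_line (p q : ℍ[ℝ]) : HasDerivAt (fun t : ℝ => p + t • q) q 0 := by
  simpa using ((hasDerivAt_id (0 : ℝ)).smul_const q).const_add p

theorem hasDerivAt_star {f : ℝ → ℍ[ℝ]} {f' : ℍ[ℝ]} {t : ℝ} (hf : HasDerivAt f f' t) :
    HasDerivAt (fun s => star (f s)) (star f') t :=
  HasFDerivAt.comp_hasDerivAt t (LinearMap.toContinuousLinearMap (E := ℍ[ℝ]) (F' := ℍ[ℝ])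
    { toFun := fun q => star q, map_add' := star_add, map_smul' := fun _ _ => by simp }).hasFDerivAt
    hf

theorem hasDerivAt_hopf {f : ℝ → ℍ[ℝ]} {f' : ℍ[ℝ]} {t : ℝ} (hf : HasDerivAt f f' t) :
    HasDerivAt (fun s => hopf (f s)) (star f' * unit 0 * f t + star (f t) * unit 0 * f') t := by
  exact ((hasDerivAt_star hf).mul_const (unit 0)).mul hf

/-- Scaling a changes r at nonzero rate. Moving x along x n keeps r and changes r² cos θ at rate
-2|n|². The two images form a triangular, invertible matrix. -/
theorem fderiv_proj_surjective {m : H2} (hm : m ∈ principalSet) :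
    (TM m).map (fderiv ℝ proj m : H2 →ₗ[ℝ] ℝ × ℝ) = ⊤ := by
  have hd : DifferentiableAt ℝ proj m := (contDiffAt_proj hm).differentiableAt (by simp)
  obtain ⟨hM, hN⟩ := mem_principalSet.1 hm
  have ha := snd_ne_zero hN
  have hr : 0 < ‖m.2‖ := norm_pos_iff.2 ha
  -- the radial direction
  have h1 : (0, m.2) ∈ TM m := by simp [mem_TM]
  obtain ⟨s, hs⟩ : ∃ s, fderiv ℝ proj m (0, m.2) = (s, ‖m.2‖) := by
    refine ⟨(fderiv ℝ proj m (0, m.2)).1, Prod.ext rfl ?_⟩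
    have h2 : HasDerivAt (fun t : ℝ => (proj (m + t • ((0, m.2) : H2))).2)
        (fderiv ℝ proj m (0, m.2)).2 0 := (hd.hasFDerivAt.hasLineDerivAt _).snd
    have h3 : HasDerivAt (fun t : ℝ => (1 + t) * ‖m.2‖) ‖m.2‖ 0 := by
      simpa using ((hasDerivAt_id (0 : ℝ)).const_add 1).mul_const ‖m.2‖
    refine h2.unique (h3.congr_of_eventuallyEq ?_)
    filter_upwards [Ioi_mem_nhds (show (-1 : ℝ) < 0 by norm_num)] with t ht
    have ht : 0 < 1 + t := by have : -1 < t := ht; linarith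
    change ‖m.2 + t • m.2‖ = _
    rw [← one_smul ℝ m.2, smul_smul, ← add_smul, norm_smul, mul_one, one_smul, Real.norm_eq_abs,
      abs_of_pos ht]
  -- the direction in which the angle changes
  have h2 : (m.1 * hopfCross m, 0) ∈ TM m := by
    have := inner_mul_left_mul_left m.1 1 (hopfCross m)
    rw [mul_one] at this
    rw [mem_TM, this, inner_expand]
    simp
  obtain ⟨k, hk, hk'⟩ : ∃ k : ℝ, k ≠ 0 ∧ fderiv ℝ proj m (m.1 * hopfCross m, 0) = (k, 0) := by
    have h3 : HasDerivAt (fun t : ℝ => proj (m + t • ((m.1 * hopfCross m, 0) : H2)))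
        (fderiv ℝ proj m (m.1 * hopfCross m, 0)) 0 := hd.hasFDerivAt.hasLineDerivAt _
    have h4 : HasDerivAt (fun t : ℝ => ⟪hopf (m.1 + t • (m.1 * hopfCross m)), hopf m.2⟫_ℝ)
        (-2 * ‖hopfCross m‖ ^ 2) 0 := by
      have := (hasDerivAt_hopf (hasDerivAt_line m.1 (m.1 * hopfCross m))).inner ℝ
        (hasDerivAt_const 0 (hopf m.2))
      refine this.congr_deriv ?_
      simp only [inner_zero_right, zero_smul, add_zero, zero_add]
      have e : star (m.1 * hopfCross m) * unit 0 * m.1 + star m.1 * unit 0 * (m.1 * hopfCross m) =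
          hopf m.1 * hopfCross m - hopfCross m * hopf m.1 := by
        rw [star_mul, star_eq_neg (hopfCross_re m)]
        simp only [hopf, mul_assoc, neg_mul]
        abel
      rw [e, normSq_expand, inner_expand]
      simp only [hopfCross_re]
      simp [hopfCross_imI, hopfCross_imJ, hopfCross_imK]
      ring
    have h5 : HasDerivAt (fun t : ℝ => proj (m + t • ((m.1 * hopfCross m, 0) : H2)))
        (-(1 / √(1 - (hopfInner m / ‖m.2‖ ^ 2) ^ 2)) * (-2 * ‖hopfCross m‖ ^ 2 / ‖m.2‖ ^ 2), 0) 0 := by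
      have := (Real.hasDerivAt_arccos (abs_cos_lt_one hm).1.ne' (abs_cos_lt_one hm).2.ne)
      have h6 := (HasDerivAt.comp_of_eq (0 : ℝ) this (h4.div_const (‖m.2‖ ^ 2))
        (by simp [hopfInner])).prodMk (hasDerivAt_const 0 ‖m.2‖)
      refine h6.congr_of_eventuallyEq (Filter.Eventually.of_forall fun t => ?_)
      simp [proj, theta_eq, hopfInner]
    refine ⟨_, ?_, h3.unique h5⟩
    have hS := norm_pos_iff.2 hN
    have : 0 < 1 - (hopfInner m / ‖m.2‖ ^ 2) ^ 2 := by
      have := abs_cos_lt_one hm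
      nlinarith
    have h7 : 0 < 1 / √(1 - (hopfInner m / ‖m.2‖ ^ 2) ^ 2) := by positivity
    have h8 : 0 < 2 * ‖hopfCross m‖ ^ 2 / ‖m.2‖ ^ 2 := by positivity
    rw [show -(1 / √(1 - (hopfInner m / ‖m.2‖ ^ 2) ^ 2)) * (-2 * ‖hopfCross m‖ ^ 2 / ‖m.2‖ ^ 2) =
      1 / √(1 - (hopfInner m / ‖m.2‖ ^ 2) ^ 2) * (2 * ‖hopfCross m‖ ^ 2 / ‖m.2‖ ^ 2) by ring]
    exact (mul_pos h7 h8).ne'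
  rw [eq_top_iff]
  rintro ⟨p, q⟩ -
  refine ⟨((p - q / ‖m.2‖ * s) / k) • (m.1 * hopfCross m, 0) + (q / ‖m.2‖) • (0, m.2),
    add_mem ((TM m).smul_mem _ h2) ((TM m).smul_mem _ h1), ?_⟩
  rw [map_add, map_smul, map_smul, ContinuousLinearMap.coe_coe, hk', hs]
  ext
  · simp; field_simp; ring
  · simp; field_simp

/-! ### The multi-moment map -/

/-- The real coordinates of a quaternion. -/
def coord4 (q : ℍ[ℝ]) : Fin 4 → ℝ := ![q.re, q.imI, q.imJ, q.imK]

/-- The element of `ℝ⁷` given by an imaginary quaternion and a quaternion. -/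
def toR7 (p q : ℍ[ℝ]) : R7 := (imCoord p, coord4 q)

theorem coframe_tangent (c : ℝ) {m : H2} (hm : m ∈ M) {X : H2} {p : ℍ[ℝ]} (hX : X.1 = m.1 * p) :
    coframe c m X = (fun l => -(√3 * (c + ‖m.2‖ ^ 2) ^ (1 / 3 : ℝ)) * (toR7 p 0).1 l,
      fun l => 2 * (c + ‖m.2‖ ^ 2) ^ (-(1 / 6) : ℝ) *
        (toR7 0 (X.2 - (1 / 2 : ℝ) • (m.2 * p))).2 l) := by
  have h : ∀ l, imCoord p l = ⟪unit l, p⟫_ℝ := by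
    intro l
    fin_cases l <;> simp [imCoord, inner_expand]
  rw [coframe]
  simp only [eForm_tangent hm hX, vert_tangent hm hX, toR7, coord4, h]
  ext l
  · simp
  · rfl

theorem det_four (x y z w : Fin 4 → ℝ) : Matrix.det (Matrix.of ![x, y, z, w]) =
    x 0 * (y 1 * (z 2 * w 3 - z 3 * w 2) - y 2 * (z 1 * w 3 - z 3 * w 1) +
      y 3 * (z 1 * w 2 - z 2 * w 1)) -
    x 1 * (y 0 * (z 2 * w 3 - z 3 * w 2) - y 2 * (z 0 * w 3 - z 3 * w 0) +
      y 3 * (z 0 * w 2 - z 2 * w 0)) +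
    x 2 * (y 0 * (z 1 * w 3 - z 3 * w 1) - y 1 * (z 0 * w 3 - z 3 * w 0) +
      y 3 * (z 0 * w 1 - z 1 * w 0)) -
    x 3 * (y 0 * (z 1 * w 2 - z 2 * w 1) - y 1 * (z 0 * w 2 - z 2 * w 0) +
      y 2 * (z 0 * w 1 - z 1 * w 0)) := by
  simp [Matrix.det_succ_row_zero, Fin.sum_univ_succ, Fin.succAbove]
  ring

/-- The sum `∑ i, dx_j ∧ dx_k ∧ Ω_i`. -/
def mixedTerm (X Y Z W : R7) : ℝ :=
  ∑ i : Fin 3, (dxdx i X Y * Omega i Z W - dxdx i X Z * Omega i Y W + dxdx i X W * Omega i Y Z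
      + dxdx i Y Z * Omega i X W - dxdx i Y W * Omega i X Z + dxdx i Z W * Omega i X Y)

theorem starPhi0_scale (A D : ℝ) (X Y Z W : R7) :
    starPhi0 (fun l => A * X.1 l, fun l => D * X.2 l) (fun l => A * Y.1 l, fun l => D * Y.2 l)
      (fun l => A * Z.1 l, fun l => D * Z.2 l) (fun l => A * W.1 l, fun l => D * W.2 l) =
    D ^ 4 * Matrix.det (Matrix.of ![X.2, Y.2, Z.2, W.2]) -
      A ^ 2 * D ^ 2 * mixedTerm X Y Z W := by
  simp only [starPhi0, mixedTerm, det_four, Finset.mul_sum]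
  congr 1
  · ring
  · refine Finset.sum_congr rfl fun i _ => ?_
    simp only [dxdx, Omega]
    ring

/-! ### Powers of c + r² arising from the scale factors of the coframe -/

section Weights

variable {R : ℝ}

theorem weight_A_sq (hR : 0 < R) : (√3 * R ^ (1 / 3 : ℝ)) ^ 2 = 3 * R ^ (2 / 3 : ℝ) := by
  rw [mul_pow, Real.sq_sqrt (by norm_num), ← Real.rpow_natCast (_ ^ (1 / 3 : ℝ)),
    ← Real.rpow_mul hR.le]
  norm_num

theorem weight_D_sq (hR : 0 < R) : (2 * R ^ (-(1 / 6) : ℝ)) ^ 2 = 4 * R ^ (-(1 / 3) : ℝ) := by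
  rw [mul_pow, ← Real.rpow_natCast (_ ^ (-(1 / 6) : ℝ)), ← Real.rpow_mul hR.le]
  norm_num

theorem weight_D_pow_four (hR : 0 < R) : (2 * R ^ (-(1 / 6) : ℝ)) ^ 4 = 16 * R ^ (-(2 / 3) : ℝ) := by
  rw [mul_pow, ← Real.rpow_natCast (_ ^ (-(1 / 6) : ℝ)), ← Real.rpow_mul hR.le]
  norm_num

theorem weight_mixed (hR : 0 < R) :
    (√3 * R ^ (1 / 3 : ℝ)) ^ 2 * (2 * R ^ (-(1 / 6) : ℝ)) ^ 2 = 12 * R ^ (1 / 3 : ℝ) := by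
  rw [weight_A_sq hR, weight_D_sq hR, mul_mul_mul_comm, ← Real.rpow_add hR]
  norm_num

end Weights

/-- Tangent vectors are written as (x p, ·), so that the coframe depends on x only through p. The
two types of terms of `*φ₀` then carry different powers of c + r²: four vertical factors, or two
horizontal and two vertical ones. -/
theorem starPhi_eq {c : ℝ} (hc : 0 < c) {m : H2} (hm : m ∈ M) {X Y Z W : H2} {p q s t : ℍ[ℝ]}
    (hX : X.1 = m.1 * p) (hY : Y.1 = m.1 * q) (hZ : Z.1 = m.1 * s) (hW : W.1 = m.1 * t)
    {α β γ δ : ℍ[ℝ]} (hα : X.2 - (1 / 2 : ℝ) • (m.2 * p) = α)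
    (hβ : Y.2 - (1 / 2 : ℝ) • (m.2 * q) = β) (hγ : Z.2 - (1 / 2 : ℝ) • (m.2 * s) = γ)
    (hδ : W.2 - (1 / 2 : ℝ) • (m.2 * t) = δ) :
    starPhi c m X Y Z W = 16 * (c + ‖m.2‖ ^ 2) ^ (-(2 / 3) : ℝ) *
        Matrix.det (Matrix.of ![coord4 α, coord4 β, coord4 γ, coord4 δ]) -
      12 * (c + ‖m.2‖ ^ 2) ^ (1 / 3 : ℝ) *
        mixedTerm (toR7 p α) (toR7 q β) (toR7 s γ) (toR7 t δ) := by
  have hR : 0 < c + ‖m.2‖ ^ 2 := by positivity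
  rw [starPhi, coframe_tangent c hm hX, coframe_tangent c hm hY, coframe_tangent c hm hZ,
    coframe_tangent c hm hW, hα, hβ, hγ, hδ]
  have h := starPhi0_scale (-(√3 * (c + ‖m.2‖ ^ 2) ^ (1 / 3 : ℝ)))
    (2 * (c + ‖m.2‖ ^ 2) ^ (-(1 / 6) : ℝ)) (toR7 p α) (toR7 q β) (toR7 s γ) (toR7 t δ)
  rw [neg_sq, weight_mixed hR, weight_D_pow_four hR] at h
  exact h

theorem U₁_fst {m : H2} (hm : m ∈ M) : (U₁ m).1 = m.1 * hopf m.1 := intertwine_hopf hm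

theorem V_fst (l : Fin 3) (m : H2) : (V l m).1 = m.1 * ((1 / 2 : ℝ) • unit l) := by
  rw [V, mul_smul_comm]

/-- The vertical parts of U₁, U₂, V_i and V_j all lie in a · Im ℍ, of dimension at most three, so
the determinant term vanishes and the mixed term gives the cross product. -/
theorem mu_apply {c : ℝ} (hc : 0 < c) {m : H2} (hm : m ∈ M) (k : Fin 3) :
    mu c m k = 3 * (c + ‖m.2‖ ^ 2) ^ (1 / 3 : ℝ) * imCoord (hopfCross m) k := by
  change -starPhi c m _ _ _ _ = _
  rw [starPhi_eq hc hm (U₁_fst hm) (q := 0) (by simp [U₂]) (V_fst _ m) (V_fst _ m) rfl rfl rfl rfl]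
  simp only [U₁, U₂, V]
  -- Making v opaque leaves a polynomial identity in v and a alone, in which only Re v = 0 is
  -- needed.
  obtain ⟨v, hv⟩ : ∃ v, v = hopf m.1 := ⟨_, rfl⟩
  have hv0 : v.re = 0 := by rw [hv, hopf_re]
  rw [← hv]
  fin_cases k <;>
  · simp [det_four, mixedTerm, dxdx, Omega, toR7, coord4, imCoord, Fin.sum_univ_three,
      hopfCross_imI, hopfCross_imJ, hopfCross_imK, ← hv, hv0]
    simp [hopf]
    ring

theorem norm_mu {c : ℝ} (hc : 0 < c) {m : H2} (hm : m ∈ M) :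
    ‖mu c m‖ = 3 * (c + ‖m.2‖ ^ 2) ^ (1 / 3 : ℝ) * ‖hopfCross m‖ := by
  have hR : 0 < c + ‖m.2‖ ^ 2 := by positivity
  rw [← sq_eq_sq₀ (norm_nonneg _) (by positivity), EuclideanSpace.norm_sq_eq, mul_pow,
    normSq_expand (hopfCross m), Fin.sum_univ_three]
  simp only [mu_apply hc hm, Real.norm_eq_abs, sq_abs, imCoord]
  simp
  ring

theorem norm_mu_eq_muNorm {c : ℝ} (hc : 0 < c) {m : H2} (hm : m ∈ principalSet) :
    ‖mu c m‖ = muNorm c (proj m) := by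
  have hr : ‖m.2‖ ≠ 0 := norm_ne_zero_iff.2 (snd_ne_zero (mem_principalSet.1 hm).2)
  rw [norm_mu hc (mem_principalSet.1 hm).1, muNorm]
  simp only [proj]
  rw [sin_theta hm]
  field_simp

/-- The square of the norm of the fibre coordinate, shifted by `c`. -/
def weight (c : ℝ) (m : H2) : ℝ := c + ‖m.2‖ ^ 2

theorem weight_pos {c : ℝ} (hc : 0 < c) (m : H2) : 0 < weight c m := by
  unfold weight; positivity

/-! ### Smoothness of the coframe, of `*φ_c` and of the multi-moment map -/

@[fun_prop] theorem contDiff_weight (c : ℝ) {n : ℕ∞ω} : ContDiff ℝ n (weight c) :=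
  contDiff_const.add (contDiff_snd.norm_sq ℝ)

theorem contDiff_weight_rpow {c : ℝ} (hc : 0 < c) (s : ℝ) {n : ℕ∞ω} :
    ContDiff ℝ n (fun m => weight c m ^ s) :=
  (contDiff_weight c).rpow_const_of_ne fun m => (weight_pos hc m).ne'

@[fun_prop] theorem contDiff_eForm {n : ℕ∞ω} (l : Fin 3) {X : H2 → H2} (hX : ContDiff ℝ n X) :
    ContDiff ℝ n (fun m => eForm l m (X m)) := by
  unfold eForm; fun_prop

@[fun_prop] theorem contDiff_vert {n : ℕ∞ω} {X : H2 → H2} (hX : ContDiff ℝ n X) :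
    ContDiff ℝ n (fun m => vert m (X m)) := by
  unfold vert; fun_prop

theorem contDiff_coframe_fst {c : ℝ} (hc : 0 < c) {n : ℕ∞ω} {X : H2 → H2} (hX : ContDiff ℝ n X)
    (l : Fin 3) : ContDiff ℝ n (fun m => (coframe c m (X m)).1 l) :=
  (contDiff_const.mul (contDiff_weight_rpow hc _)).mul (contDiff_eForm l hX)

theorem contDiff_coframe_snd {c : ℝ} (hc : 0 < c) {n : ℕ∞ω} {X : H2 → H2} (hX : ContDiff ℝ n X)
    (l : Fin 4) : ContDiff ℝ n (fun m => (coframe c m (X m)).2 l) := by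
  refine (contDiff_const.mul (contDiff_weight_rpow hc _)).mul ?_
  have h := contDiff_vert hX
  fin_cases l <;> simp <;> fun_prop

theorem contDiff_det {E ι : Type*} [NormedAddCommGroup E] [NormedSpace ℝ E] [Fintype ι]
    [DecidableEq ι] {n : ℕ∞ω} {A : E → Matrix ι ι ℝ} (hA : ∀ i j, ContDiff ℝ n (fun e => A e i j)) :
    ContDiff ℝ n (fun e => (A e).det) := by
  simp only [Matrix.det_apply]
  exact ContDiff.sum fun σ _ => (contDiff_prod fun i _ => hA _ _).const_smul _

theorem contDiff_starPhi0 {E : Type*} [NormedAddCommGroup E] [NormedSpace ℝ E] {n : ℕ∞ω}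
    {x y z w : Fin 3 → E → ℝ} {a b d f : Fin 4 → E → ℝ} (hx : ∀ l, ContDiff ℝ n (x l))
    (hy : ∀ l, ContDiff ℝ n (y l)) (hz : ∀ l, ContDiff ℝ n (z l)) (hw : ∀ l, ContDiff ℝ n (w l))
    (ha : ∀ l, ContDiff ℝ n (a l)) (hb : ∀ l, ContDiff ℝ n (b l)) (hd : ∀ l, ContDiff ℝ n (d l))
    (hf : ∀ l, ContDiff ℝ n (f l)) :
    ContDiff ℝ n (fun e => starPhi0 (fun l => x l e, fun l => a l e) (fun l => y l e, fun l => b l e)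
      (fun l => z l e, fun l => d l e) (fun l => w l e, fun l => f l e)) := by
  simp only [starPhi0, Omega, dxdx]
  refine ContDiff.sub ?_ (ContDiff.sum fun i _ => ?_)
  · refine contDiff_det fun i l => ?_
    fin_cases i
    exacts [ha l, hb l, hd l, hf l]
  · fun_prop

theorem contDiff_starPhi {c : ℝ} (hc : 0 < c) {n : ℕ∞ω} {X Y Z W : H2 → H2}
    (hX : ContDiff ℝ n X) (hY : ContDiff ℝ n Y) (hZ : ContDiff ℝ n Z) (hW : ContDiff ℝ n W) :
    ContDiff ℝ n (fun m => starPhi c m (X m) (Y m) (Z m) (W m)) :=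
  contDiff_starPhi0 (contDiff_coframe_fst hc hX) (contDiff_coframe_fst hc hY)
    (contDiff_coframe_fst hc hZ) (contDiff_coframe_fst hc hW) (contDiff_coframe_snd hc hX)
    (contDiff_coframe_snd hc hY) (contDiff_coframe_snd hc hZ) (contDiff_coframe_snd hc hW)

@[fun_prop] theorem contDiff_U₁ {n : ℕ∞ω} : ContDiff ℝ n U₁ := by unfold U₁; fun_prop
@[fun_prop] theorem contDiff_U₂ {n : ℕ∞ω} : ContDiff ℝ n U₂ := by unfold U₂; fun_prop
@[fun_prop] theorem contDiff_V {n : ℕ∞ω} (l : Fin 3) : ContDiff ℝ n (V l) := by unfold V; fun_prop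

theorem contDiff_mu_apply {c : ℝ} (hc : 0 < c) {n : ℕ∞ω} (k : Fin 3) :
    ContDiff ℝ n (fun m => mu c m k) :=
  (contDiff_starPhi hc contDiff_U₁ contDiff_U₂ (contDiff_V _) (contDiff_V _)).neg

theorem differentiableAt_mu {c : ℝ} (hc : 0 < c) (m : H2) : DifferentiableAt ℝ (mu c) m :=
  differentiableAt_euclidean.2 fun k =>
    (contDiff_mu_apply hc (n := 1) k).differentiable (by simp) m

@[fun_prop] theorem contDiff_imCoord {n : ℕ∞ω} (k : Fin 3) :
    ContDiff ℝ n (fun q => imCoord q k) := by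
  fin_cases k <;> simp [imCoord] <;> fun_prop

theorem hasDerivAt_imCoord {f : ℝ → ℍ[ℝ]} {f' : ℍ[ℝ]} {t : ℝ} (hf : HasDerivAt f f' t)
    (k : Fin 3) : HasDerivAt (fun s => imCoord (f s) k) (imCoord f' k) t :=
  HasFDerivAt.comp_hasDerivAt t (LinearMap.toContinuousLinearMap (E := ℍ[ℝ]) (F' := ℝ)
    { toFun := fun q => imCoord q k
      map_add' := fun p q => by fin_cases k <;> simp [imCoord]
      map_smul' := fun r q => by fin_cases k <;> simp [imCoord] }).hasFDerivAt hf

theorem imCoord_hopfCross (m : H2) (k : Fin 3) : imCoord (hopfCross m) k =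
    imCoord (hopf m.1) (k + 1) * imCoord (hopf m.2) (k + 2) -
      imCoord (hopf m.1) (k + 2) * imCoord (hopf m.2) (k + 1) := by
  fin_cases k
  · exact hopfCross_imI m
  · exact hopfCross_imJ m
  · exact hopfCross_imK m

/-- The formula for μ is differentiated as a product. The derivative of (c + r²)^(1/3) accounts for
the determinant term of `*φ_c`, and the derivative of n for the mixed term; the two powers of c + r²
match separately. -/
theorem isMultiMomentMap_mu {c : ℝ} (hc : 0 < c) : IsMultiMomentMap c (mu c) := by
  intro m hm
  refine ⟨differentiableAt_mu hc m, fun X hX k => ?_⟩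
  obtain ⟨p, hp, hp0⟩ := exists_tangent hm hX
  have hR := weight_pos hc m
  have h1 : fderiv ℝ (mu c) m X k = fderiv ℝ (fun n => mu c n k) m X := by
    have h := (EuclideanSpace.proj k : EuclideanSpace ℝ (Fin 3) →L[ℝ] ℝ).hasFDerivAt.comp m
      (differentiableAt_mu hc m).hasFDerivAt
    exact (congrArg (fun f : H2 →L[ℝ] ℝ => f X) h.fderiv).symm
  -- The closed formula holds only on M, so the derivatives are compared along tangent vectors of M.
  have h2 : fderiv ℝ (fun n => mu c n k) m X =
      fderiv ℝ (fun n => 3 * weight c n ^ (1 / 3 : ℝ) * imCoord (hopfCross n) k) m X := by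
    refine fderiv_eq_of_eqOn_M hm hX
      ((contDiff_mu_apply hc (n := 1) k).differentiable (by simp) m)
      (ContDiff.differentiable (n := 1) ?_ (by simp) m) fun n hn => mu_apply hc hn k
    exact (contDiff_const.mul (contDiff_weight_rpow hc _)).mul
      ((contDiff_imCoord k).comp contDiff_hopfCross)
  have hd : DifferentiableAt ℝ
      (fun n => 3 * weight c n ^ (1 / 3 : ℝ) * imCoord (hopfCross n) k) m :=
    ContDiff.differentiable (n := 1) ((contDiff_const.mul (contDiff_weight_rpow hc _)).mul
      ((contDiff_imCoord k).comp contDiff_hopfCross)) (by simp) m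
  have h3 : HasDerivAt (fun t : ℝ => 3 * weight c (m + t • X) ^ (1 / 3 : ℝ) *
      imCoord (hopfCross (m + t • X)) k) _ 0 := hd.hasFDerivAt.hasLineDerivAt X
  simp only [imCoord_hopfCross (m + _ • X)] at h3
  have hv := hasDerivAt_hopf (hasDerivAt_line m.1 X.1)
  have hw := hasDerivAt_hopf (hasDerivAt_line m.2 X.2)
  have hwt : HasDerivAt (fun t : ℝ => weight c (m + t • X)) (2 * ⟪m.2, X.2⟫_ℝ) 0 := by
    simpa [weight] using ((hasDerivAt_line m.2 X.2).norm_sq).const_add c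
  have hrp := hwt.rpow_const (p := 1 / 3) (Or.inl (by simpa using hR.ne'))
  have h4 := (hrp.const_mul 3).mul
    (((hasDerivAt_imCoord hv (k + 1)).mul (hasDerivAt_imCoord hw (k + 2))).sub
      ((hasDerivAt_imCoord hv (k + 2)).mul (hasDerivAt_imCoord hw (k + 1))))
  rw [h1, h2, h3.unique h4]
  obtain ⟨v, hvd⟩ : ∃ v, v = hopf m.1 := ⟨_, rfl⟩
  have hv0 : v.re = 0 := by rw [hvd, hopf_re]
  -- The vertical coordinate η replaces X.2, matching the variables of `starPhi_eq`.
  obtain ⟨η, hη⟩ : ∃ η, η = X.2 - (1 / 2 : ℝ) • (m.2 * p) := ⟨_, rfl⟩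
  have hη' : X.2 = η + (1 / 2 : ℝ) • (m.2 * p) := by rw [hη]; abel
  rw [starPhi_eq hc hm (U₁_fst hm) (q := 0) (by simp [U₂]) (V_fst _ m) hp rfl rfl rfl hη.symm]
  have hvX : star X.1 * unit 0 * m.1 + star m.1 * unit 0 * X.1 = v * p - p * v := by
    rw [hp, star_mul, star_eq_neg hp0, hvd]
    simp only [hopf, mul_assoc, neg_mul]
    abel
  simp only [Pi.mul_apply, Pi.sub_apply, zero_smul, add_zero, hvX, U₁, U₂, V, ← hvd, weight]
  rw [hη', show (1 / 3 - 1 : ℝ) = -(2 / 3) by norm_num]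
  fin_cases k <;>
  · simp [det_four, mixedTerm, dxdx, Omega, toR7, coord4, imCoord, Fin.sum_univ_three, hp0, hv0,
      inner_expand]
    simp [hopf]
    ring

/-! ### Embedded submanifolds -/

section Submanifolds

variable {E F N : Type*} [NormedAddCommGroup E] [NormedSpace ℝ E]
  [NormedAddCommGroup F] [NormedSpace ℝ F] [NormedAddCommGroup N] [NormedSpace ℝ N]

theorem Diffeomorphic.trans {A : Set E} {B : Set F} {C : Set N} (h : Diffeomorphic A B)
    (h' : Diffeomorphic B C) : Diffeomorphic A C := by
  obtain ⟨f, g, hf, hg, mf, mg, l, r⟩ := h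
  obtain ⟨f', g', hf', hg', mf', mg', l', r'⟩ := h'
  refine ⟨f' ∘ f, g ∘ g', hf'.comp hf mf, hg.comp hg' mg', mf'.comp mf, mg.comp mg', ?_, ?_⟩
  · intro x hx
    simp only [Function.comp_apply]
    rw [l' (mf hx), l hx]
  · intro x hx
    simp only [Function.comp_apply]
    rw [r (mg' hx), r' hx]

/-- A chart of A is composed with the inverse diffeomorphism; the preimage of its domain is open
only relative to L and has to be cut out by an open set of the ambient space. -/
theorem IsEmbeddedSubmanifold.of_diffeomorphic {k : ℕ} {L : Set E} {A : Set F}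
    (hA : IsEmbeddedSubmanifold k A) (h : Diffeomorphic L A) : IsEmbeddedSubmanifold k L := by
  obtain ⟨f, g, hf, hg, mf, mg, l, r⟩ := h
  intro m hm
  obtain ⟨U', V, hU', hmU', hV, hVA⟩ := hA (f m) (mf hm)
  obtain ⟨U, hU, hU2⟩ := continuousOn_iff'.1 hf.continuousOn U' hU'
  have hmem : ∀ n, n ∈ L ∩ U ↔ n ∈ L ∧ f n ∈ U' := fun n => by
    constructor
    · intro hn
      have : n ∈ f ⁻¹' U' ∩ L := by rw [hU2]; exact ⟨hn.2, hn.1⟩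
      exact ⟨hn.1, this.1⟩
    · intro hn
      have : n ∈ U ∩ L := by rw [← hU2]; exact ⟨hn.2, hn.1⟩
      exact ⟨hn.1, this.1⟩
  refine ⟨U, V, hU, ((hmem m).2 ⟨hm, hmU'⟩).2, hV, hVA.trans ?_⟩
  refine ⟨g, f, hg.mono Set.inter_subset_left, hf.mono Set.inter_subset_left, ?_, ?_,
    fun a ha => r ha.1, fun n hn => l hn.1⟩
  · intro a ha
    exact (hmem _).2 ⟨mg ha.1, by rw [r ha.1]; exact ha.2⟩
  · intro n hn
    exact ⟨mf hn.1, ((hmem n).1 hn).2⟩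

/-- The fibres of a smooth fibre bundle are diffeomorphic to the typical fibre. -/
theorem IsSmoothFibreBundle.diffeomorphic {π : E → F} {X : Set E} {Y : Set F} {P : Set N}
    (h : IsSmoothFibreBundle π X Y P) {y : F} (hy : y ∈ Y) :
    Diffeomorphic (X ∩ π ⁻¹' {y}) P := by
  obtain ⟨W, hW, hyW, f, g, hf, hg, mf, mg, l, r⟩ := h.2.2 y hy
  have hsub : X ∩ π ⁻¹' {y} ⊆ X ∩ π ⁻¹' W := fun m hm => ⟨hm.1, by
    have : π m = y := hm.2
    change π m ∈ W
    rwa [this]⟩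
  refine ⟨f, fun n => g (y, n), hf.mono hsub, ?_, mf.mono_left hsub, ?_, ?_, ?_⟩
  · exact hg.comp (contDiff_const.prodMk contDiff_id).contDiffOn fun n hn => ⟨⟨hy, hyW⟩, hn⟩
  · intro n hn
    exact ⟨(mg (show (y, n) ∈ (Y ∩ W) ×ˢ P from ⟨⟨hy, hyW⟩, hn⟩)).1, (r y ⟨hy, hyW⟩ n hn).1⟩
  · intro m hm
    have : π m = y := hm.2
    have := l m (hsub hm)
    simp_all
  · intro n hn
    exact (r y ⟨hy, hyW⟩ n hn).2

theorem tangentTo_mono {L L' : Set E} (h : L ⊆ L') (m : E) : tangentTo L m ≤ tangentTo L' m :=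
  Submodule.span_mono fun _ ⟨γ, h1, h2, h3⟩ => ⟨γ, h1, h2.mono fun _ ht => h ht, h3⟩

theorem tangentTo_inter_isOpen {L O : Set E} (hO : IsOpen O) {m : E} (hm : m ∈ O) :
    tangentTo (L ∩ O) m = tangentTo L m := by
  refine le_antisymm (tangentTo_mono Set.inter_subset_left m) (Submodule.span_mono ?_)
  rintro X ⟨γ, h1, h2, h3, h4⟩
  refine ⟨γ, h1, ?_, h3, h4⟩
  have : ∀ᶠ t in 𝓝 (0 : ℝ), γ t ∈ O := h1.continuousAt (hO.mem_nhds (by rwa [h3]))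
  filter_upwards [h2, this] with t ht ht' using ⟨ht, ht'⟩

end Submanifolds

/-- The angle of a complex number, measured from `z₀`. -/
def angleFrom (z₀ z : ℂ) : ℝ := (Complex.log (star z₀ * z)).im

theorem contDiffAt_angleFrom {z₀ z : ℂ} (h : star z₀ * z ∈ Complex.slitPlane) :
    ContDiffAt ℝ ∞ (angleFrom z₀) z := by
  have h1 : ContDiffAt ℝ ∞ (fun z => star z₀ * z) z := by fun_prop
  have h2 : ContDiffAt ℝ ∞ Complex.log (star z₀ * z) := (Complex.contDiffAt_log h).restrict_scalars ℝ
  exact Complex.imCLM.contDiff.contDiffAt.comp z (h2.comp z h1)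

theorem mul_exp_angleFrom {z₀ z : ℂ} (h0 : ‖z₀‖ = 1) (h : ‖z‖ = 1) :
    z₀ * Complex.exp (angleFrom z₀ z * Complex.I) = z := by
  have h1 : ‖star z₀ * z‖ = 1 := by rw [norm_mul, norm_star, h0, h, one_mul]
  have h2 := Complex.norm_mul_exp_arg_mul_I (star z₀ * z)
  rw [h1, Complex.ofReal_one, one_mul] at h2
  rw [angleFrom, Complex.log_im, h2, ← mul_assoc]
  have h3 : z₀ * star z₀ = 1 := by
    have := Complex.mul_conj z₀
    rw [Complex.normSq_eq_norm_sq, h0] at this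
    simpa using this
  rw [h3, one_mul]

theorem angleFrom_mul_exp {z₀ : ℂ} (h0 : ‖z₀‖ = 1) {t : ℝ} (ht : t ∈ Set.Ioo (-Real.pi) Real.pi) :
    angleFrom z₀ (z₀ * Complex.exp (t * Complex.I)) = t ∧
      star z₀ * (z₀ * Complex.exp (t * Complex.I)) ∈ Complex.slitPlane := by
  have h3 : star z₀ * z₀ = 1 := by
    have := Complex.mul_conj z₀
    rw [Complex.normSq_eq_norm_sq, h0, mul_comm] at this
    simpa using this
  have ha : Complex.arg (Complex.exp (t * Complex.I)) = t := by
    rw [Complex.arg_exp_mul_I, toIocMod_eq_self]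
    constructor
    · exact ht.1
    · linarith [ht.2]
  rw [angleFrom, ← mul_assoc, h3, one_mul, Complex.log_im, ha]
  refine ⟨rfl, Complex.mem_slitPlane_iff_arg.2 ⟨?_, Complex.exp_ne_zero _⟩⟩
  rw [ha]
  exact ht.2.ne

theorem angleFrom_mem {z₀ z : ℂ} (h : star z₀ * z ∈ Complex.slitPlane) :
    angleFrom z₀ z ∈ Set.Ioo (-Real.pi) Real.pi := by
  rw [angleFrom, Complex.log_im]
  exact ⟨Complex.neg_pi_lt_arg _,
    lt_of_le_of_ne (Complex.arg_le_pi _) (Complex.mem_slitPlane_iff_arg.1 h).1⟩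

theorem star_mul_mem_slitPlane {z : ℂ} (h : ‖z‖ = 1) : star z * z ∈ Complex.slitPlane := by
  have := Complex.mul_conj z
  rw [Complex.normSq_eq_norm_sq, h, mul_comm] at this
  change star z * z = _ at this
  rw [this]
  simp

theorem isOpen_slit (z₀ : ℂ) : IsOpen {z : ℂ | star z₀ * z ∈ Complex.slitPlane} :=
  Complex.isOpen_slitPlane.preimage (by fun_prop)

theorem norm_mul_exp {z₀ : ℂ} (h : ‖z₀‖ = 1) (t : ℝ) :
    ‖z₀ * Complex.exp (t * Complex.I)‖ = 1 := by
  rw [norm_mul, h, Complex.norm_exp_ofReal_mul_I, one_mul]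

@[fun_prop] theorem contDiff_ofReal {n : ℕ∞ω} : ContDiff ℝ n (fun t : ℝ => (t : ℂ)) :=
  Complex.ofRealCLM.contDiff

/-- The angles measured from the two circle coordinates of the centre are smooth once the antipodal
points are removed. -/
theorem isEmbeddedSubmanifold_torusLine : IsEmbeddedSubmanifold 3 torusLine := by
  rintro ⟨a, b, c⟩ ⟨ha, hb⟩
  simp only at ha hb
  refine ⟨{p | star a * p.1 ∈ Complex.slitPlane ∧ star b * p.2.1 ∈ Complex.slitPlane},
    {s | s 0 ∈ Set.Ioo (-Real.pi) Real.pi ∧ s 1 ∈ Set.Ioo (-Real.pi) Real.pi}, ?_,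
    ⟨star_mul_mem_slitPlane ha, star_mul_mem_slitPlane hb⟩, ?_,
    fun s => (a * Complex.exp (s 0 * Complex.I), b * Complex.exp (s 1 * Complex.I), s 2),
    fun p => WithLp.toLp 2 ![angleFrom a p.1, angleFrom b p.2.1, p.2.2], ?_, ?_, ?_, ?_, ?_, ?_⟩
  · exact ((isOpen_slit a).preimage continuous_fst).inter
      ((isOpen_slit b).preimage (continuous_fst.comp continuous_snd))
  · exact (isOpen_Ioo.preimage (by fun_prop)).inter (isOpen_Ioo.preimage (by fun_prop))
  · apply ContDiff.contDiffOn
    fun_prop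
  · rintro p ⟨-, hp1, hp2⟩
    refine ContDiffAt.contDiffWithinAt (contDiffAt_euclidean.2 fun l => ?_)
    have h1 := (contDiffAt_angleFrom hp1).comp p contDiffAt_fst
    have h2 := (contDiffAt_angleFrom hp2).comp p (contDiffAt_fst.comp p contDiffAt_snd)
    fin_cases l
    · exact h1
    · exact h2
    · exact contDiffAt_snd.comp p contDiffAt_snd
  · rintro s ⟨h1, h2⟩
    exact ⟨⟨norm_mul_exp ha _, norm_mul_exp hb _⟩, (angleFrom_mul_exp ha h1).2,
      (angleFrom_mul_exp hb h2).2⟩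
  · rintro p ⟨-, hp1, hp2⟩
    exact ⟨angleFrom_mem hp1, angleFrom_mem hp2⟩
  · rintro s ⟨h1, h2⟩
    ext l
    fin_cases l
    · exact (angleFrom_mul_exp ha h1).1
    · exact (angleFrom_mul_exp hb h2).1
    · rfl
  · rintro p ⟨⟨h1, h2⟩, -⟩
    exact Prod.ext (mul_exp_angleFrom ha h1) (Prod.ext (mul_exp_angleFrom hb h2) rfl)

theorem isEmbeddedSubmanifold_circlePlane : IsEmbeddedSubmanifold 3 circlePlane := by
  rintro ⟨a, b⟩ ha
  replace ha : ‖a‖ = 1 := ha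
  refine ⟨{p | star a * p.1 ∈ Complex.slitPlane}, {s | s 0 ∈ Set.Ioo (-Real.pi) Real.pi},
    (isOpen_slit a).preimage continuous_fst, star_mul_mem_slitPlane ha,
    isOpen_Ioo.preimage (by fun_prop),
    fun s => (a * Complex.exp (s 0 * Complex.I), (s 1 : ℂ) + s 2 * Complex.I),
    fun p => WithLp.toLp 2 ![angleFrom a p.1, p.2.re, p.2.im], ?_, ?_, ?_, ?_, ?_, ?_⟩
  · apply ContDiff.contDiffOn
    fun_prop
  · rintro p ⟨-, hp1⟩
    refine ContDiffAt.contDiffWithinAt (contDiffAt_euclidean.2 fun l => ?_)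
    have h1 := (contDiffAt_angleFrom hp1).comp p contDiffAt_fst
    fin_cases l
    · exact h1
    · exact Complex.reCLM.contDiff.contDiffAt.comp p contDiffAt_snd
    · exact Complex.imCLM.contDiff.contDiffAt.comp p contDiffAt_snd
  · rintro s h1
    exact ⟨norm_mul_exp ha _, (angleFrom_mul_exp ha h1).2⟩
  · rintro p ⟨-, hp1⟩
    exact angleFrom_mem hp1
  · rintro s h1
    ext l
    fin_cases l
    · exact (angleFrom_mul_exp ha h1).1
    · simp
    · simp
  · rintro p ⟨h1, -⟩
    exact Prod.ext (mul_exp_angleFrom ha h1) (by simp)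

theorem tangentTo_le_TM {L : Set H2} (hL : L ⊆ M) (m : H2) : tangentTo L m ≤ TM m := by
  refine Submodule.span_le.2 ?_
  rintro X ⟨γ, h1, h2, rfl, rfl⟩
  have hd : HasDerivAt γ (deriv γ 0) 0 := (h1.differentiableAt (by simp)).hasDerivAt
  have h0 : HasDerivAt (fun t => (γ t).1) (deriv γ 0).1 0 := hd.fst
  have h3 := h0.norm_sq
  have h4 : HasDerivAt (fun t => ‖(γ t).1‖ ^ 2) 0 0 := by
    refine (hasDerivAt_const (0 : ℝ) (1 : ℝ)).congr_of_eventuallyEq ?_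
    filter_upwards [h2] with t ht
    rw [show ‖(γ t).1‖ = 1 from hL ht, one_pow]
  have h5 := h3.unique h4
  change ⟪(γ 0).1, (deriv γ 0).1⟫_ℝ = 0
  linarith

/-! ### Fixed points of elements of the group -/

/-- The fixed points in `M` of an element of the group. -/
def fixedSet (g : G) : Set H2 := {m | m ∈ M ∧ act g m = m}

/-- The action is linear, so velocities inherit the fixed point equation. Conversely, if g fixes m
and X, it fixes the whole normalised line `curveM m X`. -/
theorem tangentTo_fixedSet (g : G) {m : H2} (hm : m ∈ fixedSet g) {X : H2} :
    X ∈ tangentTo (fixedSet g) m ↔ X ∈ TM m ∧ act g X = X := by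
  constructor
  · intro hX
    refine ⟨tangentTo_le_TM (fun _ h => h.1) m hX, ?_⟩
    have : tangentTo (fixedSet g) m ≤ LinearMap.eqLocus (act g) LinearMap.id := by
      refine Submodule.span_le.2 ?_
      rintro Y ⟨γ, h1, h2, rfl, rfl⟩
      have hd : HasDerivAt γ (deriv γ 0) 0 := (h1.differentiableAt (by simp)).hasDerivAt
      have h3 : HasDerivAt (fun t => act g (γ t)) (act g (deriv γ 0)) 0 :=
        (LinearMap.toContinuousLinearMap (act g)).hasFDerivAt.comp_hasDerivAt 0 hd
      refine h3.unique (hd.congr_of_eventuallyEq ?_)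
      filter_upwards [h2] with t ht using ht.2
    exact this hX
  · rintro ⟨hX, hg⟩
    refine Submodule.subset_span ⟨curveM m X, (contDiff_curveM m X).contDiffAt, ?_,
      curveM_zero m X, (hasDerivAt_curveM m X).deriv⟩
    refine Filter.Eventually.of_forall fun t => ⟨curveM_mem hm.1 hX t, ?_⟩
    have h1 := Prod.ext_iff.1 hm.2
    have h2 := Prod.ext_iff.1 hg
    rw [act_fst, act_snd] at h1 h2
    ext1
    · rw [act_fst]
      simp only [curveM, mul_smul_comm, smul_mul_assoc, mul_add, add_mul, h1.1, h2.1]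
    · rw [act_snd]
      simp only [curveM, mul_smul_comm, smul_mul_assoc, mul_add, add_mul, h1.2, h2.2]

/-! ### Linear algebra of the metric -/

/-- The coframe as a linear map. -/
def coframeL (c : ℝ) (m : H2) : H2 →ₗ[ℝ] R7 where
  toFun := coframe c m
  map_add' X Y := by
    ext l
    · simp only [coframe, eForm, Prod.fst_add, Pi.add_apply, inner_add_right]; ring
    · fin_cases l <;> simp [coframe, vert, mul_add] <;> ring
  map_smul' r X := by
    ext l
    · simp [coframe, eForm, inner_smul_right]; ring
    · fin_cases l <;> simp [coframe, vert] <;> ring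

theorem coframeL_apply (c : ℝ) (m X : H2) : coframeL c m X = coframe c m X := rfl

/-- The standard inner product of `ℝ⁷`. -/
def dotR7 : LinearMap.BilinForm ℝ R7 :=
  LinearMap.mk₂ ℝ (fun u w => ∑ l, u.1 l * w.1 l + ∑ l, u.2 l * w.2 l)
    (fun u u' w => by simp [Fin.sum_univ_succ]; ring) (fun r u w => by simp [Fin.sum_univ_succ]; ring)
    (fun u w w' => by simp [Fin.sum_univ_succ]; ring) (fun r u w => by simp [Fin.sum_univ_succ]; ring)

/-- The metric as a bilinear form. -/
def metricL (c : ℝ) (m : H2) : LinearMap.BilinForm ℝ H2 :=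
  dotR7.compl₁₂ (coframeL c m) (coframeL c m)

theorem metricL_apply (c : ℝ) (m X Y : H2) : metricL c m X Y = metric c m X Y := rfl

theorem metric_comm (c : ℝ) (m X Y : H2) : metric c m X Y = metric c m Y X := by
  simp only [metric, mul_comm]

theorem metric_add_left (c : ℝ) (m X Y Z : H2) :
    metric c m (X + Y) Z = metric c m X Z + metric c m Y Z := by
  simp only [← metricL_apply, map_add, LinearMap.add_apply]

theorem metric_smul_left (c : ℝ) (m : H2) (r : ℝ) (X Y : H2) :
    metric c m (r • X) Y = r * metric c m X Y := by
  simp only [← metricL_apply, map_smul, LinearMap.smul_apply, smul_eq_mul]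

theorem metric_add_right (c : ℝ) (m X Y Z : H2) :
    metric c m X (Y + Z) = metric c m X Y + metric c m X Z := by
  simp only [← metricL_apply, map_add]

theorem metric_smul_right (c : ℝ) (m : H2) (r : ℝ) (X Y : H2) :
    metric c m X (r • Y) = r * metric c m X Y := by
  simp only [← metricL_apply, map_smul, smul_eq_mul]

theorem metric_zero_left (c : ℝ) (m Y : H2) : metric c m 0 Y = 0 := by
  simp only [← metricL_apply, map_zero, LinearMap.zero_apply]

theorem metric_neg_left (c : ℝ) (m X Y : H2) : metric c m (-X) Y = -metric c m X Y := by
  simp only [← metricL_apply, map_neg, LinearMap.neg_apply]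

theorem metric_neg_right (c : ℝ) (m X Y : H2) : metric c m X (-Y) = -metric c m X Y := by
  simp only [← metricL_apply, map_neg]

/-- The metric is positive definite on `T_m M`. -/
theorem eq_zero_of_metric_self {c : ℝ} (hc : 0 < c) {m : H2} (hm : m ∈ M) {X : H2}
    (hX : X ∈ TM m) (h : metric c m X X = 0) : X = 0 := by
  refine coframe_injOn hc hm hX (TM m).zero_mem ?_
  rw [← coframeL_apply, ← coframeL_apply, map_zero]
  have h1 : 0 ≤ ∑ l, (coframe c m X).1 l * (coframe c m X).1 l :=
    Finset.sum_nonneg fun l _ => mul_self_nonneg _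
  have h2 : 0 ≤ ∑ l, (coframe c m X).2 l * (coframe c m X).2 l :=
    Finset.sum_nonneg fun l _ => mul_self_nonneg _
  have h3 : ∑ l, (coframe c m X).1 l * (coframe c m X).1 l = 0 := by
    unfold metric at h; linarith
  have h4 : ∑ l, (coframe c m X).2 l * (coframe c m X).2 l = 0 := by
    unfold metric at h; linarith
  rw [Finset.sum_eq_zero_iff_of_nonneg fun l _ => mul_self_nonneg _] at h3 h4
  ext l
  · exact mul_self_eq_zero.1 (h3 l (Finset.mem_univ l))
  · exact mul_self_eq_zero.1 (h4 l (Finset.mem_univ l))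

/-- A coordinate expression of the metric, in the left trivialisation of `T S³`. -/
theorem metric_tangent {c : ℝ} (hc : 0 < c) {m : H2} (hm : m ∈ M) {X Y : H2} {p q : ℍ[ℝ]}
    (hX : X.1 = m.1 * p) (hY : Y.1 = m.1 * q) (hp : p.re = 0) :
    metric c m X Y = 3 * weight c m ^ (2 / 3 : ℝ) * ⟪p, q⟫_ℝ + 4 * weight c m ^ (-(1 / 3) : ℝ) *
      ⟪X.2 - (1 / 2 : ℝ) • (m.2 * p), Y.2 - (1 / 2 : ℝ) • (m.2 * q)⟫_ℝ := by
  have h : ∀ s : ℍ[ℝ], star m.1 * (m.1 * s) = s := fun s => by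
    rw [← mul_assoc, star_mul_of_norm_one hm, one_mul]
  have hR := weight_pos hc m
  unfold weight at *
  rw [metric_eq, vert_tangent hm hX, vert_tangent hm hY, hX, hY, h, h, hp, weight_A_sq hR,
    weight_D_sq hR, zero_mul, sub_zero]

/-! ### Associative planes -/

theorem phi0_combination (C : Matrix (Fin 3) (Fin 3) ℝ) (u : Fin 3 → R7) :
    phi0 (∑ j, C 0 j • u j) (∑ j, C 1 j • u j) (∑ j, C 2 j • u j) =
      C.det * phi0 (u 0) (u 1) (u 2) := by
  have add₁ : ∀ X X' Y Z, phi0 (X + X') Y Z = phi0 X Y Z + phi0 X' Y Z := fun X X' Y Z => by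
    simp only [phi0, Omega, Matrix.det_fin_three, Fin.sum_univ_three]; simp; ring
  have smul₁ : ∀ (r : ℝ) X Y Z, phi0 (r • X) Y Z = r * phi0 X Y Z := fun r X Y Z => by
    simp only [phi0, Omega, Matrix.det_fin_three, Fin.sum_univ_three]; simp; ring
  have rot : ∀ X Y Z, phi0 X Y Z = phi0 Y Z X := fun X Y Z => by
    simp only [phi0, Omega, Matrix.det_fin_three, Fin.sum_univ_three]; simp; ring
  have swap : ∀ X Y Z, phi0 X Y Z = -phi0 Y X Z := fun X Y Z => by
    simp only [phi0, Omega, Matrix.det_fin_three, Fin.sum_univ_three]; simp; ring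
  have diag : ∀ X Z, phi0 X X Z = 0 := fun X Z => by linarith [swap X X Z]
  have diag' : ∀ X Z, phi0 Z X X = 0 := fun X Z => by rw [rot, diag]
  have diag'' : ∀ X Z, phi0 X Z X = 0 := fun X Z => by rw [rot, diag']
  have add₂ : ∀ X X' Y Z, phi0 Y (X + X') Z = phi0 Y X Z + phi0 Y X' Z := fun X X' Y Z => by
    rw [rot, add₁, rot Y X Z, rot Y X' Z]
  have smul₂ : ∀ (r : ℝ) X Y Z, phi0 Y (r • X) Z = r * phi0 Y X Z := fun r X Y Z => by
    rw [rot, smul₁, ← rot]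
  have add₃ : ∀ X X' Y Z, phi0 Y Z (X + X') = phi0 Y Z X + phi0 Y Z X' := fun X X' Y Z => by
    rw [rot, add₂, rot Y Z X, rot Y Z X']
  have smul₃ : ∀ (r : ℝ) X Y Z, phi0 Y Z (r • X) = r * phi0 Y Z X := fun r X Y Z => by
    rw [rot, smul₂, ← rot]
  have e1 : phi0 (u 0) (u 2) (u 1) = -phi0 (u 0) (u 1) (u 2) := by rw [rot, swap, ← rot, ← rot,
    ← rot]
  have e2 : phi0 (u 1) (u 2) (u 0) = phi0 (u 0) (u 1) (u 2) := (rot _ _ _).symm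
  have e3 : phi0 (u 2) (u 0) (u 1) = phi0 (u 0) (u 1) (u 2) := by rw [rot]
  have e4 : phi0 (u 1) (u 0) (u 2) = -phi0 (u 0) (u 1) (u 2) := swap _ _ _
  have e5 : phi0 (u 2) (u 1) (u 0) = -phi0 (u 0) (u 1) (u 2) := by rw [swap, e2]
  simp only [Fin.sum_univ_three, add₁, add₂, add₃, smul₁, smul₂, smul₃, diag, diag', diag'', e1, e2,
    e3, e4, e5, Matrix.det_fin_three]
  ring

/-- The Gram matrix of three vectors. -/
def gram (c : ℝ) (m : H2) (b : Fin 3 → H2) : Matrix (Fin 3) (Fin 3) ℝ :=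
  Matrix.of fun i j => metric c m (b i) (b j)

/-- An orthonormal frame of P is X = C b with C G Cᵀ = 1, hence (det C)² det G = 1, while φ(X) = det
C · φ(b). So φ(X)² = 1 as soon as φ(b)² = det G. Nonvanishing of φ(b) makes G nonsingular and b
independent. -/
theorem isAssociativePlane_of_gram {c : ℝ} (hc : 0 < c) {m : H2} (hm : m ∈ M) {b : Fin 3 → H2}
    (hb : ∀ i, b i ∈ TM m) (h : phi c m (b 0) (b 1) (b 2) ^ 2 = (gram c m b).det)
    (h0 : phi c m (b 0) (b 1) (b 2) ≠ 0) {P : Submodule ℝ H2}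
    (hP : P = Submodule.span ℝ (Set.range b)) : IsAssociativePlane c m P := by
  have hle : P ≤ TM m := by
    rw [hP, Submodule.span_le]
    rintro _ ⟨i, rfl⟩
    exact hb i
  refine ⟨hle, ?_, fun X hX hXo => ?_⟩
  · have hli : LinearIndependent ℝ b := by
      rw [Fintype.linearIndependent_iff]
      intro g hg
      by_contra! hne
      refine (pow_ne_zero 2 h0) (h.trans ?_)
      -- The coefficients of a linear relation among the b_i form a kernel vector of the Gram
      -- matrix.
      refine Matrix.exists_mulVec_eq_zero_iff.1 ⟨g, fun hh => ?_, ?_⟩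
      · obtain ⟨i, hi⟩ := hne
        exact hi (congrFun hh i)
      · ext i
        have : metricL c m (b i) (∑ j, g j • b j) = 0 := by rw [hg, map_zero]
        rw [map_sum] at this
        simp only [map_smul, smul_eq_mul, metricL_apply] at this
        rw [Matrix.mulVec, dotProduct, Pi.zero_apply, ← this]
        exact Finset.sum_congr rfl fun j _ => mul_comm _ _
    rw [hP, finrank_span_eq_card hli]
    simp
  · have hC : ∀ l, ∃ g : Fin 3 → ℝ, ∑ j, g j • b j = X l := fun l => by
      have := hX l
      rw [hP] at this
      exact (Submodule.mem_span_range_iff_exists_fun ℝ).1 this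
    choose C hC using hC
    have h1 : Matrix.of C * gram c m b * (Matrix.of C).transpose = 1 := by
      ext i j
      rw [Matrix.one_apply, ← hXo i j, ← hC i, ← hC j, ← metricL_apply]
      simp only [Matrix.mul_apply, Matrix.transpose_apply, Matrix.of_apply, gram,
        Fin.sum_univ_three, map_add, map_smul, LinearMap.add_apply, LinearMap.smul_apply,
        smul_eq_mul, metricL_apply]
      ring
    have h2 := congrArg Matrix.det h1
    rw [Matrix.det_mul, Matrix.det_mul, Matrix.det_transpose, Matrix.det_one, ← h] at h2
    have h3 : phi c m (X 0) (X 1) (X 2) =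
        (Matrix.of C).det * phi c m (b 0) (b 1) (b 2) := by
      rw [phi_eq_phi0_coframe hc hm (hle (hX 0)) (hle (hX 1)) (hle (hX 2)),
        phi_eq_phi0_coframe hc hm (hb 0) (hb 1) (hb 2), ← hC, ← hC, ← hC]
      simp only [← coframeL_apply, map_sum, map_smul]
      exact phi0_combination (Matrix.of C) fun j => coframeL c m (b j)
    have h4 : phi c m (X 0) (X 1) (X 2) ^ 2 = 1 := by rw [h3, ← h2]; ring
    exact (sq_eq_sq₀ (abs_nonneg _) zero_le_one).1 (by rw [sq_abs, h4, one_pow])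

/-! ### Totally geodesic submanifolds -/

theorem contDiff_metric {c : ℝ} (hc : 0 < c) {n : ℕ∞ω} {E : Type*} [NormedAddCommGroup E]
    [NormedSpace ℝ E] {P X Y : E → H2} (hP : ContDiff ℝ n P) (hX : ContDiff ℝ n X)
    (hY : ContDiff ℝ n Y) : ContDiff ℝ n (fun e => metric c (P e) (X e) (Y e)) := by
  have hw : ∀ s : ℝ, ContDiff ℝ n (fun e => (c + ‖(P e).2‖ ^ 2) ^ s) := fun s =>
    (contDiff_weight_rpow hc s).comp hP
  have hw1 := hw (1 / 3)
  have hw2 := hw (-(1 / 6))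
  simp only [metric_eq, vert]
  fun_prop

/-- The derivative of the metric at `m` in the direction `X`, on fixed vectors. -/
def metricDeriv (c : ℝ) (m X Y Z : H2) : ℝ := deriv (fun t : ℝ => metric c (m + t • X) Y Z) 0

/-- The product rule: the metric is one smooth function of the base point and two vectors, bilinear
in the latter. -/
theorem fderiv_metric {c : ℝ} (hc : 0 < c) {Y Z : H2 → H2} {m : H2}
    (hY : DifferentiableAt ℝ Y m) (hZ : DifferentiableAt ℝ Z m) (X : H2) :
    fderiv ℝ (fun p => metric c p (Y p) (Z p)) m X = metricDeriv c m X (Y m) (Z m) +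
      metric c m (fderiv ℝ Y m X) (Z m) + metric c m (Y m) (fderiv ℝ Z m X) := by
  have hg : Differentiable ℝ (fun q : H2 × H2 × H2 => metric c q.1 q.2.1 q.2.2) :=
    (contDiff_metric hc (n := 1) contDiff_fst (contDiff_fst.comp contDiff_snd)
      (contDiff_snd.comp contDiff_snd)).differentiable (by simp)
  have h1 := (hg (m, Y m, Z m)).hasFDerivAt
  have h2 := HasFDerivAt.comp m h1
    ((hasFDerivAt_id m).prodMk (hY.hasFDerivAt.prodMk hZ.hasFDerivAt))
  have h3 : fderiv ℝ (fun p => metric c p (Y p) (Z p)) m X =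
      fderiv ℝ (fun q : H2 × H2 × H2 => metric c q.1 q.2.1 q.2.2) (m, Y m, Z m)
        (X, fderiv ℝ Y m X, fderiv ℝ Z m X) := congrArg (fun f : H2 →L[ℝ] ℝ => f X) h2.fderiv
  have h4 : ((X, fderiv ℝ Y m X, fderiv ℝ Z m X) : H2 × H2 × H2) =
      (X, 0, 0) + (0, fderiv ℝ Y m X, 0) + (0, 0, fderiv ℝ Z m X) := by simp
  rw [h3, h4, map_add, map_add]
  congr 1
  · congr 1
    · have h5 : HasDerivAt (fun t : ℝ => metric c (m + t • X) (Y m + t • 0) (Z m + t • 0)) _ 0 :=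
        h1.hasLineDerivAt (X, 0, 0)
      simp only [smul_zero, add_zero] at h5
      exact h5.deriv.symm
    · have h5 : HasDerivAt (fun t : ℝ => metric c (m + t • (0 : H2))
        (Y m + t • fderiv ℝ Y m X) (Z m + t • (0 : H2))) _ 0 :=
        h1.hasLineDerivAt (0, fderiv ℝ Y m X, 0)
      simp only [smul_zero, add_zero, metric_add_left, metric_smul_left] at h5
      refine h5.unique ?_
      simpa using ((hasDerivAt_id (0 : ℝ)).mul_const
        (metric c m (fderiv ℝ Y m X) (Z m))).const_add (metric c m (Y m) (Z m))
  · have h5 : HasDerivAt (fun t : ℝ => metric c (m + t • (0 : H2))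
        (Y m + t • (0 : H2)) (Z m + t • fderiv ℝ Z m X)) _ 0 :=
        h1.hasLineDerivAt (0, 0, fderiv ℝ Z m X)
    simp only [smul_zero, add_zero, metric_add_right, metric_smul_right] at h5
    refine h5.unique ?_
    simpa using ((hasDerivAt_id (0 : ℝ)).mul_const
      (metric c m (Y m) (fderiv ℝ Z m X))).const_add (metric c m (Y m) (Z m))

/-- In the flat ambient space brackets are differences of directional derivatives, and all of these
cancel except two copies of D_X Y. What remains depends on X and Z only through their values at m.
-/
theorem koszul_eq {c : ℝ} (hc : 0 < c) {X Y Z : H2 → H2} {m : H2}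
    (hX : DifferentiableAt ℝ X m) (hY : DifferentiableAt ℝ Y m) (hZ : DifferentiableAt ℝ Z m) :
    koszul c X Y Z m = metricDeriv c m (X m) (Y m) (Z m) + metricDeriv c m (Y m) (X m) (Z m) -
      metricDeriv c m (Z m) (X m) (Y m) + 2 * metric c m (fderiv ℝ Y m (X m)) (Z m) := by
  rw [koszul, fderiv_metric hc hY hZ, fderiv_metric hc hX hZ, fderiv_metric hc hX hY]
  simp only [VectorField.lieBracket, sub_eq_add_neg, metric_add_left, metric_neg_left]
  rw [metric_comm c m (Y m) (fderiv ℝ Z m (X m)), metric_comm c m (X m) (fderiv ℝ Z m (Y m)),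
    metric_comm c m (X m) (fderiv ℝ Y m (Z m))]
  ring

/-- The fixed point set of an involution in the group is totally geodesic. -/
theorem isTotallyGeodesic_of_fixed {c : ℝ} (hc : 0 < c) {g : G} (hg : ∀ X, act g (act g X) = X)
    {L : Set H2} (hL : L ⊆ fixedSet g)
    (hT : ∀ m ∈ L, ∀ X, X ∈ tangentTo L m ↔ X ∈ TM m ∧ act g X = X) :
    IsTotallyGeodesic c L := by
  intro X Y Z hX hY hZ hM hXY m hm hperp
  have hfix : act g m = m := (hL hm).2
  have hmM : m ∈ M := (hL hm).1
  have dX := hX.differentiable (by simp) m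
  have dY := hY.differentiable (by simp) m
  have dZ := hZ.differentiable (by simp) m
  have inv : ∀ A B : H2, metric c m (act g A) (act g B) = metric c m A B := fun A B => by
    have := metric_act c g m A B
    rwa [hfix] at this
  have sX := ((hT m hm _).1 (hXY m hm).1).2
  have sY := ((hT m hm _).1 (hXY m hm).2).2
  -- the normal vector is reversed by the involution
  have sZ : act g (Z m) = -Z m := by
    -- The sum of Z and its image is fixed by the involution, hence tangent. It is orthogonal to Z
    -- and, by invariance, to the image of Z, so it has length zero.
    have h1 : act g (Z m) + Z m ∈ tangentTo L m := by
      refine (hT m hm _).2 ⟨add_mem ?_ (hM m hmM).2.2, ?_⟩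
      · have := act_mem_TM g (hM m hmM).2.2
        rwa [hfix] at this
      · rw [map_add, hg, add_comm]
    have h2 := hperp _ h1
    have h3 : metric c m (act g (Z m)) (act g (Z m) + Z m) = 0 := by
      rw [← inv, hg, map_add, hg, add_comm (Z m), h2]
    have h4 := eq_zero_of_metric_self hc hmM (tangentTo_le_TM (fun n hn => (hL hn).1) m h1)
      (by rw [metric_add_left, h2, h3, add_zero])
    exact eq_neg_of_add_eq_zero_left h4
  -- Y takes fixed values along L, and so does its derivative in directions tangent to L.
  have hD : act g (fderiv ℝ Y m (X m)) = fderiv ℝ Y m (X m) := by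
    have : tangentTo L m ≤ LinearMap.eqLocus ((act g).comp (fderiv ℝ Y m : H2 →ₗ[ℝ] H2))
        (fderiv ℝ Y m : H2 →ₗ[ℝ] H2) := by
      refine Submodule.span_le.2 ?_
      rintro W ⟨γ, h1, h2, h3, rfl⟩
      have hd : HasDerivAt γ (deriv γ 0) 0 := (h1.differentiableAt (by simp)).hasDerivAt
      have h4 : HasDerivAt (fun t => Y (γ t)) (fderiv ℝ Y m (deriv γ 0)) 0 :=
        HasFDerivAt.comp_hasDerivAt 0 (by rw [h3]; exact dY.hasFDerivAt) hd
      have h5 : HasDerivAt (fun t => act g (Y (γ t))) (act g (fderiv ℝ Y m (deriv γ 0))) 0 :=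
        (LinearMap.toContinuousLinearMap (act g)).hasFDerivAt.comp_hasDerivAt 0 h4
      refine h5.unique (h4.congr_of_eventuallyEq ?_)
      filter_upwards [h2] with t ht using ((hT _ ht _).1 (hXY _ ht).2).2
    exact this (hXY m hm).1
  have anti : ∀ n A B : H2, act g n = n → act g A = A → act g B = -B → metric c n A B = 0 := by
    intro n A B hn hA hB
    have := metric_act c g n A B
    rw [hn, hA, hB, metric_neg_right] at this
    linarith
  have line : ∀ A : H2, act g A = A → ∀ t : ℝ, act g (m + t • A) = m + t • A := fun A hA t => by
    rw [map_add, map_smul, hfix, hA]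
  have h1 : metricDeriv c m (X m) (Y m) (Z m) = 0 := by
    rw [metricDeriv, funext fun t => anti _ _ _ (line _ sX t) sY sZ, deriv_const]
  have h2 : metricDeriv c m (Y m) (X m) (Z m) = 0 := by
    rw [metricDeriv, funext fun t => anti _ _ _ (line _ sY t) sX sZ, deriv_const]
  -- The involution reverses the line in direction Z and fixes X and Y, so the function being
  -- differentiated is even in t.
  have h3 : metricDeriv c m (Z m) (X m) (Y m) = 0 := by
    have even : ∀ t : ℝ, metric c (m + (-t) • Z m) (X m) (Y m) =
        metric c (m + t • Z m) (X m) (Y m) := fun t => by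
      have := metric_act c g (m + t • Z m) (X m) (Y m)
      rw [sX, sY, map_add, map_smul, hfix, sZ, smul_neg, ← neg_smul] at this
      exact this
    have := deriv_comp_neg (fun t : ℝ => metric c (m + t • Z m) (X m) (Y m)) 0
    simp only [even, neg_zero] at this
    rw [metricDeriv]
    linarith
  rw [koszul_eq hc dX dY dZ, h1, h2, h3, anti m _ _ hfix hD sZ]
  ring

/-! ### The zero section -/

/-- T² × {1} is central in the group. -/
theorem isT2Invariant_fixedSet (g : G) : IsT2Invariant (fixedSet g) := by
  intro l₁ l₂ m hm
  refine ⟨act_mem_M hm.1 _, ?_⟩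
  have : g * (l₁, l₂, 1) = (l₁, l₂, 1) * g := by
    ext1
    · exact mul_comm _ _
    · ext1
      · exact mul_comm _ _
      · simp
  rw [← act_mul, this, act_mul, hm.2]

/-- The element of the group which acts by `(x, a) ↦ (x, -a)`. -/
def fibreReflection : G := (1, ⟨-1, by simp [Submonoid.unitSphere]⟩, 1)

theorem act_fibreReflection (m : H2) : act fibreReflection m = (m.1, -m.2) := by
  ext1
  · rw [act_fst]; simp [fibreReflection]
  · rw [act_snd]
    have : ((-1 : ℂ) : ℍ[ℝ]) = -1 := by ext <;> simp
    simp [fibreReflection, this]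

theorem quaternion_neg_eq_self {q : ℍ[ℝ]} : -q = q ↔ q = 0 := by
  rw [neg_eq_iff_add_eq_zero, ← two_smul ℝ, smul_eq_zero]
  simp

theorem zeroSection_eq : zeroSection = fixedSet fibreReflection := by
  ext m
  refine and_congr_right fun _ => ?_
  rw [act_fibreReflection, Prod.ext_iff]
  simp [quaternion_neg_eq_self]

theorem mem_tangentTo_zeroSection {m : H2} (hm : m ∈ zeroSection) (X : H2) :
    X ∈ tangentTo zeroSection m ↔ X ∈ TM m ∧ act fibreReflection X = X := by
  rw [zeroSection_eq] at *
  exact tangentTo_fixedSet _ hm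

theorem isTotallyGeodesic_zeroSection {c : ℝ} (hc : 0 < c) : IsTotallyGeodesic c zeroSection :=
  isTotallyGeodesic_of_fixed hc (g := fibreReflection)
    (fun X => by simp [act_fibreReflection]) zeroSection_eq.subset
    fun _ hm X => mem_tangentTo_zeroSection hm X

theorem isT2Invariant_zeroSection : IsT2Invariant zeroSection := by
  rw [zeroSection_eq]; exact isT2Invariant_fixedSet _

theorem zeroSection_eq_orbit : ∃ m ∈ M, zeroSection = orbit m := by
  refine ⟨(1, 0), by simp [M], ?_⟩
  ext m
  constructor
  · rintro ⟨hm, h0⟩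
    refine ⟨(1, 1, ⟨star m.1, mem_unitary_of_norm (by rw [Quaternion.norm_star]; exact hm)⟩), ?_⟩
    ext1
    · rw [act_fst]; simp
    · rw [act_snd, h0]; simp
  · rintro ⟨g, rfl⟩
    exact ⟨act_mem_M (by simp [M]) g, by simp [act_snd]⟩

/-- The quaternion with given real coordinates. -/
def ofCoord4 (y : Fin 4 → ℝ) : ℍ[ℝ] := ⟨y 0, y 1, y 2, y 3⟩

@[fun_prop] theorem contDiff_ofCoord4 {n : ℕ∞ω} : ContDiff ℝ n ofCoord4 :=
  (LinearMap.toContinuousLinearMap (E := Fin 4 → ℝ) (F' := ℍ[ℝ])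
    { toFun := ofCoord4, map_add' := fun _ _ => rfl, map_smul' := fun _ _ => rfl }).contDiff

@[fun_prop] theorem contDiff_coord4 {n : ℕ∞ω} : ContDiff ℝ n coord4 := by
  refine contDiff_pi.2 fun l => ?_
  fin_cases l <;> simp [coord4] <;> fun_prop

theorem norm_toLp_coord4 (q : ℍ[ℝ]) : ‖WithLp.toLp 2 (coord4 q)‖ = ‖q‖ := by
  rw [← sq_eq_sq₀ (norm_nonneg _) (norm_nonneg _), EuclideanSpace.norm_sq_eq, normSq_expand,
    Fin.sum_univ_four]
  simp [coord4]

theorem diffeomorphic_zeroSection : Diffeomorphic zeroSection (unitSphere 3) := by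
  refine ⟨fun m => WithLp.toLp 2 (coord4 m.1), fun y => (ofCoord4 y, 0), ?_, ?_, ?_, ?_, ?_, ?_⟩
  · apply ContDiff.contDiffOn; fun_prop
  · apply ContDiff.contDiffOn; fun_prop
  · intro m hm
    exact mem_sphere_zero_iff_norm.2 ((norm_toLp_coord4 _).trans hm.1)
  · intro y hy
    refine ⟨?_, rfl⟩
    change ‖_‖ = 1
    rw [← norm_toLp_coord4, ← mem_sphere_zero_iff_norm.1 hy]
    congr 1
    ext l; fin_cases l <;> rfl
  · intro m hm
    exact Prod.ext rfl hm.2.symm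
  · intro y hy
    ext l; fin_cases l <;> rfl

theorem norm_imQ_sq (w : EuclideanSpace ℝ (Fin 3)) : ‖imQ w‖ ^ 2 = ‖w‖ ^ 2 := by
  rw [normSq_expand, EuclideanSpace.norm_sq_eq, Fin.sum_univ_three]
  simp

/-- Left translation moves the base point to 1, around which the unit quaternions of positive real
part form a graph over the unit ball of Im ℍ. -/
theorem isEmbeddedSubmanifold_zeroSection : IsEmbeddedSubmanifold 3 zeroSection := by
  rintro m ⟨hm, h0⟩
  have hdec : ∀ q : ℍ[ℝ], q = q.re • (1 : ℍ[ℝ]) + imQ (imCoord q) := fun q => by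
    ext <;> simp [imCoord]
  have hm1 : star m.1 * m.1 = 1 := star_mul_of_norm_one hm
  have hcancel : ∀ q : ℍ[ℝ], star m.1 * (m.1 * q) = q := fun q => by
    rw [← mul_assoc, hm1, one_mul]
  have hsq : ∀ w : EuclideanSpace ℝ (Fin 3), ‖w‖ < 1 → 0 < 1 - ‖w‖ ^ 2 := fun w hw => by
    have := norm_nonneg w
    nlinarith
  refine ⟨{n | 0 < (star m.1 * n.1).re}, Metric.ball 0 1, ?_, ?_, Metric.isOpen_ball,
    fun w => (m.1 * ((√(1 - ‖w‖ ^ 2)) • (1 : ℍ[ℝ]) + imQ w), 0),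
    fun n => WithLp.toLp 2 (imCoord (star m.1 * n.1)), ?_, ?_, ?_, ?_, ?_, ?_⟩
  · exact isOpen_lt continuous_const (Quaternion.continuous_re.comp
      (continuous_const.mul continuous_fst))
  · change 0 < (star m.1 * m.1).re
    rw [hm1]; simp
  · have h1 : ContDiffOn ℝ ∞ (fun w : EuclideanSpace ℝ (Fin 3) => √(1 - ‖w‖ ^ 2))
        (Metric.ball 0 1) :=
      (contDiff_const.sub (contDiff_id.norm_sq ℝ)).contDiffOn.sqrt fun w hw =>
        (hsq w (by simpa using hw)).ne'
    fun_prop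
  · apply ContDiff.contDiffOn
    refine contDiff_euclidean.2 fun l => (contDiff_imCoord l).comp ?_
    fun_prop
  · intro w hw
    have hw := hsq w (by simpa using hw)
    refine ⟨⟨?_, rfl⟩, ?_⟩
    · change ‖_‖ = 1
      rw [norm_mul, (show ‖m.1‖ = 1 from hm), one_mul, ← sq_eq_sq₀ (norm_nonneg _) zero_le_one,
        normSq_expand]
      have h1 := norm_imQ_sq w
      rw [normSq_expand] at h1
      have h2 := Real.sq_sqrt hw.le
      simp at h1 ⊢
      linarith
    · change 0 < (star m.1 * _).re
      rw [hcancel]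
      simpa using hw
  · rintro n ⟨⟨hn, -⟩, h⟩
    replace h : 0 < (star m.1 * n.1).re := h
    have h1 : ‖star m.1 * n.1‖ ^ 2 = 1 := by
      rw [norm_mul, Quaternion.norm_star, (show ‖m.1‖ = 1 from hm), (show ‖n.1‖ = 1 from hn)]
      norm_num
    rw [mem_ball_zero_iff, ← sq_lt_one_iff₀ (norm_nonneg _), ← norm_imQ_sq, normSq_expand]
    rw [normSq_expand] at h1
    beta_reduce
    generalize star m.1 * n.1 = q at *
    simp [imCoord]
    nlinarith
  · intro w hw
    simp only [hcancel]
    ext l; fin_cases l <;> simp [imCoord]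
  · rintro n ⟨⟨hn, hn0⟩, h⟩
    replace h : 0 < (star m.1 * n.1).re := h
    have h1 : ‖star m.1 * n.1‖ ^ 2 = 1 := by
      rw [norm_mul, Quaternion.norm_star, (show ‖m.1‖ = 1 from hm), (show ‖n.1‖ = 1 from hn)]
      norm_num
    refine Prod.ext ?_ hn0.symm
    have h2 : √(1 - ‖WithLp.toLp 2 (imCoord (star m.1 * n.1))‖ ^ 2) = (star m.1 * n.1).re := by
      rw [← norm_imQ_sq, normSq_expand, ← Real.sqrt_sq h.le]
      rw [normSq_expand] at h1
      congr 1
      simp [imCoord] at h1 ⊢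
      linarith
    simp only
    rw [h2]
    change m.1 * (_ • 1 + imQ (imCoord (star m.1 * n.1))) = n.1
    rw [← hdec, ← mul_assoc, mul_star_of_norm_one hm, one_mul]

/-- In the frame x e_l the form takes the value -3√3 c, and the Gram matrix is 3c^(2/3) times the
identity, with determinant 27c². -/
theorem isAssociative_zeroSection {c : ℝ} (hc : 0 < c) : IsAssociative c zeroSection := by
  refine ⟨fun m hm => hm.1, isEmbeddedSubmanifold_zeroSection, fun m hm => ?_⟩
  have hmM := hm.1
  have hb : ∀ i, ((m.1 * unit i, 0) : H2) ∈ TM m := fun i => by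
    have := inner_mul_left_mul_left m.1 1 (unit i)
    rw [mul_one] at this
    rw [mem_TM, this, inner_expand, unit_re]
    simp
  have hphi : phi c m (m.1 * unit 0, 0) (m.1 * unit 1, 0) (m.1 * unit 2, 0) = -(3 * √3 * c) := by
    have e : ∀ l n, eForm l m (m.1 * unit n, 0) = -⟪unit l, unit n⟫_ℝ := fun l n =>
      eForm_tangent hmM rfl l
    simp only [phi, Matrix.det_fin_three, e, alphaForm, dAlphaForm, inner_expand,
      Fin.sum_univ_three]
    simp
  refine isAssociativePlane_of_gram hc hmM (b := fun i => (m.1 * unit i, 0)) hb ?_ ?_ ?_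
  · have hg : ∀ i j, metric c m (m.1 * unit i, 0) (m.1 * unit j, 0) =
        3 * c ^ (2 / 3 : ℝ) * ⟪unit i, unit j⟫_ℝ := fun i j => by
      rw [metric_tangent hc hmM rfl rfl (unit_re i)]
      simp [hm.2, weight]
    have h3 : (c ^ (2 / 3 : ℝ)) ^ 3 = c ^ 2 := by
      rw [← Real.rpow_natCast, ← Real.rpow_mul hc.le]; norm_num
    have hs : √3 ^ 2 = (3 : ℝ) := Real.sq_sqrt (by norm_num)
    rw [hphi, gram, Matrix.det_fin_three]
    simp only [Matrix.of_apply, hg, inner_expand]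
    simp
    linear_combination 9 * c ^ 2 * hs - 27 * h3
  · rw [hphi]
    have : 0 < 3 * √3 * c := by positivity
    linarith
  · ext X
    rw [mem_tangentTo_zeroSection hm, act_fibreReflection, Submodule.mem_span_range_iff_exists_fun]
    constructor
    · rintro ⟨hX, h⟩
      have h2 : X.2 = 0 := by
        have := congrArg Prod.snd h
        exact quaternion_neg_eq_self.1 this
      obtain ⟨p, hp, hp0⟩ := exists_tangent hmM hX
      refine ⟨imCoord p, ?_⟩
      have hp1 : p = ∑ i, imCoord p i • unit i := by
        ext <;> simp [Fin.sum_univ_three, imCoord, hp0]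
      ext1
      · rw [hp]
        conv_rhs => rw [hp1, Finset.mul_sum]
        simp [Prod.fst_sum]
      · rw [h2]; simp [Prod.snd_sum]
    · rintro ⟨g, rfl⟩
      refine ⟨Submodule.sum_mem _ fun i _ => (TM m).smul_mem _ (hb i), ?_⟩
      ext1
      · rfl
      · simp [Prod.snd_sum]

/-! ### The singular stratum with one-dimensional stabilizers -/

/-- The complex number with the first two coordinates of a quaternion. -/
def toComplex (q : ℍ[ℝ]) : ℂ := ⟨q.re, q.imI⟩

@[fun_prop] theorem contDiff_toComplex {n : ℕ∞ω} : ContDiff ℝ n toComplex :=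
  (LinearMap.toContinuousLinearMap (E := ℍ[ℝ]) (F' := ℂ)
    { toFun := toComplex, map_add' := fun _ _ => rfl
      map_smul' := fun _ _ => by apply Complex.ext <;> simp [toComplex] }).contDiff

@[simp] theorem toComplex_coe (z : ℂ) : toComplex (z : ℍ[ℝ]) = z := rfl

theorem coe_toComplex_mul_star {x y v : ℍ[ℝ]} (hv : star v = -v)
    (hx : unit 0 * x = x * v) (hy : unit 0 * y = y * v) :
    (toComplex (x * star y) : ℍ[ℝ]) = x * star y := by
  obtain ⟨z, hz⟩ := exists_coeComplex_of_intertwine hv hx hy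
  rw [hz, toComplex_coe]

theorem norm_toComplex_mul_star {x y v : ℍ[ℝ]} (hv : star v = -v)
    (hx : unit 0 * x = x * v) (hy : unit 0 * y = y * v) :
    ‖toComplex (x * star y)‖ = ‖x‖ * ‖y‖ := by
  rw [← norm_coeComplex, coe_toComplex_mul_star hv hx hy, norm_mul, Quaternion.norm_star]

/-- An unnormalised section of the Hopf map: it intertwines `i` with `v`. -/
def preSection (p v : ℍ[ℝ]) : ℍ[ℝ] := p - unit 0 * p * v

/-- A local section of the Hopf map. -/
def hopfSection (p v : ℍ[ℝ]) : ℍ[ℝ] := ‖preSection p v‖⁻¹ • preSection p v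

theorem mul_self_eq_neg_one {v : ℍ[ℝ]} (h0 : v.re = 0) (h1 : ‖v‖ = 1) : v * v = -1 := by
  have h := star_mul_of_norm_one h1
  rw [star_eq_neg h0, neg_mul] at h
  rw [← h, neg_neg]

/-- Since i² = v² = -1, the map q ↦ -i q v is an involution whose fixed vectors are the solutions of
i q = q v; `preSection p v` is twice the projection of p onto them. -/
theorem preSection_intertwine (p : ℍ[ℝ]) {v : ℍ[ℝ]} (h0 : v.re = 0) (h1 : ‖v‖ = 1) :
    unit 0 * preSection p v = preSection p v * v := by
  have hu : ∀ q : ℍ[ℝ], unit 0 * (unit 0 * q) = -q := fun q => by ext <;> simp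
  rw [preSection, mul_sub, sub_mul, mul_assoc (unit 0), hu, mul_assoc (unit 0), mul_assoc p,
    mul_self_eq_neg_one h0 h1, mul_neg, mul_neg, mul_one]
  abel

theorem hopfSection_intertwine (p : ℍ[ℝ]) {v : ℍ[ℝ]} (h0 : v.re = 0) (h1 : ‖v‖ = 1) :
    unit 0 * hopfSection p v = hopfSection p v * v := by
  rw [hopfSection, mul_smul_comm, smul_mul_assoc, preSection_intertwine p h0 h1]

theorem norm_hopfSection {p v : ℍ[ℝ]} (h : preSection p v ≠ 0) : ‖hopfSection p v‖ = 1 := by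
  rw [hopfSection, norm_smul, norm_inv, norm_norm, inv_mul_cancel₀ (norm_ne_zero_iff.2 h)]

theorem hopf_eq_of_norm_one {x v : ℍ[ℝ]} (h : ‖x‖ = 1) (hx : unit 0 * x = x * v) :
    hopf x = v := by
  rw [hopf_eq_of_intertwine hx, h]; simp

theorem exists_preSection_ne_zero (v : ℍ[ℝ]) : ∃ p, preSection p v ≠ 0 := by
  by_contra! h
  -- The real part for p = 1 and the j-part for p = j are 1 ± v_i, and they cannot both vanish.
  have h1 := congrArg QuaternionAlgebra.imI (h 1)
  have h2 := congrArg QuaternionAlgebra.imJ (h (unit 1))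
  have h3 := congrArg QuaternionAlgebra.re (h 1)
  simp [preSection] at h1 h2 h3
  linarith

/-- A quaternion `ε` with `i ε = ± ε i`. -/
def twist (e : ℝ) : ℍ[ℝ] := ((1 + e) / 2) • (1 : ℍ[ℝ]) + ((1 - e) / 2) • unit 1

@[fun_prop] theorem contDiff_twist {n : ℕ∞ω} : ContDiff ℝ n twist := by
  unfold twist; fun_prop

theorem unit_mul_twist {e : ℝ} (he : e = 1 ∨ e = -1) :
    unit 0 * twist e = e • (twist e * unit 0) := by
  rcases he with rfl | rfl <;> ext <;> simp [twist]

theorem norm_twist {e : ℝ} (he : e = 1 ∨ e = -1) : ‖twist e‖ = 1 := by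
  rw [← sq_eq_sq₀ (norm_nonneg _) zero_le_one, normSq_expand]
  rcases he with rfl | rfl <;> simp [twist]

theorem twist_intertwine {e : ℝ} (he : e = 1 ∨ e = -1) {x v : ℍ[ℝ]} (hx : unit 0 * x = x * v) :
    unit 0 * (twist e * x) = (twist e * x) * (e • v) := by
  rw [← mul_assoc, unit_mul_twist he, smul_mul_assoc, mul_assoc, hx, mul_smul_comm, mul_assoc]

theorem coe_mul_intertwine (z : ℂ) {x v : ℍ[ℝ]} (hx : unit 0 * x = x * v) :
    unit 0 * ((z : ℍ[ℝ]) * x) = ((z : ℍ[ℝ]) * x) * v := by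
  rw [← mul_assoc, unit_mul_coeComplex, mul_assoc, hx, mul_assoc]

theorem mem_fixedSet_involution {e : ℝ} (he : e = 1 ∨ e = -1) {v : ℍ[ℝ]} (hv : ‖v‖ = 1) {m : H2} :
    m ∈ fixedSet (involution e he v hv) ↔
      m ∈ M ∧ unit 0 * m.1 = m.1 * v ∧ unit 0 * m.2 = m.2 * (e • v) := by
  refine and_congr_right fun _ => ?_
  rw [act_involution_eq_iff, mul_smul_comm]

theorem mem_tangentTo_fixedSet_involution {e : ℝ} (he : e = 1 ∨ e = -1) {v : ℍ[ℝ]} (hv : ‖v‖ = 1)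
    {m : H2} (hm : m ∈ fixedSet (involution e he v hv)) {X : H2} :
    X ∈ tangentTo (fixedSet (involution e he v hv)) m ↔
      X ∈ TM m ∧ unit 0 * X.1 = X.1 * v ∧ unit 0 * X.2 = X.2 * (e • v) := by
  rw [tangentTo_fixedSet _ hm, act_involution_eq_iff, mul_smul_comm]

theorem inner_coe_mul (z : ℂ) (y : ℍ[ℝ]) :
    ⟪(z : ℍ[ℝ]) * y, y⟫_ℝ = z.re * ‖y‖ ^ 2 ∧ ⟪(z : ℍ[ℝ]) * y, unit 0 * y⟫_ℝ = z.im * ‖y‖ ^ 2 := by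
  constructor
  · rw [inner_expand, normSq_expand]; simp; ring
  · rw [inner_expand, normSq_expand]; simp; ring

theorem coe_mul_eq (z : ℂ) (y : ℍ[ℝ]) : (z : ℍ[ℝ]) * y = z.re • y + z.im • (unit 0 * y) := by
  ext <;> simp <;> ring

theorem exists_coe_mul {x y v : ℍ[ℝ]} (hv : star v = -v) (hy1 : ‖y‖ = 1)
    (hx : unit 0 * x = x * v) (hy : unit 0 * y = y * v) :
    ∃ z : ℂ, x = (z : ℍ[ℝ]) * y ∧ ‖z‖ = ‖x‖ := by
  refine ⟨toComplex (x * star y), ?_, ?_⟩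
  · rw [coe_toComplex_mul_star hv hx hy, mul_assoc, star_mul_of_norm_one hy1, mul_one]
  · rw [norm_toComplex_mul_star hv hx hy, hy1, mul_one]

theorem star_smul_eq_neg {v : ℍ[ℝ]} (h : v.re = 0) (e : ℝ) : star (e • v) = -(e • v) :=
  star_eq_neg (by simp [h])

/-- The second component moves in a complex line with unit vector y = `twist e * x`, so (i x, 0),
(0, y), (0, i y) is a frame of the tangent space. Here φ = -4√3 e, and the Gram determinant is 48
everywhere: the off-diagonal entries cancel the term with r² in the first diagonal one. -/
theorem isAssociativePlane_singular {c : ℝ} (hc : 0 < c) {e : ℝ} (he : e = 1 ∨ e = -1) {v : ℍ[ℝ]}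
    (hv : ‖v‖ = 1) (hv0 : v.re = 0) {m : H2} (hm : m ∈ fixedSet (involution e he v hv)) :
    IsAssociativePlane c m (tangentTo (fixedSet (involution e he v hv)) m) := by
  have hmem := (mem_fixedSet_involution he hv).1 hm
  obtain ⟨hM, hx, ha⟩ := hmem
  obtain ⟨y, hy⟩ : ∃ y, y = twist e * m.1 := ⟨_, rfl⟩
  have hy1 : ‖y‖ = 1 := by rw [hy, norm_mul, norm_twist he, (show ‖m.1‖ = 1 from hM), one_mul]
  have hyi : unit 0 * y = y * (e • v) := by rw [hy]; exact twist_intertwine he hx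
  have hee : e * e = 1 := by rcases he with rfl | rfl <;> norm_num
  have hyv : y * v = e • (unit 0 * y) := by
    rw [hyi, mul_smul_comm, smul_smul, hee, one_smul]
  obtain ⟨z, hz, hzn⟩ := exists_coe_mul (star_smul_eq_neg hv0 e) hy1 ha hyi
  have hb0 : (unit 0 * m.1, 0) ∈ TM m := by
    rw [mem_TM, inner_expand]; simp; ring
  have hb : ∀ q, ((0, q) : H2) ∈ TM m := fun q => by simp [mem_TM]
  have hphi : phi c m (unit 0 * m.1, 0) (0, y) (0, unit 0 * y) = -(4 * √3 * e) := by
    have e0 : ∀ l, eForm l m (unit 0 * m.1, 0) = -⟪unit l, v⟫_ℝ := eForm_tangent hM hx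
    have e1 : ∀ l q, eForm l m (0, q) = 0 := fun l q => by simp [eForm]
    have e2 : ∀ l, alphaForm l m (unit 0 * m.1, 0) = 0 := fun l => by simp [alphaForm]
    have e3 : ∑ l, ⟪unit l, v⟫_ℝ * ⟪y, unit 0 * y * unit l⟫_ℝ = ⟪y, unit 0 * y * v⟫_ℝ := by
      simp [Fin.sum_univ_three, inner_expand, hv0]; ring
    have e4 : ⟪y, unit 0 * y * v⟫_ℝ = -e := by
      have hu : unit 0 * (unit 0 * y) = -y := by ext <;> simp
      rw [mul_assoc, hyv, mul_smul_comm, hu, inner_smul_right, inner_neg_right,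
        real_inner_self_eq_norm_sq, hy1]
      ring
    rw [e4, Fin.sum_univ_three] at e3
    simp only [phi, Matrix.det_fin_three, e0, e1, e2, dAlphaForm, Fin.sum_univ_three]
    simp
    linear_combination 4 * √3 * e3
  refine isAssociativePlane_of_gram hc hM (b := ![(unit 0 * m.1, 0), (0, y), (0, unit 0 * y)])
    ?_ ?_ ?_ ?_
  · intro i
    fin_cases i
    exacts [hb0, hb _, hb _]
  · have hR := weight_pos hc m
    have g : ∀ p q, metric c m (0, p) (0, q) = 4 * weight c m ^ (-(1 / 3) : ℝ) * ⟪p, q⟫_ℝ :=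
      fun p q => by
        rw [metric_tangent hc hM (p := 0) (q := 0) (by simp) (by simp) rfl]; simp
    have hav : m.2 * v = ((e * (Complex.I * z) : ℂ) : ℍ[ℝ]) * y := by
      rw [hz, mul_assoc, hyv, mul_smul_comm, ← mul_assoc, ← unit_mul_coeComplex]
      ext <;> simp <;> ring
    have g0 : ∀ q, metric c m (unit 0 * m.1, 0) (0, q) =
        -(2 * weight c m ^ (-(1 / 3) : ℝ) * ⟪m.2 * v, q⟫_ℝ) := fun q => by
      rw [metric_tangent hc hM hx (q := 0) (by simp) hv0]
      simp [inner_smul_left]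
      ring
    have g00 : metric c m (unit 0 * m.1, 0) (unit 0 * m.1, 0) = 3 * weight c m ^ (2 / 3 : ℝ) +
        weight c m ^ (-(1 / 3) : ℝ) * ‖z‖ ^ 2 := by
      rw [metric_tangent hc hM hx hx hv0]
      simp only [zero_sub, inner_neg_left, inner_neg_right, inner_smul_left, inner_smul_right,
        real_inner_self_eq_norm_sq, norm_mul, hv, hzn]
      simp
      ring
    have hyu : ⟪y, unit 0 * y⟫_ℝ = 0 := by rw [inner_expand]; simp; ring
    have hyy : ⟪y, y⟫_ℝ = 1 := by rw [real_inner_self_eq_norm_sq, hy1]; norm_num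
    have huu : ⟪unit 0 * y, unit 0 * y⟫_ℝ = 1 := by
      rw [real_inner_self_eq_norm_sq, norm_mul, norm_unit, hy1]; norm_num
    have hzz : ‖z‖ ^ 2 = z.re ^ 2 + z.im ^ 2 := by
      rw [Complex.sq_norm, Complex.normSq_apply]; ring
    have hw3 : weight c m ^ (2 / 3 : ℝ) * (weight c m ^ (-(1 / 3) : ℝ)) ^ 2 = 1 := by
      rw [← Real.rpow_natCast, ← Real.rpow_mul hR.le, ← Real.rpow_add hR]; norm_num
    have hs : √3 ^ 2 = (3 : ℝ) := Real.sq_sqrt (by norm_num)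
    have g01 : metric c m (unit 0 * m.1, 0) (0, y) =
        2 * weight c m ^ (-(1 / 3) : ℝ) * (e * z.im) := by
      rw [g0, hav, (inner_coe_mul _ y).1, hy1]; simp
    have g02 : metric c m (unit 0 * m.1, 0) (0, unit 0 * y) =
        -(2 * weight c m ^ (-(1 / 3) : ℝ) * (e * z.re)) := by
      rw [g0, hav, (inner_coe_mul _ y).2, hy1]; simp
    have g10 := (metric_comm c m (0, y) (unit 0 * m.1, 0)).trans g01
    have g20 := (metric_comm c m (0, unit 0 * y) (unit 0 * m.1, 0)).trans g02
    have g11 := g y y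
    have g12 := g y (unit 0 * y)
    have g21 := (metric_comm c m (0, unit 0 * y) (0, y)).trans g12
    have g22 := g (unit 0 * y) (unit 0 * y)
    rw [hyy] at g11
    rw [hyu] at g12 g21
    rw [huu] at g22
    rw [hzz] at g00
    change phi c m (unit 0 * m.1, 0) (0, y) (0, unit 0 * y) ^ 2 = _
    rw [hphi, Matrix.det_fin_three]
    change _ = metric c m (unit 0 * m.1, 0) (unit 0 * m.1, 0) * metric c m (0, y) (0, y) *
        metric c m (0, unit 0 * y) (0, unit 0 * y) -
      metric c m (unit 0 * m.1, 0) (unit 0 * m.1, 0) * metric c m (0, y) (0, unit 0 * y) *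
        metric c m (0, unit 0 * y) (0, y) -
      metric c m (unit 0 * m.1, 0) (0, y) * metric c m (0, y) (unit 0 * m.1, 0) *
        metric c m (0, unit 0 * y) (0, unit 0 * y) +
      metric c m (unit 0 * m.1, 0) (0, y) * metric c m (0, y) (0, unit 0 * y) *
        metric c m (0, unit 0 * y) (unit 0 * m.1, 0) +
      metric c m (unit 0 * m.1, 0) (0, unit 0 * y) * metric c m (0, y) (unit 0 * m.1, 0) *
        metric c m (0, unit 0 * y) (0, y) -
      metric c m (unit 0 * m.1, 0) (0, unit 0 * y) * metric c m (0, y) (0, y) *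
        metric c m (0, unit 0 * y) (unit 0 * m.1, 0)
    rw [g00, g01, g02, g10, g11, g12, g20, g21, g22]
    linear_combination 16 * e ^ 2 * hs - 48 * hw3 + (48 + 16 * (weight c m ^ (-(1 / 3) : ℝ)) ^ 3 *
      (z.re ^ 2 + z.im ^ 2)) * hee
  · change phi c m (unit 0 * m.1, 0) (0, y) (0, unit 0 * y) ≠ 0
    rw [hphi]
    have : e ≠ 0 := by rintro rfl; norm_num at hee
    exact neg_ne_zero.2 (mul_ne_zero (by positivity) this)
  · ext X
    rw [mem_tangentTo_fixedSet_involution he hv hm, Submodule.mem_span_range_iff_exists_fun]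
    constructor
    · rintro ⟨hX, h1, h2⟩
      obtain ⟨z1, hz1, -⟩ := exists_coe_mul (star_eq_neg hv0) hM h1 hx
      obtain ⟨z2, hz2, -⟩ := exists_coe_mul (star_smul_eq_neg hv0 e) hy1 h2 hyi
      have h3 : z1.re = 0 := by
        have := (inner_coe_mul z1 m.1).1
        rw [← hz1, real_inner_comm, mem_TM.1 hX, (show ‖m.1‖ = 1 from hM)] at this
        linarith
      refine ⟨![z1.im, z2.re, z2.im], ?_⟩
      rw [coe_mul_eq] at hz1 hz2
      ext1
      · simp [Fin.sum_univ_three, hz1, h3]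
      · simp [Fin.sum_univ_three, hz2]
    · rintro ⟨s, rfl⟩
      refine ⟨Submodule.sum_mem _ fun i _ => (TM m).smul_mem _ ?_, ?_, ?_⟩
      · fin_cases i
        exacts [hb0, hb _, hb _]
      · have e1 : (∑ i, s i • (![(unit 0 * m.1, 0), (0, y), (0, unit 0 * y)] : Fin 3 → H2) i).1 =
            s 0 • (unit 0 * m.1) := by simp [Fin.sum_univ_three]
        rw [e1, mul_smul_comm, smul_mul_assoc, mul_assoc, ← hx]
      · have e2 : (∑ i, s i • (![(unit 0 * m.1, 0), (0, y), (0, unit 0 * y)] : Fin 3 → H2) i).2 =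
            s 1 • y + s 2 • (unit 0 * y) := by simp [Fin.sum_univ_three]
        rw [e2, mul_add, add_mul, mul_smul_comm, mul_smul_comm, smul_mul_assoc, smul_mul_assoc,
          mul_assoc (unit 0), ← hyi]

@[fun_prop] theorem contDiff_preSection {n : ℕ∞ω} (p : ℍ[ℝ]) : ContDiff ℝ n (preSection p) := by
  unfold preSection; fun_prop

theorem contDiffAt_hopfSection {n : ℕ∞ω} {p v : ℍ[ℝ]} (h : preSection p v ≠ 0) :
    ContDiffAt ℝ n (hopfSection p) v :=
  (((contDiff_preSection p).contDiffAt.norm ℝ h).inv (norm_ne_zero_iff.2 h)).smul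
    (contDiff_preSection p).contDiffAt

/-- The projection of the stratum `S₁` to `{1, -1} × S²`. -/
def singularMap (m : H2) : ℝ × EuclideanSpace ℝ (Fin 3) :=
  (hopfInner m / ‖m.2‖ ^ 2, WithLp.toLp 2 (imCoord (hopf m.1)))

theorem imQ_singularMap (m : H2) : imQ (singularMap m).2 = hopf m.1 :=
  imQ_imCoord (hopf_re _)

theorem norm_imQ_eq {w : EuclideanSpace ℝ (Fin 3)} (hw : w ∈ unitSphere 2) : ‖imQ w‖ = 1 := by
  have h := norm_imQ_sq w
  rw [show ‖w‖ = 1 by simpa [unitSphere] using hw] at h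
  exact (sq_eq_sq₀ (norm_nonneg _) zero_le_one).1 h

theorem hopfInner_of_intertwine {m : H2} (hm : m ∈ M) {e : ℝ}
    (h : unit 0 * m.2 = m.2 * (e • hopf m.1)) : hopfInner m = e * ‖m.2‖ ^ 2 := by
  rw [hopfInner, hopf_eq_of_intertwine h, inner_smul_right, inner_smul_right,
    real_inner_self_eq_norm_sq, norm_hopf, (show ‖m.1‖ = 1 from hm)]
  ring

/-- Both components are eigenvectors: i x = x v and i a = e a v are exactly the fixed point
equations of the involution (i, e i, v). They determine `singularMap` as soon as a ≠ 0. -/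
theorem mem_singular_fibre {e : ℝ} (he : e = 1 ∨ e = -1) {w : EuclideanSpace ℝ (Fin 3)}
    (hw : ‖imQ w‖ = 1) {m : H2} : m ∈ stratum 1 ∩ singularMap ⁻¹' {(e, w)} ↔
      m ∈ fixedSet (involution e he (imQ w) hw) ∧ m.2 ≠ 0 := by
  rw [stratum_one_eq, mem_fixedSet_involution]
  constructor
  · rintro ⟨⟨hm, h0, hN⟩, hu⟩
    replace hu : singularMap m = (e, w) := hu
    have hv : hopf m.1 = imQ w := by rw [← imQ_singularMap, hu]
    have he' : hopfInner m / ‖m.2‖ ^ 2 = e := congrArg Prod.fst hu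
    obtain ⟨e', he1, h1⟩ := exists_sign_of_hopfCross_eq_zero hm hN
    rw [← mul_smul_comm] at h1
    rw [hopfInner_of_intertwine hm h1, mul_div_cancel_right₀ _ (by simpa using h0)] at he'
    exact ⟨⟨hm, by rw [← hv]; exact intertwine_hopf hm, by rw [← hv, ← he']; exact h1⟩, h0⟩
  · rintro ⟨⟨hm, hx, ha⟩, h0⟩
    have hv : hopf m.1 = imQ w := hopf_eq_of_norm_one hm hx
    rw [← hv] at ha
    refine ⟨⟨hm, h0, hopfCross_eq_zero_of_sign (e := e) (by rw [ha, mul_smul_comm])⟩, ?_⟩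
    refine Prod.ext ?_ ?_
    · change hopfInner m / ‖m.2‖ ^ 2 = e
      rw [hopfInner_of_intertwine hm ha, mul_div_cancel_right₀ _ (by simpa using h0)]
    · have := imQ_singularMap m
      rw [hv] at this
      exact (WithLp.ofLp_injective 2) (imQ_injective this)

theorem singularMap_mem {m : H2} (hm : m ∈ stratum 1) : singularMap m ∈ twoSpheres := by
  rw [stratum_one_eq] at hm
  obtain ⟨hm, h0, hN⟩ := hm
  obtain ⟨e, he, h1⟩ := exists_sign_of_hopfCross_eq_zero hm hN
  rw [← mul_smul_comm] at h1
  refine ⟨?_, ?_⟩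
  · change hopfInner m / ‖m.2‖ ^ 2 ∈ _
    rw [hopfInner_of_intertwine hm h1, mul_div_cancel_right₀ _ (by simpa using h0)]
    exact he
  · have := norm_imQ_sq (singularMap m).2
    rw [imQ_singularMap, norm_hopf, (show ‖m.1‖ = 1 from hm)] at this
    have h2 : ‖(singularMap m).2‖ = 1 := (sq_eq_sq₀ (norm_nonneg _) zero_le_one).1 (by simpa using this.symm)
    simpa [unitSphere] using h2

/-! ### Complex coordinates on the fixed sets of the involutions -/

section Chart

variable {e : ℝ} (he : e = 1 ∨ e = -1) {v : ℍ[ℝ]} (hv : ‖v‖ = 1) {x : ℍ[ℝ]}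

theorem toComplex_coe_mul_star (hx1 : ‖x‖ = 1) (z : ℂ) : toComplex ((z : ℍ[ℝ]) * x * star x) = z := by
  rw [mul_assoc, mul_star_of_norm_one hx1, mul_one, toComplex_coe]

theorem norm_twist_mul (he : e = 1 ∨ e = -1) (hx1 : ‖x‖ = 1) : ‖twist e * x‖ = 1 := by
  rw [norm_mul, norm_twist he, hx1, one_mul]

theorem coe_mem_fixedSet (hx1 : ‖x‖ = 1) (hx : unit 0 * x = x * v) {z₁ : ℂ} (h : ‖z₁‖ = 1) (z₂ : ℂ) :
    ((z₁ : ℍ[ℝ]) * x, (z₂ : ℍ[ℝ]) * (twist e * x)) ∈ fixedSet (involution e he v hv) := by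
  refine (mem_fixedSet_involution he hv).2 ⟨?_, coe_mul_intertwine z₁ hx,
    coe_mul_intertwine z₂ (twist_intertwine he hx)⟩
  change ‖_‖ = 1
  rw [norm_mul, norm_coeComplex, h, hx1, one_mul]

theorem coe_toComplex_fixedSet (hv0 : v.re = 0) (hx1 : ‖x‖ = 1) (hx : unit 0 * x = x * v) {m : H2}
    (hm : m ∈ fixedSet (involution e he v hv)) :
    (toComplex (m.1 * star x) : ℍ[ℝ]) * x = m.1 ∧ ‖toComplex (m.1 * star x)‖ = 1 ∧
    (toComplex (m.2 * star (twist e * x)) : ℍ[ℝ]) * (twist e * x) = m.2 ∧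
    ‖toComplex (m.2 * star (twist e * x))‖ = ‖m.2‖ := by
  obtain ⟨hM, h1, h2⟩ := (mem_fixedSet_involution he hv).1 hm
  have hy := twist_intertwine he hx
  have hy1 := norm_twist_mul he hx1
  have s := star_smul_eq_neg hv0 e
  refine ⟨?_, ?_, ?_, ?_⟩
  · rw [coe_toComplex_mul_star (star_eq_neg hv0) h1 hx, mul_assoc, star_mul_of_norm_one hx1, mul_one]
  · rw [norm_toComplex_mul_star (star_eq_neg hv0) h1 hx, hx1, (show ‖m.1‖ = 1 from hM), one_mul]
  · rw [coe_toComplex_mul_star s h2 hy, mul_assoc, star_mul_of_norm_one hy1, mul_one]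
  · rw [norm_toComplex_mul_star s h2 hy, hy1, mul_one]

end Chart

/-- Given one unit solution x of i x = x v, all solutions are complex multiples of it, and those of
the second equation are complex multiples of `twist e * x`. The unit length of the first component
leaves S¹ × ℂ. -/
theorem diffeomorphic_fixedSet_involution {e : ℝ} (he : e = 1 ∨ e = -1) {v : ℍ[ℝ]} (hv : ‖v‖ = 1)
    (hv0 : v.re = 0) : Diffeomorphic (fixedSet (involution e he v hv)) circlePlane := by
  obtain ⟨p, hp⟩ := exists_preSection_ne_zero v
  have hx1 := norm_hopfSection hp
  have hx := hopfSection_intertwine p hv0 hv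
  obtain ⟨x, hxd⟩ : ∃ x, x = hopfSection p v := ⟨_, rfl⟩
  rw [← hxd] at hx1 hx
  have key := fun {m} hm => coe_toComplex_fixedSet he hv hv0 hx1 hx (m := m) hm
  refine ⟨fun m => (toComplex (m.1 * star x), toComplex (m.2 * star (twist e * x))),
    fun z => ((z.1 : ℍ[ℝ]) * x, (z.2 : ℍ[ℝ]) * (twist e * x)), ?_, ?_, ?_, ?_, ?_, ?_⟩
  · apply ContDiff.contDiffOn; fun_prop
  · apply ContDiff.contDiffOn; fun_prop
  · exact fun m hm => (key hm).2.1
  · exact fun z hz => coe_mem_fixedSet he hv hx1 hx hz z.2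
  · exact fun m hm => Prod.ext (key hm).1 (key hm).2.2.1
  · exact fun z hz => Prod.ext (toComplex_coe_mul_star hx1 _)
      (toComplex_coe_mul_star (norm_twist_mul he hx1) _)

theorem contDiffOn_singularMap : ContDiffOn ℝ ∞ singularMap (stratum 1) := by
  rw [stratum_one_eq]
  rintro m ⟨-, h0, -⟩
  refine ContDiffAt.contDiffWithinAt (ContDiffAt.prodMk ?_ ?_)
  · exact contDiff_hopfInner.contDiffAt.div (contDiffAt_snd.norm_sq ℝ) (by simpa using h0)
  · exact contDiffAt_euclidean.2 fun i =>
      ((contDiff_imCoord i).comp (contDiff_hopf.comp contDiff_fst)).contDiffAt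

/-- Over the open set where `preSection p` does not vanish, x can be chosen smoothly in v, which
trivialises the family. Since a ≠ 0, its complex coordinate is recorded as a phase together with log
r. -/
theorem isSmoothFibreBundle_singularMap :
    IsSmoothFibreBundle singularMap (stratum 1) twoSpheres torusLine := by
  refine ⟨contDiffOn_singularMap, fun m hm => singularMap_mem hm, ?_⟩
  rintro ⟨e₀, w₀⟩ -
  obtain ⟨p, hp⟩ := exists_preSection_ne_zero (imQ w₀)
  have hm1 : ∀ m ∈ stratum 1 ∩ singularMap ⁻¹' {b | preSection p (imQ b.2) ≠ 0},
      ∃ (e : ℝ) (he : e = 1 ∨ e = -1) (v : ℍ[ℝ]) (hv : ‖v‖ = 1), v.re = 0 ∧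
        preSection p v ≠ 0 ∧ (singularMap m).1 = e ∧ imQ (singularMap m).2 = v ∧ m.2 ≠ 0 ∧
        m ∈ fixedSet (involution e he v hv) := by
    rintro m ⟨hm, hp⟩
    have h1 := singularMap_mem hm
    obtain ⟨h2, h3⟩ := (mem_singular_fibre h1.1 (norm_imQ_eq h1.2)).1 ⟨hm, rfl⟩
    exact ⟨_, h1.1, _, norm_imQ_eq h1.2, rfl, hp, rfl, rfl, h3, h2⟩
  refine ⟨{b | preSection p (imQ b.2) ≠ 0}, ?_, hp,
    fun m => (toComplex (m.1 * star (hopfSection p (imQ (singularMap m).2))),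
      ‖m.2‖⁻¹ • toComplex (m.2 *
        star (twist (singularMap m).1 * hopfSection p (imQ (singularMap m).2))),
      Real.log ‖m.2‖),
    fun b => ((b.2.1 : ℍ[ℝ]) * hopfSection p (imQ b.1.2),
      ((Real.exp b.2.2.2 • b.2.2.1 : ℂ) : ℍ[ℝ]) * (twist b.1.1 * hopfSection p (imQ b.1.2))),
    ?_, ?_, ?_, ?_, ?_, ?_⟩
  · refine isOpen_ne.preimage ?_
    exact ((contDiff_preSection (n := 0) p).comp (contDiff_imQ.comp (by fun_prop))).continuous
  · intro m hm
    obtain ⟨e, he, v, hv, hv0, hpv, h1, h2, h0, hfix⟩ := hm1 m hm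
    have hu : ContDiffWithinAt ℝ ∞ singularMap
        (stratum 1 ∩ singularMap ⁻¹' {b | preSection p (imQ b.2) ≠ 0}) m :=
      (contDiffOn_singularMap m hm.1).mono Set.inter_subset_left
    have hx : ContDiffWithinAt ℝ ∞ (fun m => hopfSection p (imQ (singularMap m).2))
        (stratum 1 ∩ singularMap ⁻¹' {b | preSection p (imQ b.2) ≠ 0}) m :=
      (contDiffAt_hopfSection (by rwa [h2])).comp_contDiffWithinAt m
        ((contDiff_imQ.comp (by fun_prop : ContDiff ℝ ∞
          fun b : ℝ × EuclideanSpace ℝ (Fin 3) => (b.2 : Fin 3 → ℝ))).comp_contDiffWithinAt hu)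
    have he : ContDiffWithinAt ℝ ∞ (fun m => twist (singularMap m).1)
        (stratum 1 ∩ singularMap ⁻¹' {b | preSection p (imQ b.2) ≠ 0}) m :=
      contDiff_twist.comp_contDiffWithinAt (contDiff_fst.comp_contDiffWithinAt hu)
    have hn : ContDiffWithinAt ℝ ∞ (fun m : H2 => ‖m.2‖)
        (stratum 1 ∩ singularMap ⁻¹' {b | preSection p (imQ b.2) ≠ 0}) m :=
      (contDiffAt_snd.norm ℝ h0).contDiffWithinAt
    have hn0 : ‖m.2‖ ≠ 0 := norm_ne_zero_iff.2 h0
    refine ContDiffWithinAt.prodMk ?_ (ContDiffWithinAt.prodMk ?_ (hn.log hn0))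
    · exact contDiff_toComplex.comp_contDiffWithinAt
        (contDiffWithinAt_fst.mul (contDiff_star_quaternion.comp_contDiffWithinAt hx))
    · exact (hn.inv hn0).smul (contDiff_toComplex.comp_contDiffWithinAt
        (contDiffWithinAt_snd.mul (contDiff_star_quaternion.comp_contDiffWithinAt (he.mul hx))))
  · rintro ⟨b, z⟩ ⟨⟨-, hb⟩, -⟩
    have hx : ContDiffAt ℝ ∞ (fun q : (ℝ × EuclideanSpace ℝ (Fin 3)) × ℂ × ℂ × ℝ =>
        hopfSection p (imQ q.1.2)) (b, z) :=
      ContDiffAt.comp (b, z) (g := hopfSection p) (contDiffAt_hopfSection hb)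
        (contDiff_imQ.comp (by fun_prop : ContDiff ℝ ∞
          fun b : (ℝ × EuclideanSpace ℝ (Fin 3)) × ℂ × ℂ × ℝ =>
            (b.1.2 : Fin 3 → ℝ))).contDiffAt
    refine ContDiffAt.contDiffWithinAt (ContDiffAt.prodMk (ContDiffAt.mul ?_ hx)
      (ContDiffAt.mul ?_ (ContDiffAt.mul ?_ hx)))
    all_goals apply ContDiff.contDiffAt; fun_prop
  · intro m hm
    obtain ⟨e, he, v, hv, hv0, hpv, h1, h2, h0, hfix⟩ := hm1 m hm
    obtain ⟨-, k2, -, k4⟩ := coe_toComplex_fixedSet he hv hv0 (norm_hopfSection hpv)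
      (hopfSection_intertwine p hv0 hv) hfix
    refine ⟨?_, ?_⟩
    · simp only [h2, k2]
    · simp only [h1, h2, norm_smul, k4, norm_inv, norm_norm]
      exact inv_mul_cancel₀ (norm_ne_zero_iff.2 h0)
  · rintro ⟨⟨e, w⟩, z₁, z₂, t⟩ ⟨⟨⟨he, hw⟩, hb⟩, hz₁, hz₂⟩
    simp only at hz₁ hz₂ hb he hw
    have h1 := norm_hopfSection hb
    have h2 := coe_mem_fixedSet he (norm_imQ_eq hw) h1
      (hopfSection_intertwine p rfl (norm_imQ_eq hw)) hz₁ (Real.exp t • z₂)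
    have h3 : ((Real.exp t • z₂ : ℂ) : ℍ[ℝ]) * (twist e * hopfSection p (imQ w)) ≠ 0 := by
      rw [← norm_ne_zero_iff, norm_mul, norm_coeComplex, norm_twist_mul he h1, norm_smul, hz₂]
      simp
    have h4 := (mem_singular_fibre he (norm_imQ_eq hw)).2 ⟨h2, h3⟩
    refine ⟨h4.1, ?_⟩
    change preSection p (imQ (singularMap _).2) ≠ 0
    rw [show singularMap _ = (e, w) from h4.2]
    exact hb
  · intro m hm
    obtain ⟨e, he, v, hv, hv0, hpv, h1, h2, h0, hfix⟩ := hm1 m hm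
    obtain ⟨k1, -, k3, -⟩ := coe_toComplex_fixedSet he hv hv0 (norm_hopfSection hpv)
      (hopfSection_intertwine p hv0 hv) hfix
    refine Prod.ext ?_ ?_
    · simp only [h2, k1]
    · simp only [h1, h2]
      rw [Real.exp_log (norm_pos_iff.2 h0), smul_smul,
        mul_inv_cancel₀ (norm_ne_zero_iff.2 h0), one_smul, k3]
  · rintro ⟨e, w⟩ ⟨⟨he, hw⟩, hb⟩ ⟨z₁, z₂, t⟩ ⟨hz₁, hz₂⟩
    simp only at hz₁ hz₂ hb he hw
    have h1 := norm_hopfSection hb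
    have h2 := coe_mem_fixedSet he (norm_imQ_eq hw) h1
      (hopfSection_intertwine p rfl (norm_imQ_eq hw)) hz₁ (Real.exp t • z₂)
    have h5 : ‖((Real.exp t • z₂ : ℂ) : ℍ[ℝ]) * (twist e * hopfSection p (imQ w))‖ = Real.exp t := by
      rw [norm_mul, norm_coeComplex, norm_twist_mul he h1, norm_smul, hz₂]
      simp
    have h3 : ((Real.exp t • z₂ : ℂ) : ℍ[ℝ]) * (twist e * hopfSection p (imQ w)) ≠ 0 := by
      rw [← norm_ne_zero_iff, h5]; positivity
    have h4 := ((mem_singular_fibre he (norm_imQ_eq hw)).2 ⟨h2, h3⟩).2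
    replace h4 : singularMap _ = (e, w) := h4
    refine ⟨h4, ?_⟩
    simp only [h4, h5, toComplex_coe_mul_star h1, toComplex_coe_mul_star (norm_twist_mul he h1),
      Real.log_exp, smul_smul]
    rw [inv_mul_cancel₀ (Real.exp_ne_zero t), one_smul]

theorem isOpen_snd_ne_zero : IsOpen {m : H2 | m.2 ≠ 0} := isOpen_ne.preimage continuous_snd

theorem isClosed_fixedSet (g : G) : IsClosed (fixedSet g) := by
  refine IsClosed.inter ?_ ?_
  · exact isClosed_eq (f := fun m : H2 => ‖m.1‖) (by fun_prop) continuous_const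
  · exact isClosed_eq (contDiff_act (n := 0) g).continuous continuous_id

/-- A fixed point (x, 0) of the zero section is the limit of the fixed points (x, t ε x) as t → 0,
with ε = `twist e`. -/
theorem closure_fixedSet_inter {e : ℝ} (he : e = 1 ∨ e = -1) {v : ℍ[ℝ]} (hv : ‖v‖ = 1) :
    closure (fixedSet (involution e he v hv) ∩ {m | m.2 ≠ 0}) = fixedSet (involution e he v hv) := by
  refine subset_antisymm ((isClosed_fixedSet _).closure_subset_iff.2 Set.inter_subset_left) ?_
  intro m hm
  by_cases h0 : m.2 = 0
  · obtain ⟨hM, h1, h2⟩ := (mem_fixedSet_involution he hv).1 hm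
    have hlim : Filter.Tendsto (fun t : ℝ => ((m.1, t • (twist e * m.1)) : H2)) (𝓝[≠] 0) (𝓝 m) := by
      have : Continuous fun t : ℝ => ((m.1, t • (twist e * m.1)) : H2) := by fun_prop
      have h := (this.tendsto 0).mono_left (nhdsWithin_le_nhds (s := {0}ᶜ))
      rwa [zero_smul, ← h0] at h
    refine mem_closure_of_tendsto hlim ?_
    filter_upwards [self_mem_nhdsWithin] with t ht
    refine ⟨(mem_fixedSet_involution he hv).2 ⟨hM, h1, ?_⟩, ?_⟩
    · simp only [mul_smul_comm, smul_mul_assoc]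
      rw [twist_intertwine he h1, mul_smul_comm, smul_comm]
    · have h3 := norm_twist_mul he (show ‖m.1‖ = 1 from hM)
      refine smul_ne_zero ht ?_
      rw [← norm_ne_zero_iff, h3]
      exact one_ne_zero
  · exact subset_closure ⟨hm, h0⟩

theorem singular_fibre_properties {c : ℝ} (hc : 0 < c) {y : ℝ × EuclideanSpace ℝ (Fin 3)}
    (hy : y ∈ twoSpheres) {L : Set H2} (hL : L = stratum 1 ∩ singularMap ⁻¹' {y}) :
    IsT2Invariant L ∧ IsAssociative c L ∧ IsTotallyGeodesic c L ∧ Diffeomorphic L torusLine ∧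
      IsAssociative c (closure L) ∧ Diffeomorphic (closure L) circlePlane := by
  have hd : Diffeomorphic L torusLine := by
    rw [hL]; exact isSmoothFibreBundle_singularMap.diffeomorphic hy
  obtain ⟨e, w⟩ := y
  obtain ⟨he, hw⟩ := hy
  simp only at he hw
  have hv := norm_imQ_eq hw
  obtain ⟨g, hg⟩ : ∃ g, g = involution e he (imQ w) hv := ⟨_, rfl⟩
  have hLg : L = fixedSet g ∩ {m | m.2 ≠ 0} := by
    rw [hL, hg]; ext m; exact mem_singular_fibre he hv
  have hcl : closure L = fixedSet g := by rw [hLg, hg]; exact closure_fixedSet_inter he hv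
  have hT : ∀ m ∈ L, tangentTo L m = tangentTo (fixedSet g) m := fun m hm => by
    rw [hLg] at hm ⊢
    exact tangentTo_inter_isOpen isOpen_snd_ne_zero hm.2
  have hsub : L ⊆ fixedSet g := by rw [hLg]; exact Set.inter_subset_left
  have hd' : Diffeomorphic (fixedSet g) circlePlane := by
    rw [hg]; exact diffeomorphic_fixedSet_involution he hv rfl
  have hass : ∀ m ∈ fixedSet g, IsAssociativePlane c m (tangentTo (fixedSet g) m) := by
    rw [hg]; exact fun m hm => isAssociativePlane_singular hc he hv rfl hm
  refine ⟨?_, ⟨fun m hm => (hsub hm).1, isEmbeddedSubmanifold_torusLine.of_diffeomorphic hd,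
    fun m hm => by rw [hT m hm]; exact hass m (hsub hm)⟩, ?_, hd, ?_, ?_⟩
  · rw [hLg]
    rintro l₁ l₂ m ⟨hm, h0⟩
    refine ⟨isT2Invariant_fixedSet g l₁ l₂ m hm, ?_⟩
    change (act _ m).2 ≠ 0
    rw [← norm_ne_zero_iff, norm_act_snd]
    exact norm_ne_zero_iff.2 h0
  · refine isTotallyGeodesic_of_fixed hc (g := g) ?_ hsub fun m hm X => ?_
    · rw [hg]; exact act_involution_involution he hv rfl
    · rw [hT m hm, tangentTo_fixedSet g (hsub hm)]
  · rw [hcl]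
    exact ⟨fun m hm => hm.1, isEmbeddedSubmanifold_circlePlane.of_diffeomorphic hd', hass⟩
  · rw [hcl]; exact hd'

/-! ### The connection induced by the metric -/

theorem inner_hopfCross_left (m : H2) : ⟪hopfCross m, hopf m.1⟫_ℝ = 0 := by
  rw [inner_expand, hopfCross_imI, hopfCross_imJ, hopfCross_imK]; simp; ring

theorem inner_hopfCross_right (m : H2) : ⟪hopfCross m, hopf m.2⟫_ℝ = 0 := by
  rw [inner_expand, hopfCross_imI, hopfCross_imJ, hopfCross_imK]; simp; ring

/-- Expansion of an imaginary quaternion in the basis v, r²w, n. Up to the factor |n|², the dual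
basis is r²w × n, n × v, n. -/
theorem inner_hopf_mul_cross (m : H2) (q : ℍ[ℝ]) (hq : q.re = 0) :
    ‖hopfCross m‖ ^ 2 • q = ⟪hopf m.2 * hopfCross m, q⟫_ℝ • hopf m.1 +
      ⟪hopfCross m * hopf m.1, q⟫_ℝ • hopf m.2 + ⟪hopfCross m, q⟫_ℝ • hopfCross m := by
  rw [normSq_expand, inner_expand, inner_expand, inner_expand]
  ext <;> simp [hopfCross_imI, hopfCross_imJ, hopfCross_imK, hq] <;> ring

theorem inner_cross_products (m : H2) :
    ⟪hopf m.2 * hopfCross m, hopf m.1⟫_ℝ = ‖hopfCross m‖ ^ 2 ∧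
    ⟪hopf m.2 * hopfCross m, hopfCross m⟫_ℝ = 0 ∧
    ⟪hopfCross m * hopf m.1, hopf m.2⟫_ℝ = ‖hopfCross m‖ ^ 2 ∧
    ⟪hopfCross m * hopf m.1, hopfCross m⟫_ℝ = 0 ∧ ⟪hopfCross m * hopf m.1, 1⟫_ℝ = 0 := by
  refine ⟨?_, ?_, ?_, ?_, ?_⟩ <;> (try rw [normSq_expand]) <;> rw [inner_expand] <;>
    simp [hopfCross_imI, hopfCross_imJ, hopfCross_imK] <;> ring

/-- A vector field orthogonal to the orbits and to the radial direction. -/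
def angularField (c : ℝ) (m : H2) : H2 :=
  (‖m.2‖ ^ 2 • (m.1 * hopfCross m), -(‖m.2‖ ^ 2 + 3 * c / 2) • (m.2 * hopfCross m))

/-- The radial vector field of the fibres. -/
def radialField (m : H2) : H2 := (0, m.2)

theorem U₂_snd (m : H2) : ‖m.2‖ ^ 2 • (U₂ m).2 = m.2 * hopf m.2 := (mul_hopf m.2).symm

theorem inner_unit_mul (a : ℍ[ℝ]) : ⟪a, unit 0 * a⟫_ℝ = 0 := by
  rw [inner_expand]; simp; ring

theorem inner_mul_imaginary (a : ℍ[ℝ]) {q : ℍ[ℝ]} (hq : q.re = 0) : ⟪a, a * q⟫_ℝ = 0 := by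
  have := inner_mul_left_mul_left a 1 q
  rw [mul_one] at this
  rw [this, inner_expand]
  simp [hq]

/-! ### Tangent spaces of the orbits -/

theorem mul_mem_TM (m : H2) {q : ℍ[ℝ]} (hq : q.re = 0) (Y : ℍ[ℝ]) :
    ((m.1 * q, Y) : H2) ∈ TM m := inner_mul_imaginary m.1 hq

theorem U₁_mem_TM (m : H2) : U₁ m ∈ TM m := inner_unit_mul m.1

theorem U₂_mem_TM (m : H2) : U₂ m ∈ TM m := by simp [mem_TM, U₂]

theorem V_mem_TM (m : H2) (l : Fin 3) : V l m ∈ TM m := by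
  rw [mem_TM, V, inner_smul_right, inner_mul_imaginary _ (unit_re l), mul_zero]

theorem torusTangent_le_orbitTangent (m : H2) : torusTangent m ≤ orbitTangent m :=
  Submodule.span_mono Set.subset_union_left

theorem orbitTangent_le_TM (m : H2) : orbitTangent m ≤ TM m := by
  refine Submodule.span_le.2 ?_
  rintro X ((rfl | rfl) | ⟨l, rfl⟩)
  exacts [U₁_mem_TM m, U₂_mem_TM m, V_mem_TM m l]

theorem angularField_mem_TM (c : ℝ) (m : H2) : angularField c m ∈ TM m := by
  rw [angularField, ← mul_smul_comm]
  exact mul_mem_TM m (by simp) _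

theorem radialField_mem_TM (m : H2) : radialField m ∈ TM m := by simp [mem_TM, radialField]

theorem mul_mem_orbitTangent (m : H2) {q : ℍ[ℝ]} (hq : q.re = 0) :
    ((m.1 * q, m.2 * q) : H2) ∈ orbitTangent m := by
  have h : ((m.1 * q, m.2 * q) : H2) = ∑ l, (2 * imCoord q l) • V l m := by
    have hq' : q = ∑ l, imCoord q l • unit l := by
      ext <;> simp [Fin.sum_univ_three, imCoord, hq]
    have e : ∀ p : ℍ[ℝ], p * q = ∑ l, (2 * imCoord q l) • ((1 / 2 : ℝ) • (p * unit l)) := fun p => by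
      conv_lhs => rw [hq']
      rw [Finset.mul_sum]
      refine Finset.sum_congr rfl fun l _ => ?_
      rw [smul_smul, mul_smul_comm]
      congr 1; ring
    ext1
    · rw [Prod.fst_sum]; exact e m.1
    · rw [Prod.snd_sum]; exact e m.2
  rw [h]
  exact Submodule.sum_mem _ fun l _ => Submodule.smul_mem _ _
    (Submodule.subset_span (Or.inr ⟨l, rfl⟩))

/-- The quaternion z stands for r² a⁻¹ X.2. The coefficient r² + 3c/2 in `angularField` makes its
vertical part -(3/2)(c + r²) a n, so both contributions acquire the same power of c + r².
Orthogonality to the SU(2)-directions, where z = r²q, becomes visible. -/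
theorem metric_angularField {c : ℝ} (hc : 0 < c) {m : H2} (hm : m ∈ M) {X : H2} {q z : ℍ[ℝ]}
    (hX : X.1 = m.1 * q) (hX2 : ‖m.2‖ ^ 2 • X.2 = m.2 * z) :
    metric c m (angularField c m) X = 6 * weight c m ^ (2 / 3 : ℝ) *
      (‖m.2‖ ^ 2 * ⟪hopfCross m, q⟫_ℝ - ⟪hopfCross m, z⟫_ℝ) := by
  have hw := weight_pos hc m
  have h23 : weight c m ^ (2 / 3 : ℝ) = weight c m * weight c m ^ (-(1 / 3) : ℝ) := by
    rw [← Real.rpow_one_add' hw.le] <;> norm_num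
  rcases eq_or_ne m.2 0 with h0 | h0
  · have : hopfCross m = 0 := by by_contra h; exact snd_ne_zero h h0
    have h1 : angularField c m = 0 := by simp [angularField, this]
    rw [h1, metric_zero_left, this]; simp
  have hr : ‖m.2‖ ^ 2 ≠ 0 := by simpa using h0
  rw [metric_tangent hc hm (p := ‖m.2‖ ^ 2 • hopfCross m) (q := q)
    (by simp [angularField]) hX (by simp)]
  have e1 : (angularField c m).2 - (1 / 2 : ℝ) • (m.2 * ‖m.2‖ ^ 2 • hopfCross m) =
      (-(3 / 2) * weight c m) • (m.2 * hopfCross m) := by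
    simp only [angularField, mul_smul_comm, smul_smul, ← sub_smul, weight]
    congr 1; ring
  have e2 : ⟪m.2 * hopfCross m, X.2⟫_ℝ = ⟪hopfCross m, z⟫_ℝ := by
    refine mul_left_cancel₀ hr ?_
    rw [← inner_smul_right, hX2, inner_mul_left_mul_left]
  rw [e1, inner_smul_left, inner_smul_left, inner_sub_right, inner_smul_right, e2,
    inner_mul_left_mul_left, h23]
  simp
  ring

theorem metric_radialField {c : ℝ} (hc : 0 < c) {m : H2} (hm : m ∈ M) {X : H2} (hX : X ∈ TM m) :
    metric c m (radialField m) X = 4 * weight c m ^ (-(1 / 3) : ℝ) * ⟪m.2, X.2⟫_ℝ := by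
  obtain ⟨q, hq, hq0⟩ := exists_tangent hm hX
  rw [metric_tangent hc hm (p := 0) (by simp [radialField]) hq (by simp)]
  simp [radialField, inner_sub_right, inner_smul_right, inner_mul_imaginary _ hq0]

theorem snd_scaled (m X : H2) : ‖m.2‖ ^ 2 • X.2 = m.2 * (star m.2 * X.2) := by
  rw [← mul_assoc, self_mul_star_eq, Quaternion.coe_mul_eq_smul]

theorem metric_angularField_orbit {c : ℝ} (hc : 0 < c) {m : H2} (hm : m ∈ M) {Y : H2}
    (hY : Y ∈ orbitTangent m) : metric c m (angularField c m) Y = 0 := by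
  induction hY using Submodule.span_induction with
  | mem Y hY =>
    rcases hY with (rfl | rfl) | ⟨l, rfl⟩
    · rw [metric_angularField hc hm (U₁_fst hm) (z := 0) (by simp [U₁]), inner_hopfCross_left]; simp
    · rw [metric_angularField hc hm (q := 0) (by simp [U₂]) (U₂_snd m), inner_hopfCross_right]; simp
    · rw [metric_angularField hc hm (q := (1 / 2 : ℝ) • unit l) (z := ‖m.2‖ ^ 2 • (1 / 2 : ℝ) • unit l)
        (by simp [V]) (by simp [V]), inner_smul_right _ _ (‖m.2‖ ^ 2)]
      ring
  | zero => rw [metric_comm, metric_zero_left]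
  | add X Y _ _ hX hY => rw [metric_comm, metric_add_left, metric_comm, hX, metric_comm, hY, add_zero]
  | smul a X _ hX => rw [metric_comm, metric_smul_left, metric_comm, hX, mul_zero]

theorem metric_radialField_orbit {c : ℝ} (hc : 0 < c) {m : H2} (hm : m ∈ M) {Y : H2}
    (hY : Y ∈ orbitTangent m) : metric c m (radialField m) Y = 0 := by
  have h : orbitTangent m ≤ LinearMap.ker
      ((innerₛₗ ℝ m.2).comp (LinearMap.snd ℝ ℍ[ℝ] ℍ[ℝ])) := by
    refine Submodule.span_le.2 ?_
    rintro X ((rfl | rfl) | ⟨l, rfl⟩)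
    · simp [U₁]
    · exact inner_unit_mul m.2
    · change ⟪m.2, (V l m).2⟫_ℝ = 0
      rw [V, inner_smul_right, inner_mul_imaginary _ (unit_re l), mul_zero]
  rw [metric_radialField hc hm (orbitTangent_le_TM m hY), show ⟪m.2, Y.2⟫_ℝ = 0 from h hY, mul_zero]

/-- Write X = (x p, ·) and z = ā X.2. Orthogonality to the SU(2)-directions determines Im z from p;
orthogonality to U₁ and U₂ then makes p orthogonal to v and w, so p is a multiple of n. The two free
parameters are this multiple and Re z, which is the radial part. -/
theorem orthogonal_eq_span {c : ℝ} (hc : 0 < c) {m : H2} (hm : m ∈ principalSet) {X : H2} :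
    (X ∈ TM m ∧ ∀ Y ∈ orbitTangent m, metric c m X Y = 0) ↔
      X ∈ Submodule.span ℝ {angularField c m, radialField m} := by
  obtain ⟨hM, hN⟩ := mem_principalSet.1 hm
  rw [Submodule.mem_span_pair]
  constructor
  · rintro ⟨hX, hperp⟩
    obtain ⟨p, hp, hp0⟩ := exists_tangent hM hX
    obtain ⟨z, hz⟩ : ∃ z, z = star m.2 * X.2 := ⟨_, rfl⟩
    have hXz := snd_scaled m X
    rw [← hz] at hXz
    have hw := weight_pos hc m
    have h23 : weight c m ^ (2 / 3 : ℝ) = weight c m * weight c m ^ (-(1 / 3) : ℝ) := by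
      rw [← Real.rpow_one_add' hw.le] <;> norm_num
    have hw13 : weight c m ^ (-(1 / 3) : ℝ) ≠ 0 := by positivity
    have ha : m.2 ≠ 0 := snd_ne_zero hN
    have hr : ‖m.2‖ ^ 2 ≠ 0 := by simpa using ha
    have hmul : ∀ q : ℍ[ℝ], ⟪X.2, m.2 * q⟫_ℝ = ⟪z, q⟫_ℝ := fun q => by
      refine mul_left_cancel₀ hr ?_
      rw [← inner_mul_left_mul_left m.2 z, ← hXz, inner_smul_left]; simp
    have hmet : ∀ (Y : H2) (q s : ℍ[ℝ]), Y ∈ orbitTangent m → Y.1 = m.1 * q → Y.2 = m.2 * s →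
        3 * weight c m * ⟪p, q⟫_ℝ + 4 * (⟪z, s - (1 / 2 : ℝ) • q⟫_ℝ -
          1 / 2 * ‖m.2‖ ^ 2 * ⟪p, s - (1 / 2 : ℝ) • q⟫_ℝ) = 0 := fun Y q s hY hq hs => by
      have h := hperp Y hY
      rw [metric_tangent hc hM hp hq hp0, hs, ← mul_smul_comm, ← mul_smul_comm, ← mul_sub,
        inner_sub_left, hmul, inner_mul_left_mul_left, inner_smul_left, h23] at h
      simp only [conj_trivial] at h
      refine (mul_eq_zero.1 (?_ : weight c m ^ (-(1 / 3) : ℝ) * _ = 0)).resolve_left hw13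
      rw [← h]; ring
    have hu2 : (U₂ m).2 = m.2 * ((‖m.2‖ ^ 2)⁻¹ • hopf m.2) := by
      rw [mul_smul_comm, ← U₂_snd, smul_smul, inv_mul_cancel₀ hr, one_smul]
    have hV : ∀ q : ℍ[ℝ], q.re = 0 → ⟪z, q⟫_ℝ = -(‖m.2‖ ^ 2 + 3 * c / 2) * ⟪p, q⟫_ℝ := fun q hq => by
      have := hmet _ q q (mul_mem_orbitTangent m hq) rfl rfl
      rw [show q - (1 / 2 : ℝ) • q = (1 / 2 : ℝ) • q by module, inner_smul_right,
        inner_smul_right, weight] at this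
      linear_combination (1 / 2) * this
    have h1 : ⟪p, hopf m.1⟫_ℝ = 0 := by
      have := hmet _ (hopf m.1) 0 (Submodule.subset_span (Or.inl (Or.inl rfl))) (U₁_fst hM) (by simp [U₁])
      rw [zero_sub, inner_neg_right, inner_neg_right, inner_smul_right, inner_smul_right,
        hV _ (hopf_re _), weight] at this
      have h6 : 6 * (c + ‖m.2‖ ^ 2) * ⟪p, hopf m.1⟫_ℝ = 0 := by linear_combination this
      exact (mul_eq_zero.1 h6).resolve_left (by positivity)
    have h2 : ⟪p, hopf m.2⟫_ℝ = 0 := by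
      have := hmet _ 0 _ (Submodule.subset_span (Or.inl (Or.inr rfl))) (by simp [U₂]) hu2
      rw [smul_zero, sub_zero, inner_smul_right, inner_smul_right, hV _ (hopf_re _)] at this
      simp only [inner_zero_right] at this
      have h6 : 6 * (c + ‖m.2‖ ^ 2) * ⟪p, hopf m.2⟫_ℝ = 0 := by
        field_simp at this
        linear_combination -(1 / 2) * this
      exact (mul_eq_zero.1 h6).resolve_left (by positivity)
    have hn : ‖hopfCross m‖ ^ 2 ≠ 0 := by simpa using hN
    have h3 : ‖hopfCross m‖ ^ 2 • p = ⟪hopfCross m, p⟫_ℝ • hopfCross m := by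
      rw [inner_hopf_mul_cross m p hp0]
      have e1 : ⟪hopf m.2 * hopfCross m, p⟫_ℝ = 0 := by
        have h1' : hopfInner m * ⟪hopf m.1, p⟫_ℝ = 0 := by rw [real_inner_comm, h1, mul_zero]
        rw [inner_expand] at h1 h2 ⊢
        simp [hopfCross_imI, hopfCross_imJ, hopfCross_imK, hp0] at h1 h2 ⊢
        linear_combination ((hopf m.2).imI ^ 2 + (hopf m.2).imJ ^ 2 + (hopf m.2).imK ^ 2) * h1 -
          ((hopf m.1).imI * (hopf m.2).imI + (hopf m.1).imJ * (hopf m.2).imJ +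
            (hopf m.1).imK * (hopf m.2).imK) * h2
      have e2 : ⟪hopfCross m * hopf m.1, p⟫_ℝ = 0 := by
        rw [inner_expand] at h1 h2 ⊢
        simp [hopfCross_imI, hopfCross_imJ, hopfCross_imK, hp0] at h1 h2 ⊢
        linear_combination ((hopf m.1).imI ^ 2 + (hopf m.1).imJ ^ 2 + (hopf m.1).imK ^ 2) * h2 -
          ((hopf m.1).imI * (hopf m.2).imI + (hopf m.1).imJ * (hopf m.2).imJ +
            (hopf m.1).imK * (hopf m.2).imK) * h1
      rw [e1, e2]; simp
    have h4 : z = z.re • 1 + (-(‖m.2‖ ^ 2 + 3 * c / 2)) • p := by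
      have i0 := hV (unit 0) rfl
      have i1 := hV (unit 1) rfl
      have i2 := hV (unit 2) rfl
      simp [inner_expand] at i0 i1 i2
      ext <;> simp [hp0, i0, i1, i2]
    refine ⟨⟪hopfCross m, p⟫_ℝ / (‖m.2‖ ^ 2 * ‖hopfCross m‖ ^ 2), z.re / ‖m.2‖ ^ 2, ?_⟩
    have h3' : p = (⟪hopfCross m, p⟫_ℝ / ‖hopfCross m‖ ^ 2) • hopfCross m := by
      rw [div_eq_inv_mul, mul_smul, ← h3, smul_smul, inv_mul_cancel₀ hn, one_smul]
    obtain ⟨k, hk⟩ : ∃ k, k = ⟪hopfCross m, p⟫_ℝ / ‖hopfCross m‖ ^ 2 := ⟨_, rfl⟩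
    have hk' : ⟪hopfCross m, p⟫_ℝ / (‖m.2‖ ^ 2 * ‖hopfCross m‖ ^ 2) = k / ‖m.2‖ ^ 2 := by
      rw [hk, div_div, mul_comm (‖m.2‖ ^ 2)]
    rw [← hk] at h3'
    rw [hk']
    ext1
    · simp only [Prod.fst_add, Prod.smul_fst, angularField, radialField, smul_zero, add_zero]
      rw [hp, smul_smul, div_mul_cancel₀ _ hr, h3', mul_smul_comm]
    · simp only [Prod.snd_add, Prod.smul_snd, angularField, radialField]
      rw [h3'] at h4
      refine smul_right_injective _ hr ?_
      simp only
      rw [hXz]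
      conv_rhs => rw [h4]
      simp only [mul_add, mul_smul_comm, smul_add, smul_smul, mul_one]
      rw [add_comm]
      congr 2 <;> field_simp
  · rintro ⟨s, t, rfl⟩
    refine ⟨(TM m).add_mem ((TM m).smul_mem _ (angularField_mem_TM c m))
      ((TM m).smul_mem _ (radialField_mem_TM m)), fun Y hY => ?_⟩
    rw [metric_add_left, metric_smul_left, metric_smul_left, metric_angularField_orbit hc hM hY,
      metric_radialField_orbit hc hM hY]
    ring

theorem metricConnection_eq {c : ℝ} (hc : 0 < c) {m : H2} (hm : m ∈ principalSet) :
    metricConnection c m =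
      torusTangent m ⊔ Submodule.span ℝ {angularField c m, radialField m} := by
  rw [metricConnection, show {X | X ∈ TM m ∧ ∀ Y ∈ orbitTangent m, metric c m X Y = 0} =
    (Submodule.span ℝ {angularField c m, radialField m} : Set H2) from
      Set.ext fun X => orthogonal_eq_span hc hm, Submodule.span_eq]

/-- A smooth family of endomorphisms with range the metric connection. -/
def connectionMap (c : ℝ) (m : H2) : H2 →L[ℝ] H2 :=
  (((innerSL ℝ ((‖hopfCross m‖ ^ 2)⁻¹ • (m.1 * (hopf m.2 * hopfCross m)))).comp
      (ContinuousLinearMap.fst ℝ ℍ[ℝ] ℍ[ℝ])).smulRight (U₁ m)) +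
  (((innerSL ℝ ((‖hopfCross m‖ ^ 2)⁻¹ • (m.2 * (hopfCross m * hopf m.1)))).comp
      (ContinuousLinearMap.snd ℝ ℍ[ℝ] ℍ[ℝ])).smulRight (U₂ m)) +
  (((innerSL ℝ ((‖m.2‖ ^ 2 * ‖hopfCross m‖ ^ 2)⁻¹ • (m.1 * hopfCross m))).comp
      (ContinuousLinearMap.fst ℝ ℍ[ℝ] ℍ[ℝ])).smulRight (angularField c m)) +
  (((innerSL ℝ ((‖m.2‖ ^ 2)⁻¹ • m.2)).comp
      (ContinuousLinearMap.snd ℝ ℍ[ℝ] ℍ[ℝ])).smulRight (radialField m))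

theorem connectionMap_apply (c : ℝ) (m X : H2) : connectionMap c m X =
    ((‖hopfCross m‖ ^ 2)⁻¹ * ⟪m.1 * (hopf m.2 * hopfCross m), X.1⟫_ℝ) • U₁ m +
    ((‖hopfCross m‖ ^ 2)⁻¹ * ⟪m.2 * (hopfCross m * hopf m.1), X.2⟫_ℝ) • U₂ m +
    ((‖m.2‖ ^ 2 * ‖hopfCross m‖ ^ 2)⁻¹ * ⟪m.1 * hopfCross m, X.1⟫_ℝ) • angularField c m +
    ((‖m.2‖ ^ 2)⁻¹ * ⟪m.2, X.2⟫_ℝ) • radialField m := by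
  rw [← real_inner_smul_left, ← real_inner_smul_left, ← real_inner_smul_left,
    ← real_inner_smul_left]
  rfl

theorem contDiffOn_connectionMap (c : ℝ) : ContDiffOn ℝ ∞ (connectionMap c) principalSet := by
  intro m hm
  obtain ⟨-, hN⟩ := mem_principalSet.1 hm
  have ha := snd_ne_zero hN
  have hn : ContDiffAt ℝ ∞ (fun m => ‖hopfCross m‖ ^ 2) m := contDiff_hopfCross.contDiffAt.norm_sq ℝ
  have hr : ContDiffAt ℝ ∞ (fun m : H2 => ‖m.2‖ ^ 2) m := contDiffAt_snd.norm_sq ℝ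
  have hn0 : ‖hopfCross m‖ ^ 2 ≠ 0 := by simpa using hN
  have hr0 : ‖m.2‖ ^ 2 ≠ 0 := by simpa using ha
  have hsmulRight : ∀ {f : H2 → H2 →L[ℝ] ℝ} {g : H2 → H2}, ContDiffAt ℝ ∞ f m →
      ContDiffAt ℝ ∞ g m → ContDiffAt ℝ ∞ (fun m => (f m).smulRight (g m)) m :=
    fun hf hg => hf.smulRight hg
  have hcomp : ∀ {f : H2 → ℍ[ℝ]} (p : H2 →L[ℝ] ℍ[ℝ]), ContDiffAt ℝ ∞ f m →
      ContDiffAt ℝ ∞ (fun m => (innerSL ℝ (f m)).comp p) m := fun p hf =>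
    ((innerSL ℝ).contDiff.contDiffAt.comp m hf).clm_comp contDiffAt_const
  have hang : ContDiffAt ℝ ∞ (angularField c) m := by
    refine ContDiffAt.prodMk (hr.smul ?_) (((hr.add contDiffAt_const).neg).smul ?_) <;>
    exact ContDiff.contDiffAt (by fun_prop)
  refine ContDiffAt.contDiffWithinAt (((ContDiffAt.add ?_ ?_).add ?_).add ?_)
  · exact hsmulRight (hcomp _ ((hn.inv hn0).smul (ContDiff.contDiffAt (by fun_prop))))
      contDiff_U₁.contDiffAt
  · exact hsmulRight (hcomp _ ((hn.inv hn0).smul (ContDiff.contDiffAt (by fun_prop))))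
      contDiff_U₂.contDiffAt
  · exact hsmulRight (hcomp _ (((hr.mul hn).inv (mul_ne_zero hr0 hn0)).smul
      (ContDiff.contDiffAt (by fun_prop)))) hang
  · exact hsmulRight (hcomp _ ((hr.inv hr0).smul contDiffAt_snd))
      (ContDiff.contDiffAt (contDiff_const.prodMk contDiff_snd))

/-- The coefficients are dual to the four spanning vectors, so the map fixes each of them. -/
theorem range_connectionMap {c : ℝ} {m : H2} (hm : m ∈ principalSet) :
    LinearMap.range (connectionMap c m : H2 →ₗ[ℝ] H2) =
      torusTangent m ⊔ Submodule.span ℝ {angularField c m, radialField m} := by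
  obtain ⟨hM, hN⟩ := mem_principalSet.1 hm
  have ha := snd_ne_zero hN
  have hn0 : ‖hopfCross m‖ ^ 2 ≠ 0 := by simpa using hN
  have hr0 : ‖m.2‖ ^ 2 ≠ 0 := by simpa using ha
  obtain ⟨i1, i2, i3, i4, i5⟩ := inner_cross_products m
  have hx1 : ‖m.1‖ ^ 2 = 1 := by rw [show ‖m.1‖ = 1 from hM, one_pow]
  apply le_antisymm
  · rintro _ ⟨X, rfl⟩
    change connectionMap c m X ∈ _
    rw [connectionMap_apply]
    have h1 : U₁ m ∈ torusTangent m := Submodule.subset_span (Or.inl rfl)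
    have h2 : U₂ m ∈ torusTangent m := Submodule.subset_span (Or.inr rfl)
    have h3 : angularField c m ∈ Submodule.span ℝ {angularField c m, radialField m} :=
      Submodule.subset_span (Or.inl rfl)
    have h4 : radialField m ∈ Submodule.span ℝ {angularField c m, radialField m} :=
      Submodule.subset_span (Or.inr rfl)
    exact add_mem (add_mem (add_mem
      (Submodule.mem_sup_left (Submodule.smul_mem _ _ h1))
      (Submodule.mem_sup_left (Submodule.smul_mem _ _ h2)))
      (Submodule.mem_sup_right (Submodule.smul_mem _ _ h3)))
      (Submodule.mem_sup_right (Submodule.smul_mem _ _ h4))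
  · refine sup_le (Submodule.span_le.2 ?_) (Submodule.span_le.2 ?_)
    · rintro X (rfl | rfl)
      · refine ⟨U₁ m, ?_⟩
        change connectionMap c m (U₁ m) = _
        rw [connectionMap_apply, U₁_fst hM, inner_mul_left_mul_left, inner_mul_left_mul_left, i1,
          inner_hopfCross_left, hx1, one_mul, inv_mul_cancel₀ hn0]
        simp [U₁]
      · refine ⟨U₂ m, ?_⟩
        change connectionMap c m (U₂ m) = _
        have e1 : ⟪m.2 * (hopfCross m * hopf m.1), (U₂ m).2⟫_ℝ = ‖hopfCross m‖ ^ 2 := by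
          refine mul_left_cancel₀ hr0 ?_
          rw [← inner_smul_right, U₂_snd, inner_mul_left_mul_left, i3]
        have e2 : ⟪m.2, (U₂ m).2⟫_ℝ = 0 := inner_unit_mul m.2
        have e3 : (U₂ m).1 = 0 := rfl
        rw [connectionMap_apply, e1, e2, e3, inv_mul_cancel₀ hn0]
        simp
    · rintro X (rfl | rfl)
      · refine ⟨angularField c m, ?_⟩
        change connectionMap c m (angularField c m) = _
        have e1 : (angularField c m).1 = ‖m.2‖ ^ 2 • (m.1 * hopfCross m) := rfl
        have e2 : (angularField c m).2 = -(‖m.2‖ ^ 2 + 3 * c / 2) • (m.2 * hopfCross m) := rfl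
        rw [connectionMap_apply, e1, e2]
        simp only [inner_smul_right, inner_mul_left_mul_left, i2, i4,
          inner_mul_imaginary _ (hopfCross_re m), real_inner_self_eq_norm_sq, norm_mul, mul_pow, hx1,
          one_mul]
        rw [inv_mul_cancel₀ (mul_ne_zero hr0 hn0)]
        simp
      · refine ⟨radialField m, ?_⟩
        change connectionMap c m (radialField m) = _
        have e1 : (radialField m).1 = 0 := rfl
        have e2 : (radialField m).2 = m.2 := rfl
        have e3 : ⟪m.2 * (hopfCross m * hopf m.1), m.2⟫_ℝ = 0 := by
          have := inner_mul_left_mul_left m.2 (hopfCross m * hopf m.1) 1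
          rw [mul_one] at this
          rw [this, i5, mul_zero]
        rw [connectionMap_apply, e1, e2, e3, real_inner_self_eq_norm_sq, inv_mul_cancel₀ hr0]
        simp

theorem torusTangent_act_le (g : G) (m : H2) :
    (torusTangent m).map (act g) ≤ torusTangent (act g m) := by
  rw [torusTangent, Submodule.map_span_le]
  rintro X (rfl | rfl)
  · refine Submodule.subset_span (Or.inl ?_)
    ext1
    · simp only [act_fst, U₁]; simp only [← mul_assoc, unit_mul_coeComplex]
    · simp [act_snd, U₁]
  · refine Submodule.subset_span (Or.inr ?_)
    ext1
    · simp [act_fst, U₂]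
    · simp only [act_snd, U₂]; simp only [← mul_assoc, unit_mul_coeComplex]

theorem orbitTangent_act_le (g : G) (m : H2) :
    (orbitTangent m).map (act g) ≤ orbitTangent (act g m) := by
  have ht := torusTangent_act_le g m
  rw [orbitTangent, Submodule.map_span_le]
  rintro X (hX | ⟨l, rfl⟩)
  · exact torusTangent_le_orbitTangent _ (ht ⟨X, Submodule.subset_span hX, rfl⟩)
  · have h1 := star_mul_of_norm_one (norm_unitary g.2.2)
    have hre : ((g.2.2 : ℍ[ℝ]) * unit l * star (g.2.2 : ℍ[ℝ])).re = 0 := by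
      have := unit_re l
      simp [this]; ring
    have h2 := Submodule.smul_mem _ (1 / 2 : ℝ) (mul_mem_orbitTangent (act g m) hre)
    convert h2 using 1
    have h3 : ∀ p : ℍ[ℝ], p * star (g.2.2 : ℍ[ℝ]) * ((g.2.2 : ℍ[ℝ]) * unit l * star (g.2.2 : ℍ[ℝ])) =
        p * unit l * star (g.2.2 : ℍ[ℝ]) := fun p => by
      rw [mul_assoc (g.2.2 : ℍ[ℝ]), mul_assoc p, ← mul_assoc (star (g.2.2 : ℍ[ℝ])), h1, one_mul,
        ← mul_assoc]
    ext1
    · simp only [act_fst, V, Prod.smul_fst, h3, mul_smul_comm, smul_mul_assoc]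
      simp only [mul_assoc]
    · simp only [act_snd, V, Prod.smul_snd, h3, mul_smul_comm, smul_mul_assoc]
      simp only [mul_assoc]

theorem metricConnection_act_le {c : ℝ} (g : G) (m : H2) :
    (metricConnection c m).map (act g) ≤ metricConnection c (act g m) := by
  rw [metricConnection, Submodule.map_sup]
  refine sup_le_sup (torusTangent_act_le g m) ?_
  rw [Submodule.map_span_le]
  rintro X ⟨hX, hperp⟩
  refine Submodule.subset_span ⟨act_mem_TM g hX, fun Y hY => ?_⟩
  have h := orbitTangent_act_le g⁻¹ (act g m) ⟨Y, hY, rfl⟩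
  rw [act_inv_act] at h
  rw [← act_act_inv g Y, metric_act]
  exact hperp _ h

/-- Multiplication by r² turns i a into a · `hopf a` and X.2 into a z, so that only v, r²w, p and z
enter. The right-hand side vanishes on all orbit directions, which is the orthogonality of U₁ × U₂
to the orbits. -/
theorem phi_torus {c : ℝ} {m : H2} (hm : m ∈ M) {X : H2} {p z : ℍ[ℝ]} (hp : X.1 = m.1 * p)
    (hz : ‖m.2‖ ^ 2 • X.2 = m.2 * z) (ha : m.2 ≠ 0) :
    ‖m.2‖ ^ 2 * phi c m (U₁ m) (U₂ m) X = 4 * √3 *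
      (-(‖m.2‖ ^ 2 * ⟪hopfCross m, p⟫_ℝ) + z.re * hopfInner m + ⟪hopfCross m, z⟫_ℝ) := by
  have hr : ‖m.2‖ ^ 2 ≠ 0 := by simpa using ha
  have e0 : ∀ l, eForm l m (U₁ m) = -⟪unit l, hopf m.1⟫_ℝ := eForm_tangent hm (U₁_fst hm)
  have e1 : ∀ l, eForm l m (U₂ m) = 0 := fun l => by simp [eForm, U₂]
  have e2 : ∀ l, alphaForm l m (U₁ m) = 0 := fun l => by simp [alphaForm, U₁]
  have e3 : ∀ l, eForm l m X = -⟪unit l, p⟫_ℝ := eForm_tangent hm hp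
  have e4 : ∀ l, alphaForm l m (U₂ m) = -⟪unit l, hopf m.2⟫_ℝ := fun l => by
    refine mul_left_cancel₀ hr ?_
    rw [alphaForm, mul_neg, ← inner_smul_right, U₂_snd, inner_mul_left_mul_left, mul_neg]
  have e5 : ∀ l Y, dAlphaForm l (U₁ m) Y = 0 := fun l Y => by simp [dAlphaForm, U₁]
  have e6 : ∀ l Y, dAlphaForm l Y (U₁ m) = 0 := fun l Y => by simp [dAlphaForm, U₁]
  have e7 : ∀ l, ‖m.2‖ ^ 2 * dAlphaForm l (U₂ m) X = 2 * ⟪hopf m.2, z * unit l⟫_ℝ := fun l => by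
    refine mul_left_cancel₀ hr ?_
    have : ⟪m.2 * hopf m.2, m.2 * (z * unit l)⟫_ℝ = ‖m.2‖ ^ 2 * ⟪hopf m.2, z * unit l⟫_ℝ :=
      inner_mul_left_mul_left _ _ _
    rw [← U₂_snd, ← mul_assoc, ← hz, smul_mul_assoc, inner_smul_left, inner_smul_right] at this
    rw [dAlphaForm]
    simp only [conj_trivial] at this
    linear_combination 2 * this
  have e7' := fun l => e7 l
  simp only [phi, Matrix.det_fin_three, Fin.sum_univ_three, e0, e1, e2, e3, e4, e5, e6]
  simp only [Matrix.of_apply, Matrix.cons_val]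
  have d0 := e7 0
  have d1 := e7 1
  have d2 := e7 2
  rw [inner_expand] at d0 d1 d2
  simp [inner_expand] at d0 d1 d2 ⊢
  rw [hopfCross_imI, hopfCross_imJ, hopfCross_imK, hopfInner_expand]
  linear_combination 2 * √3 * ((hopf m.1).imI * d0 + (hopf m.1).imJ * d1 + (hopf m.1).imK * d2)

/-- Modulo the torus the horizontal space is the orthogonal complement of the orbit, so it meets the
orbit directions only in the torus directions. That both together span T_m M is checked by producing
all vertical vectors from v, r²w, n and the radial field. -/
theorem isConnection_metricConnection {c : ℝ} (hc : 0 < c) : IsConnection c (metricConnection c) := by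
  refine ⟨⟨connectionMap c, contDiffOn_connectionMap c, fun m hm => ?_⟩, fun m hm => ⟨?_, ?_, ?_, ?_⟩⟩
  · rw [range_connectionMap hm, metricConnection_eq hc hm]
  · refine le_antisymm ?_ (le_inf (le_sup_left) (torusTangent_le_orbitTangent m))
    rintro X ⟨hX, hXo⟩
    rw [metricConnection_eq hc hm] at hX
    obtain ⟨T, hT, Q, hQ, rfl⟩ := Submodule.mem_sup.1 hX
    obtain ⟨hQT, hperp⟩ := (orthogonal_eq_span hc hm).2 hQ
    have hQo : Q ∈ orbitTangent m := by
      have := Submodule.sub_mem _ hXo (torusTangent_le_orbitTangent m hT)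
      rwa [add_sub_cancel_left] at this
    rw [eq_zero_of_metric_self hc hm.1 hQT (hperp Q hQo), add_zero]
    exact hT
  · refine le_antisymm (sup_le ?_ (orbitTangent_le_TM m)) ?_
    · exact sup_le ((torusTangent_le_orbitTangent m).trans (orbitTangent_le_TM m))
        (Submodule.span_le.2 fun X hX => hX.1)
    · intro X hX
      obtain ⟨hM, hN⟩ := mem_principalSet.1 hm
      have hr : ‖m.2‖ ^ 2 ≠ 0 := by simpa using snd_ne_zero hN
      have hn : ‖hopfCross m‖ ^ 2 ≠ 0 := by simpa using hN
      obtain ⟨p, hp, hp0⟩ := exists_tangent hM hX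
      obtain ⟨S, hS⟩ : ∃ S, S = metricConnection c m ⊔ orbitTangent m := ⟨_, rfl⟩
      have ho : orbitTangent m ≤ S := hS ▸ le_sup_right
      have hH : Submodule.span ℝ {angularField c m, radialField m} ≤ S := by
        rw [hS, metricConnection_eq hc hm]; exact le_sup_right.trans le_sup_left
      rw [← hS]
      have hv : ((0, m.2 * hopf m.1) : H2) ∈ S := by
        have h1 := sub_mem (ho (mul_mem_orbitTangent m (hopf_re m.1)))
          (ho (Submodule.subset_span (Or.inl (Or.inl rfl))))
        convert h1 using 1
        ext1
        · exact (sub_eq_zero.2 (U₁_fst hM).symm).symm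
        · simp [U₁]
      have hw : ((0, m.2 * hopf m.2) : H2) ∈ S := by
        have h1 := S.smul_mem (‖m.2‖ ^ 2) (ho (Submodule.subset_span (Or.inl (Or.inr rfl))))
        convert h1 using 1
        ext1
        · simp [U₂]
        · exact (U₂_snd m).symm
      -- The orbit vector r²(x n, a n) and the angular field have the same first component; they
      -- differ by (0, a n) times 2r² + 3c/2 > 0.
      have hn' : ((0, m.2 * hopfCross m) : H2) ∈ S := by
        have h1 := S.smul_mem (2 * ‖m.2‖ ^ 2 + 3 * c / 2)⁻¹ (sub_mem
          (S.smul_mem (‖m.2‖ ^ 2) (ho (mul_mem_orbitTangent m (hopfCross_re m))))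
          (hH (Submodule.subset_span (Or.inl rfl))))
        convert h1 using 1
        ext1
        · simp [angularField]
        · have : 2 * ‖m.2‖ ^ 2 + 3 * c / 2 ≠ 0 := by positivity
          simp only [angularField, Prod.smul_snd, Prod.snd_sub, ← sub_smul, smul_smul]
          rw [show ‖m.2‖ ^ 2 - -(‖m.2‖ ^ 2 + 3 * c / 2) = 2 * ‖m.2‖ ^ 2 + 3 * c / 2 by ring,
            inv_mul_cancel₀ this, one_smul]
      have hvert : ∀ Y : ℍ[ℝ], ((0, Y) : H2) ∈ S := fun Y => by
        obtain ⟨z, hz⟩ : ∃ z, z = star m.2 * Y := ⟨_, rfl⟩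
        have hY : ‖m.2‖ ^ 2 • Y = m.2 * z := by rw [hz]; exact snd_scaled m (0, Y)
        have him : ∀ q : ℍ[ℝ], q.re = 0 → ((0, m.2 * q) : H2) ∈ S := fun q hq => by
          have h1 := S.smul_mem (‖hopfCross m‖ ^ 2)⁻¹ (add_mem (add_mem
            (S.smul_mem ⟪hopf m.2 * hopfCross m, q⟫_ℝ hv)
            (S.smul_mem ⟪hopfCross m * hopf m.1, q⟫_ℝ hw)) (S.smul_mem ⟪hopfCross m, q⟫_ℝ hn'))
          convert h1 using 1
          ext1
          · simp
          · simp only [Prod.smul_snd, Prod.snd_add, ← mul_smul_comm, ← mul_add]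
            rw [← inner_hopf_mul_cross m q hq, smul_smul, inv_mul_cancel₀ hn, one_smul]
        have h2 := S.smul_mem (‖m.2‖ ^ 2)⁻¹ (add_mem
          (S.smul_mem z.re (hH (Submodule.subset_span (Or.inr rfl))))
          (him (imQ (imCoord z)) rfl))
        convert h2 using 1
        ext1
        · simp [radialField]
        · simp only [Prod.smul_snd, Prod.snd_add, radialField]
          have hz' : z = z.re • 1 + imQ (imCoord z) := by ext <;> simp [imCoord]
          have : z.re • m.2 + m.2 * imQ (imCoord z) = m.2 * z := by
            conv_rhs => rw [hz']
            rw [mul_add, mul_smul_comm, mul_one]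
          rw [this, ← hY, smul_smul, inv_mul_cancel₀ hr, one_smul]
      have := add_mem (ho (mul_mem_orbitTangent m hp0)) (hvert (X.2 - m.2 * p))
      convert this using 1
      ext1 <;> simp [hp]
  · intro g
    refine le_antisymm (metricConnection_act_le g m) fun X hX => ?_
    refine ⟨act g⁻¹ X, ?_, act_act_inv g X⟩
    have := metricConnection_act_le g⁻¹ (act g m) ⟨X, hX, rfl⟩
    rwa [act_inv_act] at this
  · rintro W ⟨hW, hcross⟩
    obtain ⟨hM, hN⟩ := mem_principalSet.1 hm
    have ha := snd_ne_zero hN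
    have hr : ‖m.2‖ ^ 2 ≠ 0 := by simpa using ha
    refine Submodule.mem_sup_right (Submodule.subset_span ⟨hW, fun Y hY => ?_⟩)
    rw [hcross Y (orbitTangent_le_TM m hY)]
    refine mul_left_cancel₀ hr ?_
    rw [mul_zero]
    induction hY using Submodule.span_induction with
    | mem Y hY =>
      rcases hY with (rfl | rfl) | ⟨l, rfl⟩
      · rw [phi_torus hM (U₁_fst hM) (z := 0) (by simp [U₁]) ha, inner_hopfCross_left]; simp
      · rw [phi_torus hM (p := 0) (by simp [U₂]) (U₂_snd m) ha, inner_hopfCross_right]; simp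
      · rw [phi_torus hM (p := (1 / 2 : ℝ) • unit l) (z := ‖m.2‖ ^ 2 • (1 / 2 : ℝ) • unit l)
          (by simp [V]) (by simp [V]) ha, inner_smul_right _ _ (‖m.2‖ ^ 2)]
        simp [unit_re]
    | zero => rw [← hcross 0 (TM m).zero_mem, metric_comm, metric_zero_left, mul_zero]
    | add X Y h1 h2 hX hY =>
      rw [← hcross _ (orbitTangent_le_TM m h1)] at hX
      rw [← hcross _ (orbitTangent_le_TM m h2)] at hY
      rw [← hcross _ (orbitTangent_le_TM m (add_mem h1 h2)), metric_comm, metric_add_left,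
        metric_comm, metric_comm c m Y, mul_add, hX, hY, add_zero]
    | smul a X h1 hX =>
      rw [← hcross _ (orbitTangent_le_TM m h1)] at hX
      rw [← hcross _ ((TM m).smul_mem a (orbitTangent_le_TM m h1)), metric_comm, metric_smul_left,
        metric_comm, mul_left_comm, hX, mul_zero]

/-! ### The angle function -/

-- After reflection the integral is a convolution with the indicator function of (-1, 0], evaluated
-- at 0. The cutoff χ, equal to 1 on [-2, 2], provides the compact support under which convolutions
-- depend smoothly on a parameter.
open MeasureTheory in
theorem contDiff_integral_unitInterval {P : Type*} [NormedAddCommGroup P] [NormedSpace ℝ P]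
    {K : P × ℝ → ℝ} (hK : ContDiff ℝ ∞ K) :
    ContDiff ℝ ∞ fun p => ∫ u in (0 : ℝ)..1, K (p, u) := by
  let χ : ContDiffBump (0 : ℝ) := ⟨2, 3, by norm_num, by norm_num⟩
  have hf : LocallyIntegrable (Set.indicator (Set.Ioc (-1 : ℝ) 0) fun _ => (1 : ℝ)) :=
    (locallyIntegrable_const (1 : ℝ)).indicator measurableSet_Ioc
  have h := contDiffOn_convolution_right_with_param_comp (n := ⊤) (μ := volume)
    (ContinuousLinearMap.mul ℝ ℝ) (s := (Set.univ : Set P)) (v := fun _ => (0 : ℝ))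
    (g := fun p x => χ x * K (p, x)) contDiffOn_const isOpen_univ
    (isCompact_closedBall (0 : ℝ) 3) (fun p x _ hx => ?_) hf ?_
  · rw [contDiffOn_univ] at h
    convert h using 1
    funext p
    have e1 : ∫ u in (0 : ℝ)..1, K (p, u) = ∫ t in (-1 : ℝ)..0, K (p, -t) := by
      rw [intervalIntegral.integral_comp_neg (fun u => K (p, u))]; simp
    rw [e1, intervalIntegral.integral_of_le (by norm_num), convolution_def,
      ← integral_indicator measurableSet_Ioc]
    refine integral_congr_ae (Filter.Eventually.of_forall fun t => ?_)
    by_cases ht : t ∈ Set.Ioc (-1 : ℝ) 0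
    · have h1 : χ (-t) = 1 := χ.one_of_mem_closedBall (by
        rw [Metric.mem_closedBall, Real.dist_eq, abs_le]
        change -2 ≤ _ ∧ _ ≤ (2 : ℝ)
        constructor <;> linarith [ht.1, ht.2])
      simp [ht, h1]
    · simp [ht]
  · have h1 : χ x = 0 := χ.zero_of_le_dist (by
      change (3 : ℝ) ≤ _
      rw [Metric.mem_closedBall, not_le] at hx
      exact hx.le)
    simp only [h1, zero_mul]
  · refine ContDiff.contDiffOn ?_
    change ContDiff ℝ ∞ fun q : P × ℝ => χ q.2 * K (q.1, q.2)
    exact (χ.contDiff.comp contDiff_snd).mul hK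

/-- The function `log ρ ↦ log (ρ (c + ρ)^(1/3))`. -/
def logScale (c y : ℝ) : ℝ := y + Real.log (c + Real.exp y) / 3

/-! ### Radius and turning angle along a level curve of |μ|, as functions of cot θ -/

section LogScale

variable {c : ℝ} (hc : 0 < c)

theorem hasDerivAt_logScale (hc : 0 < c) (y : ℝ) : HasDerivAt (logScale c)
    (1 + Real.exp y / (c + Real.exp y) / 3) y := by
  have h : c + Real.exp y ≠ 0 := by positivity
  exact (hasDerivAt_id y).add ((((Real.hasDerivAt_exp y).const_add c).log h).div_const 3)

theorem contDiff_logScale (hc : 0 < c) : ContDiff ℝ ∞ (logScale c) := by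
  unfold logScale
  have h : ∀ y, c + Real.exp y ≠ 0 := fun y => by positivity
  fun_prop (disch := exact h)

theorem strictMono_logScale (hc : 0 < c) : StrictMono (logScale c) := by
  intro y z h
  have := Real.exp_lt_exp.2 h
  have h1 : Real.log (c + Real.exp y) < Real.log (c + Real.exp z) :=
    Real.log_lt_log (by positivity) (by linarith)
  unfold logScale
  linarith

theorem surjective_logScale (hc : 0 < c) : Function.Surjective (logScale c) := by
  refine (contDiff_logScale hc).continuous.surjective ?_ ?_
  · refine Filter.tendsto_atTop_mono (f := fun y => y + Real.log c / 3) (fun y => ?_)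
      (Filter.tendsto_atTop_add_const_right _ _ Filter.tendsto_id)
    have : Real.log c ≤ Real.log (c + Real.exp y) :=
      Real.log_le_log hc (by linarith [Real.exp_pos y])
    unfold logScale
    linarith
  · have h : ∀ᶠ y in Filter.atBot, logScale c y ≤ y + Real.log (c + 1) / 3 := by
      filter_upwards [Filter.eventually_le_atBot 0] with y hy
      have : Real.log (c + Real.exp y) ≤ Real.log (c + 1) :=
        Real.log_le_log (by positivity) (by linarith [Real.exp_le_one_iff.2 hy])
      unfold logScale
      linarith
    exact Filter.tendsto_atBot_mono' _ h
      (Filter.tendsto_atBot_add_const_right _ _ Filter.tendsto_id)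

/-- `logScale` as a homeomorphism of the line. -/
def logScaleHomeo (hc : 0 < c) : ℝ ≃ₜ ℝ :=
  ((strictMono_logScale hc).orderIsoOfSurjective _ (surjective_logScale hc)).toHomeomorph

/-- The derivative of `logScale` is everywhere positive, so its inverse is smooth. -/
theorem contDiff_logScaleHomeo_symm : ContDiff ℝ ∞ (logScaleHomeo hc).symm :=
  (logScaleHomeo hc).contDiff_symm_deriv (f' := fun y => 1 + Real.exp y / (c + Real.exp y) / 3)
    (fun y => by positivity) (hasDerivAt_logScale hc) (contDiff_logScale hc)

/-- The value of `log r²` on the fibre with parameter `k`, as a function of `t = cot θ`. -/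
def logRadius (q : ℝ × ℝ) : ℝ := (logScaleHomeo hc).symm (q.1 + Real.log (1 + q.2 ^ 2) / 2)

theorem logScale_logRadius (q : ℝ × ℝ) :
    logScale c (logRadius hc q) = q.1 + Real.log (1 + q.2 ^ 2) / 2 :=
  (logScaleHomeo hc).apply_symm_apply _

theorem logRadius_eq {q : ℝ × ℝ} {y : ℝ} (h : logScale c y = q.1 + Real.log (1 + q.2 ^ 2) / 2) :
    logRadius hc q = y := by
  rw [logRadius, ← h]; exact (logScaleHomeo hc).symm_apply_apply y

theorem contDiff_logRadius : ContDiff ℝ ∞ (logRadius hc) := by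
  have h : ∀ q : ℝ × ℝ, 1 + q.2 ^ 2 ≠ 0 := fun q => by positivity
  refine (contDiff_logScaleHomeo_symm hc).comp ?_
  fun_prop (disch := exact h)

/-- Implicit differentiation of `logScale c y = k + log (1 + t²) / 2`. -/
theorem hasDerivAt_logRadius (k t : ℝ) : HasDerivAt (fun t => logRadius hc (k, t))
    (3 * (c + Real.exp (logRadius hc (k, t))) * t /
      ((4 * Real.exp (logRadius hc (k, t)) + 3 * c) * (1 + t ^ 2))) t := by
  have h1 : HasDerivAt (logScaleHomeo hc).symm _ (k + Real.log (1 + t ^ 2) / 2) :=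
    HasDerivAt.of_local_left_inverse (f := logScale c)
      (logScaleHomeo hc).symm.continuous.continuousAt
      (hasDerivAt_logScale hc (logRadius hc (k, t))) (by positivity)
      (Filter.Eventually.of_forall (logScaleHomeo hc).apply_symm_apply)
  have h2 : HasDerivAt (fun t : ℝ => k + Real.log (1 + t ^ 2) / 2) (2 * t / (1 + t ^ 2) / 2) t := by
    have := (((hasDerivAt_pow 2 t).const_add 1).log (by positivity)).div_const 2
    simpa using this.const_add k
  have h3 := h1.comp t h2
  refine h3.congr_deriv ?_
  have := Real.exp_pos (logRadius hc (k, t))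
  field_simp
  ring

/-- The integrand of the angle function. -/
def angleSpeed (q : ℝ × ℝ) : ℝ := -(2 * Real.exp (logRadius hc q) /
  ((4 * Real.exp (logRadius hc q) + 3 * c) * (1 + q.2 ^ 2)))

theorem contDiff_angleSpeed : ContDiff ℝ ∞ (angleSpeed hc) := by
  have h := contDiff_logRadius hc
  have h2 : ∀ q : ℝ × ℝ, (4 * Real.exp (logRadius hc q) + 3 * c) * (1 + q.2 ^ 2) ≠ 0 :=
    fun q => by positivity
  unfold angleSpeed
  fun_prop (disch := exact h2)

/-- The angle in the plane spanned by `v` and `w` through which a parallel frame turns along the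
fibre with parameter `k`, from `θ = π / 2` to `θ = arccot t`. -/
def fibreAngle (q : ℝ × ℝ) : ℝ := ∫ u in (0 : ℝ)..1, q.2 * angleSpeed hc (q.1, q.2 * u)

theorem contDiff_fibreAngle : ContDiff ℝ ∞ (fibreAngle hc) :=
  contDiff_integral_unitInterval (K := fun p : (ℝ × ℝ) × ℝ =>
    p.1.2 * angleSpeed hc (p.1.1, p.1.2 * p.2)) (by
      have h := contDiff_angleSpeed hc
      fun_prop)

/-- The integral over [0, 1], convenient for joint smoothness in k and t, becomes by substitution
the integral of `angleSpeed` from 0 to t. -/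
theorem hasDerivAt_fibreAngle (k t : ℝ) :
    HasDerivAt (fun t => fibreAngle hc (k, t)) (angleSpeed hc (k, t)) t := by
  have hcont : Continuous fun u => angleSpeed hc (k, u) :=
    (contDiff_angleSpeed hc).continuous.comp (by fun_prop)
  have h : (fun t => fibreAngle hc (k, t)) = fun t => ∫ u in (0 : ℝ)..t, angleSpeed hc (k, u) := by
    funext t
    simp only [fibreAngle]
    rw [intervalIntegral.integral_const_mul,
      intervalIntegral.mul_integral_comp_mul_left (f := fun u => angleSpeed hc (k, u))]
    simp
  rw [h]
  exact intervalIntegral.integral_hasDerivAt_right (hcont.intervalIntegrable _ _)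
    hcont.aestronglyMeasurable.stronglyMeasurableAtFilter hcont.continuousAt

end LogScale

/-! ### Frames adapted to the principal set -/

/-- The unit quaternion `cos α + k sin α`. -/
def expK (α : ℝ) : ℍ[ℝ] := Real.cos α • (1 : ℍ[ℝ]) + Real.sin α • unit 2

@[fun_prop] theorem contDiff_expK {n : ℕ∞ω} : ContDiff ℝ n expK := by
  unfold expK
  exact (Real.contDiff_cos.smul contDiff_const).add (Real.contDiff_sin.smul contDiff_const)

@[simp] theorem expK_re (α : ℝ) : (expK α).re = Real.cos α := by simp [expK]
@[simp] theorem expK_imI (α : ℝ) : (expK α).imI = 0 := by simp [expK]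
@[simp] theorem expK_imJ (α : ℝ) : (expK α).imJ = 0 := by simp [expK]
@[simp] theorem expK_imK (α : ℝ) : (expK α).imK = Real.sin α := by simp [expK]

theorem expK_mul_expK (α β : ℝ) : expK α * expK β = expK (α + β) := by
  ext <;> simp [Real.cos_add, Real.sin_add]; ring

theorem star_expK (α : ℝ) : star (expK α) = expK (-α) := by ext <;> simp

theorem norm_expK (α : ℝ) : ‖expK α‖ = 1 := by
  rw [← sq_eq_sq₀ (norm_nonneg _) zero_le_one, normSq_expand]
  simp

theorem unit_zero_mul_expK (α : ℝ) : unit 0 * expK α = expK (-α) * unit 0 := by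
  ext <;> simp

theorem unit_two_mul_expK (α : ℝ) : unit 2 * expK α = expK α * unit 2 := by ext <;> simp

theorem hasDerivAt_expK (α : ℝ) : HasDerivAt expK (unit 2 * expK α) α := by
  have h := ((Real.hasDerivAt_cos α).smul_const (1 : ℍ[ℝ])).add
    ((Real.hasDerivAt_sin α).smul_const (unit 2))
  refine h.congr_deriv ?_
  ext <;> simp

/-- The image of `k` under the rotation defined by a quaternion. -/
def hopfK (p : ℍ[ℝ]) : ℍ[ℝ] := star p * unit 2 * p

@[simp] theorem hopfK_re (p : ℍ[ℝ]) : (hopfK p).re = 0 := by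
  simp [hopfK]; ring

theorem norm_hopfK (p : ℍ[ℝ]) : ‖hopfK p‖ = ‖p‖ ^ 2 := by
  rw [hopfK, norm_mul, norm_mul, norm_unit, Quaternion.norm_star]; ring

theorem unit_two_mul_eq {p : ℍ[ℝ]} (h : ‖p‖ = 1) : unit 2 * p = p * hopfK p := by
  rw [hopfK, ← mul_assoc, ← mul_assoc, mul_star_of_norm_one h, one_mul]

theorem hopfK_eq_of_intertwine {p u : ℍ[ℝ]} (h : ‖p‖ = 1) (hu : unit 2 * p = p * u) :
    hopfK p = u := by
  rw [hopfK, mul_assoc, hu, ← mul_assoc, star_mul_of_norm_one h, one_mul]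

theorem norm_expK_mul (α : ℝ) {x : ℍ[ℝ]} (hx : ‖x‖ = 1) : ‖expK α * x‖ = 1 := by
  rw [norm_mul, norm_expK, hx, one_mul]

/-- Since i anticommutes with k, moving `expK` past i reverses its angle, and the two factors add up
to the double angle. With `rotate_hopf` this is a rotation about `hopfK x` through -2α. -/
theorem hopf_expK_mul (α : ℝ) (x : ℍ[ℝ]) :
    hopf (expK α * x) = star x * (expK (-(2 * α)) * unit 0) * x := by
  rw [hopf, StarMul.star_mul, star_expK]
  have : expK (-(2 * α)) * unit 0 = expK (-α) * unit 0 * expK α := by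
    rw [mul_assoc, unit_zero_mul_expK, ← mul_assoc, expK_mul_expK]
    congr 2; ring
  rw [this]
  simp only [mul_assoc]

theorem star_mul_expK_mul (α : ℝ) {x : ℍ[ℝ]} (hx : ‖x‖ = 1) :
    star x * expK α * x = Real.cos α • (1 : ℍ[ℝ]) + Real.sin α • hopfK x := by
  rw [expK, mul_add, add_mul, mul_smul_comm, mul_smul_comm, smul_mul_assoc, smul_mul_assoc,
    mul_one, star_mul_of_norm_one hx, hopfK]

/-- Rotation through `α` about `n` of a vector orthogonal to the unit vector `n`. -/
def rotate (n : ℍ[ℝ]) (α : ℝ) (v : ℍ[ℝ]) : ℍ[ℝ] := (Real.cos α • (1 : ℍ[ℝ]) + Real.sin α • n) * v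

theorem rotate_hopf (α : ℝ) {x : ℍ[ℝ]} (hx : ‖x‖ = 1) :
    rotate (hopfK x) α (hopf x) = star x * (expK α * unit 0) * x := by
  rw [rotate, ← star_mul_expK_mul α hx, hopf]
  have : star x * expK α * x * (star x * unit 0 * x) =
      star x * expK α * (x * star x) * (unit 0 * x) := by simp only [mul_assoc]
  rw [this, mul_star_of_norm_one hx, mul_one]
  simp only [mul_assoc]

theorem rotate_rotate {n : ℍ[ℝ]} (h0 : n.re = 0) (h1 : ‖n‖ = 1) (α β : ℝ) (v : ℍ[ℝ]) :
    rotate n α (rotate n β v) = rotate n (α + β) v := by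
  have hn := mul_self_eq_neg_one h0 h1
  rw [rotate, rotate, rotate, ← mul_assoc]
  congr 1
  simp only [mul_add, add_mul, smul_mul_assoc, mul_smul_comm, one_mul, mul_one, hn, Real.cos_add,
    Real.sin_add]
  module

theorem rotate_zero (n v : ℍ[ℝ]) : rotate n 0 v = v := by simp [rotate]

theorem hopf_coe_mul (z : ℂ) {p : ℍ[ℝ]} (hp : ‖p‖ = 1) :
    hopf ((z : ℍ[ℝ]) * p) = ‖z‖ ^ 2 • hopf p := by
  rw [hopf_eq_of_intertwine (coe_mul_intertwine z (intertwine_hopf hp)), norm_mul, norm_coeComplex,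
    hp, mul_one]

theorem hopfInner_eq_neg_re (m : H2) : hopfInner m = -(hopf m.1 * hopf m.2).re := by
  have := hopfCross_re m
  rw [hopfCross] at this
  simp only [Quaternion.re_add, Quaternion.re_coe] at this
  linarith

/-! ### The parametrization of the fibres -/

/-- The angle with cotangent `t`. -/
def arccot (t : ℝ) : ℝ := Real.pi / 2 - Real.arctan t

@[fun_prop] theorem contDiff_arccot {n : ℕ∞ω} : ContDiff ℝ n arccot :=
  contDiff_const.sub Real.contDiff_arctan

theorem hasDerivAt_arccot (t : ℝ) : HasDerivAt arccot (-(1 / (1 + t ^ 2))) t :=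
  ((Real.hasDerivAt_arctan t).const_sub (Real.pi / 2))

theorem cos_arccot (t : ℝ) : Real.cos (arccot t) = t / √(1 + t ^ 2) := by
  rw [arccot, Real.cos_pi_div_two_sub, Real.sin_arctan]

theorem sin_arccot (t : ℝ) : Real.sin (arccot t) = 1 / √(1 + t ^ 2) := by
  rw [arccot, Real.sin_pi_div_two_sub, Real.cos_arctan]

/-- The cotangent of the angle `θ`. -/
def cotTheta (m : H2) : ℝ := hopfInner m / ‖hopfCross m‖

/-- The value of `|μ|`. -/
def level (c : ℝ) (m : H2) : ℝ := 3 * weight c m ^ (1 / 3 : ℝ) * ‖hopfCross m‖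

/-- The unit vector in the direction of `μ`. -/
def direction (m : H2) : ℍ[ℝ] := ‖hopfCross m‖⁻¹ • hopfCross m

@[simp] theorem direction_re (m : H2) : (direction m).re = 0 := by simp [direction]

theorem norm_direction {m : H2} (h : hopfCross m ≠ 0) : ‖direction m‖ = 1 := by
  rw [direction, norm_smul, norm_inv, norm_norm, inv_mul_cancel₀ (norm_ne_zero_iff.2 h)]

section Fibre

variable {c : ℝ} (hc : 0 < c)

/-- The `S³`-component of the fibres, up to the torus action. -/
def fibreFst (q : ℝ × ℝ) (x : ℍ[ℝ]) : ℍ[ℝ] := expK (fibreAngle hc q / 2) * x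

/-- The direction of the `ℝ⁴`-component of the fibres, up to the torus action. -/
def fibreSnd (q : ℝ × ℝ) (x : ℍ[ℝ]) : ℍ[ℝ] := expK ((fibreAngle hc q - arccot q.2) / 2) * x

theorem contDiff_fibreFst : ContDiff ℝ ∞ fun p : (ℝ × ℝ) × ℍ[ℝ] => fibreFst hc p.1 p.2 := by
  have := contDiff_fibreAngle hc
  unfold fibreFst
  fun_prop

theorem contDiff_fibreSnd : ContDiff ℝ ∞ fun p : (ℝ × ℝ) × ℍ[ℝ] => fibreSnd hc p.1 p.2 := by
  have := contDiff_fibreAngle hc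
  unfold fibreSnd
  fun_prop

theorem norm_fibreFst (q : ℝ × ℝ) {x : ℍ[ℝ]} (hx : ‖x‖ = 1) : ‖fibreFst hc q x‖ = 1 :=
  norm_expK_mul _ hx

theorem norm_fibreSnd (q : ℝ × ℝ) {x : ℍ[ℝ]} (hx : ‖x‖ = 1) : ‖fibreSnd hc q x‖ = 1 :=
  norm_expK_mul _ hx

theorem hopf_fibreFst (q : ℝ × ℝ) {x : ℍ[ℝ]} (hx : ‖x‖ = 1) :
    hopf (fibreFst hc q x) = rotate (hopfK x) (-fibreAngle hc q) (hopf x) := by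
  rw [fibreFst, hopf_expK_mul, rotate_hopf _ hx]
  congr 4; ring

theorem hopf_fibreSnd (q : ℝ × ℝ) {x : ℍ[ℝ]} (hx : ‖x‖ = 1) :
    hopf (fibreSnd hc q x) = rotate (hopfK x) (arccot q.2 - fibreAngle hc q) (hopf x) := by
  rw [fibreSnd, hopf_expK_mul, rotate_hopf _ hx]
  congr 4; ring

/-- The parametrization by `T² × ℝ` of the fibre with parameter `k` and frame given by `x`. -/
def fibrePoint (k : ℝ) (x : ℍ[ℝ]) (z : ℂ × ℂ × ℝ) : H2 :=
  ((z.1 : ℍ[ℝ]) * fibreFst hc (k, z.2.2) x,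
    ((Real.exp (logRadius hc (k, z.2.2) / 2) • z.2.1 : ℂ) : ℍ[ℝ]) * fibreSnd hc (k, z.2.2) x)

/-- The angle through which the frame is turned at a point of the principal set. -/
def frameAngle (m : H2) : ℝ := fibreAngle hc (Real.log (level c m / 3), cotTheta m)

/-- The first vector of the adapted frame. -/
def frameFst (m : H2) : ℍ[ℝ] := rotate (direction m) (frameAngle hc m) (hopf m.1)

/-- The fibration `M_P → ℝ⁺ × SO(3)`. -/
def principalMap (m : H2) : ℝ × (Fin 3 → Fin 3 → ℝ) :=
  (level c m, ![imCoord (frameFst hc m), imCoord (direction m * frameFst hc m),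
    imCoord (direction m)])

variable {k : ℝ} {x : ℍ[ℝ]} {z : ℂ × ℂ × ℝ}

theorem norm_fibrePoint_snd (hx : ‖x‖ = 1) (hz : z ∈ torusLine) :
    ‖(fibrePoint hc k x z).2‖ = Real.exp (logRadius hc (k, z.2.2) / 2) := by
  rw [fibrePoint, norm_mul, norm_coeComplex, norm_smul, hz.2, norm_fibreSnd hc _ hx,
    Real.norm_of_nonneg (Real.exp_pos _).le, mul_one, mul_one]

theorem norm_fibrePoint_snd_sq (hx : ‖x‖ = 1) (hz : z ∈ torusLine) :
    ‖(fibrePoint hc k x z).2‖ ^ 2 = Real.exp (logRadius hc (k, z.2.2)) := by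
  rw [norm_fibrePoint_snd hc hx hz, ← Real.exp_nat_mul]
  congr 1; push_cast; ring

theorem hopf_fibrePoint_fst (hx : ‖x‖ = 1) (hz : z ∈ torusLine) :
    hopf (fibrePoint hc k x z).1 =
      rotate (hopfK x) (-fibreAngle hc (k, z.2.2)) (hopf x) := by
  rw [fibrePoint, hopf_coe_mul _ (norm_fibreFst hc _ hx), hz.1, hopf_fibreFst hc _ hx]
  simp

theorem hopf_fibrePoint_snd (hx : ‖x‖ = 1) (hz : z ∈ torusLine) :
    hopf (fibrePoint hc k x z).2 = Real.exp (logRadius hc (k, z.2.2)) •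
      rotate (hopfK x) (arccot z.2.2 - fibreAngle hc (k, z.2.2)) (hopf x) := by
  rw [← norm_fibrePoint_snd_sq hc hx hz, fibrePoint, hopf_coe_mul _ (norm_fibreSnd hc _ hx),
    hopf_fibreSnd hc _ hx, norm_mul, norm_coeComplex, norm_fibreSnd hc _ hx, mul_one]

/-- The common angle `fibreAngle` cancels, so inner and cross product of v and r²w see only the
difference `arccot t`. -/
theorem hopf_mul_hopf_fibrePoint (hx : ‖x‖ = 1) (hz : z ∈ torusLine) :
    hopf (fibrePoint hc k x z).1 * hopf (fibrePoint hc k x z).2 =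
      Real.exp (logRadius hc (k, z.2.2)) • (-(Real.cos (arccot z.2.2)) • (1 : ℍ[ℝ]) +
        Real.sin (arccot z.2.2) • hopfK x) := by
  rw [hopf_fibrePoint_fst hc hx hz, hopf_fibrePoint_snd hc hx hz, mul_smul_comm, rotate_hopf _ hx,
    rotate_hopf _ hx]
  congr 1
  obtain ⟨α, hα⟩ : ∃ α, α = fibreAngle hc (k, z.2.2) := ⟨_, rfl⟩
  have e1 : star x * (expK (-α) * unit 0) * x *
      (star x * (expK (arccot z.2.2 - α) * unit 0) * x) =
      star x * (expK (-α) * (unit 0 * ((x * star x) * (expK (arccot z.2.2 - α) * unit 0)))) * x := by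
    simp only [mul_assoc]
  have e2 : unit 0 * unit 0 = -1 := by ext <;> simp
  have e3 : expK (-α) * expK (α - arccot z.2.2) = expK (-arccot z.2.2) := by
    rw [expK_mul_expK]; congr 1; ring
  rw [← hα, e1, mul_star_of_norm_one hx, one_mul, ← mul_assoc (unit 0), unit_zero_mul_expK, neg_sub,
    mul_assoc (expK (α - arccot z.2.2)), e2, ← mul_assoc (expK (-α)), e3, mul_neg_one, mul_neg,
    neg_mul,
    star_mul_expK_mul _ hx, Real.cos_neg, Real.sin_neg]
  module

theorem hopfInner_fibrePoint (hx : ‖x‖ = 1) (hz : z ∈ torusLine) :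
    hopfInner (fibrePoint hc k x z) =
      Real.exp (logRadius hc (k, z.2.2)) * Real.cos (arccot z.2.2) := by
  rw [hopfInner_eq_neg_re, hopf_mul_hopf_fibrePoint hc hx hz]
  simp

theorem hopfCross_fibrePoint (hx : ‖x‖ = 1) (hz : z ∈ torusLine) :
    hopfCross (fibrePoint hc k x z) =
      (Real.exp (logRadius hc (k, z.2.2)) * Real.sin (arccot z.2.2)) • hopfK x := by
  rw [hopfCross, hopf_mul_hopf_fibrePoint hc hx hz, hopfInner_fibrePoint hc hx hz]
  ext <;> simp <;> ring

theorem sqrt_one_add_sq_pos (t : ℝ) : 0 < √(1 + t ^ 2) := Real.sqrt_pos.2 (by positivity)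

theorem sin_arccot_pos (t : ℝ) : 0 < Real.sin (arccot t) := by
  rw [sin_arccot]; exact one_div_pos.2 (sqrt_one_add_sq_pos t)

theorem norm_hopfCross_fibrePoint (hx : ‖x‖ = 1) (hz : z ∈ torusLine) :
    ‖hopfCross (fibrePoint hc k x z)‖ =
      Real.exp (logRadius hc (k, z.2.2)) * Real.sin (arccot z.2.2) := by
  rw [hopfCross_fibrePoint hc hx hz, norm_smul, norm_hopfK, hx, one_pow, mul_one,
    Real.norm_of_nonneg (mul_pos (Real.exp_pos _) (sin_arccot_pos _)).le]

theorem fibrePoint_mem (hx : ‖x‖ = 1) (hz : z ∈ torusLine) :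
    fibrePoint hc k x z ∈ principalSet := by
  refine mem_principalSet.2 ⟨?_, ?_⟩
  · change ‖_‖ = 1
    rw [fibrePoint, norm_mul, norm_coeComplex, norm_fibreFst hc _ hx, hz.1, mul_one]
  · rw [← norm_ne_zero_iff, norm_hopfCross_fibrePoint hc hx hz]
    exact (mul_pos (Real.exp_pos _) (sin_arccot_pos _)).ne'

theorem cotTheta_fibrePoint (hx : ‖x‖ = 1) (hz : z ∈ torusLine) :
    cotTheta (fibrePoint hc k x z) = z.2.2 := by
  have := (sqrt_one_add_sq_pos z.2.2).ne'
  rw [cotTheta, hopfInner_fibrePoint hc hx hz, norm_hopfCross_fibrePoint hc hx hz,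
    mul_div_mul_left _ _ (Real.exp_pos _).ne', cos_arccot, sin_arccot]
  field_simp

theorem direction_fibrePoint (hx : ‖x‖ = 1) (hz : z ∈ torusLine) :
    direction (fibrePoint hc k x z) = hopfK x := by
  rw [direction, norm_hopfCross_fibrePoint hc hx hz, hopfCross_fibrePoint hc hx hz, smul_smul,
    inv_mul_cancel₀ (mul_pos (Real.exp_pos _) (sin_arccot_pos _)).ne', one_smul]

/-- The equation defining `logRadius` is the logarithm of ρ(c + ρ)^(1/3) sin θ = exp k, with ρ = r²
and sin θ = (1 + t²)^(-1/2). -/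
theorem level_fibrePoint (hx : ‖x‖ = 1) (hz : z ∈ torusLine) :
    level c (fibrePoint hc k x z) = 3 * Real.exp k := by
  have h := logScale_logRadius hc (k, z.2.2)
  rw [level, norm_hopfCross_fibrePoint hc hx hz, weight, norm_fibrePoint_snd_sq hc hx hz, sin_arccot]
  obtain ⟨y, hy⟩ : ∃ y, y = logRadius hc (k, z.2.2) := ⟨_, rfl⟩
  rw [← hy] at h ⊢
  simp only [logScale] at h
  have h1 : √(1 + z.2.2 ^ 2) = Real.exp (Real.log (1 + z.2.2 ^ 2) / 2) := by
    rw [Real.sqrt_eq_rpow, Real.rpow_def_of_pos (by positivity)]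
    congr 1; ring
  rw [h1, Real.rpow_def_of_pos (by positivity), one_div (Real.exp _), ← Real.exp_neg, mul_assoc, ← Real.exp_add,
    ← Real.exp_add]
  congr 2
  linarith

theorem frameAngle_fibrePoint (hx : ‖x‖ = 1) (hz : z ∈ torusLine) :
    frameAngle hc (fibrePoint hc k x z) = fibreAngle hc (k, z.2.2) := by
  rw [frameAngle, level_fibrePoint hc hx hz, cotTheta_fibrePoint hc hx hz,
    mul_div_cancel_left₀ _ (by norm_num), Real.log_exp]

theorem frameFst_fibrePoint (hx : ‖x‖ = 1) (hz : z ∈ torusLine) :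
    frameFst hc (fibrePoint hc k x z) = hopf x := by
  rw [frameFst, direction_fibrePoint hc hx hz, frameAngle_fibrePoint hc hx hz,
    hopf_fibrePoint_fst hc hx hz, rotate_rotate (hopfK_re x) (by rw [norm_hopfK, hx]; norm_num),
    add_neg_cancel, rotate_zero]

/-! ### Points of the principal set on the fibres -/

variable {m : H2}

theorem norm_sq_eq_mul_sqrt (hm : m ∈ principalSet) :
    ‖m.2‖ ^ 2 = ‖hopfCross m‖ * √(1 + cotTheta m ^ 2) := by
  obtain ⟨hM, hN⟩ := mem_principalSet.1 hm
  have hn : 0 < ‖hopfCross m‖ := norm_pos_iff.2 hN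
  have h := norm_hopfCross_sq_add hM
  have h1 : 1 + cotTheta m ^ 2 = (‖m.2‖ ^ 2 / ‖hopfCross m‖) ^ 2 := by
    rw [cotTheta, div_pow, div_pow]
    field_simp
    linarith
  rw [h1, Real.sqrt_sq (by positivity)]
  field_simp

/-- Every principal point satisfies the equation that defines `logRadius` at its own level and
cotangent, and the solution is unique. -/
theorem logRadius_eq_log (hm : m ∈ principalSet) :
    logRadius hc (Real.log (level c m / 3), cotTheta m) = Real.log (‖m.2‖ ^ 2) := by
  obtain ⟨hM, hN⟩ := mem_principalSet.1 hm
  have hn : 0 < ‖hopfCross m‖ := norm_pos_iff.2 hN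
  have ha : 0 < ‖m.2‖ ^ 2 := by have := norm_pos_iff.2 (snd_ne_zero hN); positivity
  have hw := weight_pos hc m
  refine logRadius_eq hc ?_
  have h1 : level c m / 3 = weight c m ^ (1 / 3 : ℝ) * ‖hopfCross m‖ := by rw [level]; ring
  have h2 : Real.log (‖m.2‖ ^ 2) = Real.log ‖hopfCross m‖ + Real.log (1 + cotTheta m ^ 2) / 2 := by
    rw [norm_sq_eq_mul_sqrt hm, Real.log_mul hn.ne' (sqrt_one_add_sq_pos _).ne',
      Real.log_sqrt (by positivity)]
  rw [h1, Real.log_mul (by positivity) hn.ne', Real.log_rpow hw, logScale, Real.exp_log ha, h2,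
    weight]
  simp only
  ring

theorem exp_logRadius (hm : m ∈ principalSet) :
    Real.exp (logRadius hc (Real.log (level c m / 3), cotTheta m) / 2) = ‖m.2‖ := by
  have ha := norm_pos_iff.2 (snd_ne_zero (mem_principalSet.1 hm).2)
  rw [logRadius_eq_log hc hm, Real.log_pow]
  push_cast
  rw [mul_div_cancel_left₀ _ (by norm_num), Real.exp_log ha]

/-- In the plane with orthonormal basis v, ν × v, the vector w is at angle θ from v. -/
theorem hopf_snd_eq_rotate (hm : m ∈ principalSet) :
    hopf m.2 = ‖m.2‖ ^ 2 • rotate (direction m) (arccot (cotTheta m)) (hopf m.1) := by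
  obtain ⟨hM, hN⟩ := mem_principalSet.1 hm
  have hn : ‖hopfCross m‖ ≠ 0 := norm_ne_zero_iff.2 hN
  have hs := (sqrt_one_add_sq_pos (cotTheta m)).ne'
  have e1 : ‖m.2‖ ^ 2 * Real.cos (arccot (cotTheta m)) = hopfInner m := by
    rw [norm_sq_eq_mul_sqrt hm, cos_arccot, mul_assoc, mul_div_cancel₀ _ hs, cotTheta,
      mul_div_cancel₀ _ hn]
  have e2 : ‖m.2‖ ^ 2 * Real.sin (arccot (cotTheta m)) = ‖hopfCross m‖ := by
    rw [norm_sq_eq_mul_sqrt hm, sin_arccot, mul_assoc, mul_div_cancel₀ _ hs, mul_one]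
  have hv : (hopf m.1).imI ^ 2 + (hopf m.1).imJ ^ 2 + (hopf m.1).imK ^ 2 = 1 := by
    have := norm_hopf m.1
    rw [show ‖m.1‖ = 1 from hM] at this
    have h2 := normSq_expand (hopf m.1)
    rw [this, hopf_re] at h2
    linarith
  rw [rotate, ← smul_mul_assoc, smul_add, smul_smul, smul_smul, e1, e2, direction, smul_smul,
    mul_inv_cancel₀ hn, one_smul]
  ext
  · simp [hopfCross_imI, hopfCross_imJ, hopfCross_imK]; ring
  · simp [hopfCross_imI, hopfCross_imJ, hopfCross_imK, hopfInner_expand]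
    linear_combination -(hopf m.2).imI * hv
  · simp [hopfCross_imI, hopfCross_imJ, hopfCross_imK, hopfInner_expand]
    linear_combination -(hopf m.2).imJ * hv
  · simp [hopfCross_imI, hopfCross_imJ, hopfCross_imK, hopfInner_expand]
    linear_combination -(hopf m.2).imK * hv

/-- A point and the model point with the same invariants and frame have the same Hopf directions, so
their components differ by complex factors. Hence `toComplex` in `fibreCoord` loses no information.
-/
theorem intertwine_fibre (hm : m ∈ principalSet) (hx : ‖x‖ = 1) (h1 : hopf x = frameFst hc m)
    (h2 : hopfK x = direction m) :
    unit 0 * m.1 = m.1 * hopf (fibreFst hc (Real.log (level c m / 3), cotTheta m) x) ∧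
    unit 0 * m.2 = m.2 * hopf (fibreSnd hc (Real.log (level c m / 3), cotTheta m) x) := by
  obtain ⟨hM, hN⟩ := mem_principalSet.1 hm
  have hd := norm_direction hN
  have ha : ‖m.2‖ ^ 2 ≠ 0 := by simpa using snd_ne_zero hN
  constructor
  · rw [hopf_fibreFst hc _ hx, h1, h2, frameFst, rotate_rotate (direction_re m) hd, frameAngle,
      neg_add_cancel, rotate_zero, ← intertwine_hopf hM]
  · rw [hopf_fibreSnd hc _ hx, h1, h2, frameFst, rotate_rotate (direction_re m) hd, frameAngle,
      sub_add_cancel]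
    refine smul_right_injective _ ha ?_
    simp only
    rw [← mul_smul_comm _ m.2, ← hopf_snd_eq_rotate hm, mul_hopf]

/-- The parameters in `T² × ℝ` of a point of the principal set. -/
def fibreCoord (m : H2) (x : ℍ[ℝ]) : ℂ × ℂ × ℝ :=
  (toComplex (m.1 * star (fibreFst hc (Real.log (level c m / 3), cotTheta m) x)),
    ‖m.2‖⁻¹ • toComplex (m.2 * star (fibreSnd hc (Real.log (level c m / 3), cotTheta m) x)),
    cotTheta m)

theorem fibreCoord_mem (hm : m ∈ principalSet) (hx : ‖x‖ = 1) (h1 : hopf x = frameFst hc m)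
    (h2 : hopfK x = direction m) : fibreCoord hc m x ∈ torusLine := by
  obtain ⟨hM, hN⟩ := mem_principalSet.1 hm
  obtain ⟨i1, i2⟩ := intertwine_fibre hc hm hx h1 h2
  refine ⟨?_, ?_⟩
  · rw [fibreCoord, norm_toComplex_mul_star (star_hopf _) i1
      (intertwine_hopf (norm_fibreFst hc _ hx)), norm_fibreFst hc _ hx, mul_one]
    exact hM
  · rw [fibreCoord, norm_smul, norm_toComplex_mul_star (star_hopf _) i2
      (intertwine_hopf (norm_fibreSnd hc _ hx)), norm_fibreSnd hc _ hx, mul_one, norm_inv,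
      norm_norm, inv_mul_cancel₀ (norm_ne_zero_iff.2 (snd_ne_zero hN))]

theorem fibrePoint_fibreCoord (hm : m ∈ principalSet) (hx : ‖x‖ = 1) (h1 : hopf x = frameFst hc m)
    (h2 : hopfK x = direction m) :
    fibrePoint hc (Real.log (level c m / 3)) x (fibreCoord hc m x) = m := by
  obtain ⟨hM, hN⟩ := mem_principalSet.1 hm
  obtain ⟨i1, i2⟩ := intertwine_fibre hc hm hx h1 h2
  have ha := norm_ne_zero_iff.2 (snd_ne_zero hN)
  refine Prod.ext ?_ ?_
  · simp only [fibrePoint, fibreCoord]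
    rw [coe_toComplex_mul_star (star_hopf _) i1 (intertwine_hopf (norm_fibreFst hc _ hx)),
      mul_assoc, star_mul_of_norm_one (norm_fibreFst hc _ hx), mul_one]
  · simp only [fibrePoint, fibreCoord]
    rw [exp_logRadius hc hm, smul_smul, mul_inv_cancel₀ ha, one_smul,
      coe_toComplex_mul_star (star_hopf _) i2 (intertwine_hopf (norm_fibreSnd hc _ hx)),
      mul_assoc, star_mul_of_norm_one (norm_fibreSnd hc _ hx), mul_one]

theorem fibreCoord_fibrePoint (hx : ‖x‖ = 1) (hz : z ∈ torusLine) :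
    fibreCoord hc (fibrePoint hc k x z) x = z := by
  have hk : Real.log (level c (fibrePoint hc k x z) / 3) = k := by
    rw [level_fibrePoint hc hx hz, mul_div_cancel_left₀ _ (by norm_num), Real.log_exp]
  rw [fibreCoord, hk, cotTheta_fibrePoint hc hx hz, norm_fibrePoint_snd hc hx hz]
  refine Prod.ext ?_ (Prod.ext ?_ rfl)
  · exact toComplex_coe_mul_star (norm_fibreFst hc _ hx) _
  · simp only [fibrePoint]
    rw [toComplex_coe_mul_star (norm_fibreSnd hc _ hx), smul_smul,
      inv_mul_cancel₀ (Real.exp_pos _).ne', one_smul]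

end Fibre

/-! ### Rotations and unit quaternions -/

/-- A rotation matrix has two orthonormal rows and their cross product as the third. The identity
A₂A₀ = A₁ of quaternions encodes orthogonality in its real part and the cross product in its
imaginary part. -/
theorem coe_mem_rotations_iff {A : Fin 3 → Fin 3 → ℝ} :
    Matrix.of A ∈ Matrix.specialOrthogonalGroup (Fin 3) ℝ ↔
      (imQ (A 0) * imQ (A 0) = -1 ∧ imQ (A 2) * imQ (A 2) = -1) ∧
        imQ (A 2) * imQ (A 0) = imQ (A 1) := by
  rw [Matrix.mem_specialOrthogonalGroup_iff, Matrix.mem_orthogonalGroup_iff]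
  constructor
  · rintro ⟨h1, h2⟩
    -- For a rotation the adjugate is the transpose, which expresses each row as the cross product
    -- of the other two.
    have hadj : (Matrix.of A).adjugate = (Matrix.of A).transpose := by
      have h3 := Matrix.mul_adjugate (Matrix.of A)
      rw [h2, one_smul] at h3
      calc (Matrix.of A).adjugate = (Matrix.of A).transpose * (Matrix.of A) * (Matrix.of A).adjugate := by
            rw [mul_eq_one_comm.1 h1, one_mul]
        _ = _ := by rw [mul_assoc, h3, mul_one]
    rw [Matrix.adjugate_fin_three] at hadj
    have a0 := congrFun (congrFun hadj 0) 1
    have a1 := congrFun (congrFun hadj 1) 1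
    have a2 := congrFun (congrFun hadj 2) 1
    have d0 := congrFun (congrFun h1 0) 0
    have d2 := congrFun (congrFun h1 2) 2
    have d02 := congrFun (congrFun h1 2) 0
    simp [Matrix.mul_apply, Fin.sum_univ_three] at a0 a1 a2 d0 d2 d02
    refine ⟨⟨?_, ?_⟩, ?_⟩
    · ext <;> simp <;> linarith
    · ext <;> simp <;> linarith
    · ext <;> simp <;> linarith
  · rintro ⟨⟨h0, h2⟩, h1⟩
    have d0 := congrArg QuaternionAlgebra.re h0
    have d2 := congrArg QuaternionAlgebra.re h2
    have d02 := congrArg QuaternionAlgebra.re h1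
    have a0 := congrArg QuaternionAlgebra.imI h1
    have a1 := congrArg QuaternionAlgebra.imJ h1
    have a2 := congrArg QuaternionAlgebra.imK h1
    simp at d0 d2 d02 a0 a1 a2
    have d1 : A 1 0 ^ 2 + A 1 1 ^ 2 + A 1 2 ^ 2 = 1 := by
      rw [← a0, ← a1, ← a2]
      linear_combination -(A 2 0 ^ 2 + A 2 1 ^ 2 + A 2 2 ^ 2) * d0 - d2 -
        (A 2 0 * A 0 0 + A 2 1 * A 0 1 + A 2 2 * A 0 2) * (-d02)
    constructor
    · ext l n
      fin_cases l <;> fin_cases n <;> simp [Matrix.mul_apply, Fin.sum_univ_three]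
      · linarith
      · rw [← a0, ← a1, ← a2]; ring
      · linarith
      · rw [← a0, ← a1, ← a2]; ring
      · linarith
      · rw [← a0, ← a1, ← a2]; ring
      · linarith
      · rw [← a0, ← a1, ← a2]; ring
      · linarith
    · rw [Matrix.det_fin_three]
      simp only [Matrix.of_apply]
      linear_combination d1 + A 1 0 * a0 + A 1 1 * a1 + A 1 2 * a2

/-- An unnormalised unit quaternion inducing the rotation with rows `A 0, A 1, A 2`. -/
def preFrame (p : ℍ[ℝ]) (A : Fin 3 → Fin 3 → ℝ) : ℍ[ℝ] :=
  p - unit 0 * p * imQ (A 0) - unit 1 * p * imQ (A 1) - unit 2 * p * imQ (A 2)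

/-- A local section of the covering `S³ → SO(3)`. -/
def frameSection (p : ℍ[ℝ]) (A : Fin 3 → Fin 3 → ℝ) : ℍ[ℝ] := ‖preFrame p A‖⁻¹ • preFrame p A

@[fun_prop] theorem contDiff_preFrame {n : ℕ∞ω} (p : ℍ[ℝ]) : ContDiff ℝ n (preFrame p) := by
  unfold preFrame; fun_prop

theorem contDiffAt_frameSection {n : ℕ∞ω} {p : ℍ[ℝ]} {A : Fin 3 → Fin 3 → ℝ}
    (h : preFrame p A ≠ 0) : ContDiffAt ℝ n (frameSection p) A :=
  (((contDiff_preFrame p).contDiffAt.norm ℝ h).inv (norm_ne_zero_iff.2 h)).smul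
    (contDiff_preFrame p).contDiffAt

theorem norm_frameSection {p : ℍ[ℝ]} {A : Fin 3 → Fin 3 → ℝ} (h : preFrame p A ≠ 0) :
    ‖frameSection p A‖ = 1 := by
  rw [frameSection, norm_smul, norm_inv, norm_norm, inv_mul_cancel₀ (norm_ne_zero_iff.2 h)]

theorem exists_preFrame_ne_zero (A : Fin 3 → Fin 3 → ℝ) : ∃ p, preFrame p A ≠ 0 := by
  by_contra! h
  -- For p = 1, i, j, k the coefficient of p in `preFrame p A` is 1 plus signed diagonal entries of
  -- A; the four coefficients add up to 4.
  have h0 := congrArg QuaternionAlgebra.re (h 1)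
  have h1 := congrArg QuaternionAlgebra.imI (h (unit 0))
  have h2 := congrArg QuaternionAlgebra.imJ (h (unit 1))
  have h3 := congrArg QuaternionAlgebra.imK (h (unit 2))
  simp [preFrame] at h0 h1 h2 h3
  linarith

/-- The rows of A satisfy the multiplication rules of i, j, k, so `preFrame` averages p, up to a
factor, over the quaternion group acting by q ↦ -e_l q A_l. Its values therefore intertwine e_l with
A_l. -/
theorem preFrame_intertwine (p : ℍ[ℝ]) {A : Fin 3 → Fin 3 → ℝ}
    (hA : Matrix.of A ∈ Matrix.specialOrthogonalGroup (Fin 3) ℝ) :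
    unit 0 * preFrame p A = preFrame p A * imQ (A 0) ∧
      unit 2 * preFrame p A = preFrame p A * imQ (A 2) := by
  obtain ⟨⟨h00, h22⟩, h20⟩ := coe_mem_rotations_iff.1 hA
  have hanti : imQ (A 0) * imQ (A 2) = -imQ (A 1) := by
    have := congrArg star h20
    rwa [StarMul.star_mul, star_eq_neg (imQ_re _), star_eq_neg (imQ_re _), star_eq_neg (imQ_re _),
      neg_mul_neg] at this
  have h10 : imQ (A 1) * imQ (A 0) = -imQ (A 2) := by
    rw [← h20, mul_assoc, h00, mul_neg_one]
  have h12 : imQ (A 1) * imQ (A 2) = imQ (A 0) := by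
    rw [← neg_neg (imQ (A 1)), ← hanti, neg_mul, mul_assoc, h22, mul_neg_one, neg_neg]
  have e00 : ∀ q : ℍ[ℝ], unit 0 * (unit 0 * q) = -q := fun q => by ext <;> simp
  have e01 : ∀ q : ℍ[ℝ], unit 0 * (unit 1 * q) = unit 2 * q := fun q => by ext <;> simp
  have e02 : ∀ q : ℍ[ℝ], unit 0 * (unit 2 * q) = -(unit 1 * q) := fun q => by ext <;> simp
  have e20 : ∀ q : ℍ[ℝ], unit 2 * (unit 0 * q) = unit 1 * q := fun q => by ext <;> simp
  have e21 : ∀ q : ℍ[ℝ], unit 2 * (unit 1 * q) = -(unit 0 * q) := fun q => by ext <;> simp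
  have e22 : ∀ q : ℍ[ℝ], unit 2 * (unit 2 * q) = -q := fun q => by ext <;> simp
  constructor <;> simp only [preFrame, mul_sub, sub_mul, mul_assoc, h00, h22, h20, h10, h12, hanti,
      e00, e01, e02, e20, e21, e22, mul_neg, mul_one] <;> abel

theorem frameSection_spec {p : ℍ[ℝ]} {A : Fin 3 → Fin 3 → ℝ}
    (hA : Matrix.of A ∈ Matrix.specialOrthogonalGroup (Fin 3) ℝ) (h : preFrame p A ≠ 0) :
    hopf (frameSection p A) = imQ (A 0) ∧ hopfK (frameSection p A) = imQ (A 2) := by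
  obtain ⟨h1, h2⟩ := preFrame_intertwine p hA
  refine ⟨hopf_eq_of_norm_one (norm_frameSection h) ?_, hopfK_eq_of_intertwine (norm_frameSection h) ?_⟩
  · rw [frameSection, mul_smul_comm, smul_mul_assoc, h1]
  · rw [frameSection, mul_smul_comm, smul_mul_assoc, h2]

/-! ### The fibration of the principal set -/

section Fibration

variable {c : ℝ} (hc : 0 < c)

theorem imCoord_imQ (w : Fin 3 → ℝ) : imCoord (imQ w) = w := by
  funext l; fin_cases l <;> rfl

theorem direction_mul_frameFst_re {m : H2} (hm : m ∈ principalSet) :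
    (frameFst hc m).re = 0 ∧ (direction m * frameFst hc m).re = 0 := by
  have h1 : (direction m * hopf m.1).re = 0 := by
    have := inner_hopfCross_left m
    rw [inner_expand] at this
    rw [direction, smul_mul_assoc, Quaternion.re_smul, Quaternion.re_mul, hopfCross_re]
    rw [hopfCross_re] at this
    linear_combination -(‖hopfCross m‖⁻¹) * this
  have h2 := mul_self_eq_neg_one (direction_re m) (norm_direction (mem_principalSet.1 hm).2)
  constructor
  · rw [frameFst, rotate, add_mul, smul_mul_assoc, smul_mul_assoc, one_mul]
    rw [Quaternion.re_add, Quaternion.re_smul, Quaternion.re_smul, h1, hopf_re]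
    simp
  · rw [frameFst, rotate, ← mul_assoc, mul_add, mul_smul_comm, mul_smul_comm, h2, mul_one, add_mul,
      smul_mul_assoc, smul_mul_assoc, neg_one_mul]
    rw [Quaternion.re_add, Quaternion.re_smul, Quaternion.re_smul, h1, Quaternion.re_neg, hopf_re]
    simp

theorem norm_frameFst {m : H2} (hm : m ∈ principalSet) : ‖frameFst hc m‖ = 1 := by
  obtain ⟨hM, hN⟩ := mem_principalSet.1 hm
  have hd := norm_direction hN
  have h1 : ‖Real.cos (frameAngle hc m) • (1 : ℍ[ℝ]) + Real.sin (frameAngle hc m) • direction m‖ = 1 := by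
    rw [← sq_eq_sq₀ (norm_nonneg _) zero_le_one, normSq_expand]
    have h2 := normSq_expand (direction m)
    rw [hd, direction_re] at h2
    simp
    linear_combination -Real.sin (frameAngle hc m) ^ 2 * h2 + Real.sin_sq_add_cos_sq (frameAngle hc m)
  rw [frameFst, rotate, norm_mul, h1, norm_hopf, show ‖m.1‖ = 1 from hM]
  norm_num

theorem level_pos {m : H2} (hc : 0 < c) (hm : m ∈ principalSet) : 0 < level c m := by
  have := norm_pos_iff.2 (mem_principalSet.1 hm).2
  have := weight_pos hc m
  unfold level
  positivity

theorem principalMap_mem {m : H2} (hm : m ∈ principalSet) : principalMap hc m ∈ posRotations := by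
  obtain ⟨h1, h2⟩ := direction_mul_frameFst_re hc hm
  refine ⟨level_pos hc hm, coe_mem_rotations_iff.2 ⟨⟨?_, ?_⟩, ?_⟩⟩
  · change imQ (imCoord (frameFst hc m)) * imQ (imCoord (frameFst hc m)) = -1
    rw [imQ_imCoord h1]
    exact mul_self_eq_neg_one h1 (norm_frameFst hc hm)
  · change imQ (imCoord (direction m)) * imQ (imCoord (direction m)) = -1
    rw [imQ_imCoord (direction_re m)]
    exact mul_self_eq_neg_one (direction_re m) (norm_direction (mem_principalSet.1 hm).2)
  · change imQ (imCoord (direction m)) * imQ (imCoord (frameFst hc m)) =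
      imQ (imCoord (direction m * frameFst hc m))
    rw [imQ_imCoord (direction_re m), imQ_imCoord h1, imQ_imCoord h2]

theorem frame_eq_of_principalMap {m : H2} (hm : m ∈ principalSet) {b : ℝ × (Fin 3 → Fin 3 → ℝ)}
    (h : principalMap hc m = b) :
    level c m = b.1 ∧ frameFst hc m = imQ (b.2 0) ∧ direction m = imQ (b.2 2) := by
  subst h
  refine ⟨rfl, ?_, ?_⟩
  · change _ = imQ (imCoord (frameFst hc m))
    rw [imQ_imCoord (direction_mul_frameFst_re hc hm).1]
  · change _ = imQ (imCoord (direction m))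
    rw [imQ_imCoord (direction_re m)]

theorem principalMap_fibrePoint {b : ℝ × (Fin 3 → Fin 3 → ℝ)} (hb : b ∈ posRotations) {x : ℍ[ℝ]}
    (hx : ‖x‖ = 1) (h0 : hopf x = imQ (b.2 0)) (h2 : hopfK x = imQ (b.2 2)) {z : ℂ × ℂ × ℝ}
    (hz : z ∈ torusLine) : principalMap hc (fibrePoint hc (Real.log (b.1 / 3)) x z) = b := by
  have h3 : 0 < b.1 / 3 := by have := hb.1; positivity
  rw [principalMap, level_fibrePoint hc hx hz, direction_fibrePoint hc hx hz,
    frameFst_fibrePoint hc hx hz, Real.exp_log h3, mul_div_cancel₀ _ (by norm_num), h0, h2,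
    (coe_mem_rotations_iff.1 hb.2).2]
  refine Prod.ext rfl ?_
  funext l
  fin_cases l <;> exact imCoord_imQ _

theorem contDiffAt_level {m : H2} (hm : m ∈ principalSet) (hc : 0 < c) : ContDiffAt ℝ ∞ (level c) m :=
  (contDiffAt_const.mul ((contDiff_weight_rpow hc _).contDiffAt)).mul
    (contDiff_hopfCross.contDiffAt.norm ℝ (mem_principalSet.1 hm).2)

theorem contDiffAt_cotTheta {m : H2} (hm : m ∈ principalSet) : ContDiffAt ℝ ∞ cotTheta m :=
  contDiff_hopfInner.contDiffAt.div (contDiff_hopfCross.contDiffAt.norm ℝ (mem_principalSet.1 hm).2)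
    (norm_ne_zero_iff.2 (mem_principalSet.1 hm).2)

theorem contDiffAt_direction {m : H2} (hm : m ∈ principalSet) : ContDiffAt ℝ ∞ direction m :=
  ((contDiff_hopfCross.contDiffAt.norm ℝ (mem_principalSet.1 hm).2).inv
    (norm_ne_zero_iff.2 (mem_principalSet.1 hm).2)).smul contDiff_hopfCross.contDiffAt

theorem contDiffAt_parameters {m : H2} (hm : m ∈ principalSet) (hc : 0 < c) :
    ContDiffAt ℝ ∞ (fun m => (Real.log (level c m / 3), cotTheta m)) m :=
  (((contDiffAt_level hm hc).div_const 3).log (by have := level_pos hc hm; positivity)).prodMk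
    (contDiffAt_cotTheta hm)

theorem contDiffAt_frameFst {m : H2} (hm : m ∈ principalSet) : ContDiffAt ℝ ∞ (frameFst hc) m := by
  have h : ContDiffAt ℝ ∞ (frameAngle hc) m :=
    (contDiff_fibreAngle hc).contDiffAt.comp m (contDiffAt_parameters hm hc)
  exact ((((Real.contDiff_cos.contDiffAt.comp m h).smul contDiffAt_const).add
    ((Real.contDiff_sin.contDiffAt.comp m h).smul (contDiffAt_direction hm))).mul
    (contDiff_hopf.comp contDiff_fst).contDiffAt)

theorem contDiffAt_principalMap {m : H2} (hm : m ∈ principalSet) :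
    ContDiffAt ℝ ∞ (principalMap hc) m := by
  refine (contDiffAt_level hm hc).prodMk (contDiffAt_pi.2 fun l => contDiffAt_pi.2 fun n => ?_)
  have h1 := contDiffAt_frameFst hc hm
  have h2 := contDiffAt_direction hm
  fin_cases l
  · exact (contDiff_imCoord n).contDiffAt.comp m h1
  · exact (contDiff_imCoord n).contDiffAt.comp m (h2.mul h1)
  · exact (contDiff_imCoord n).contDiffAt.comp m h2

theorem contDiffAt_fibreCoord {m : H2} (hm : m ∈ principalSet) {x : H2 → ℍ[ℝ]}
    (hx : ContDiffAt ℝ ∞ x m) : ContDiffAt ℝ ∞ (fun m => fibreCoord hc m (x m)) m := by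
  have ha := snd_ne_zero (mem_principalSet.1 hm).2
  have hq := (contDiffAt_parameters hm hc).prodMk hx
  have h1 := (contDiff_fibreFst hc).contDiffAt.comp m hq
  have h2 := (contDiff_fibreSnd hc).contDiffAt.comp m hq
  have h3 : ContDiffAt ℝ ∞ (fun m : H2 => ‖m.2‖⁻¹) m :=
    (contDiffAt_snd.norm ℝ ha).inv (norm_ne_zero_iff.2 ha)
  have h4 := contDiff_toComplex.contDiffAt.comp m
    (contDiffAt_fst.mul (contDiff_star_quaternion.contDiffAt.comp m h1))
  have h5 := contDiff_toComplex.contDiffAt.comp m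
    (contDiffAt_snd.mul (contDiff_star_quaternion.contDiffAt.comp m h2))
  exact h4.prodMk ((h3.smul h5).prodMk (contDiffAt_cotTheta hm))

theorem contDiffAt_fibrePoint {P : Type*} [NormedAddCommGroup P] [NormedSpace ℝ P] {q : P}
    {k : P → ℝ} {x : P → ℍ[ℝ]} {z : P → ℂ × ℂ × ℝ} (hk : ContDiffAt ℝ ∞ k q)
    (hx : ContDiffAt ℝ ∞ x q) (hz : ContDiffAt ℝ ∞ z q) :
    ContDiffAt ℝ ∞ (fun q => fibrePoint hc (k q) (x q) (z q)) q := by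
  have h0 := hk.prodMk hz.snd.snd
  have h1 := (contDiff_fibreFst hc).contDiffAt.comp q (h0.prodMk hx)
  have h2 := (contDiff_fibreSnd hc).contDiffAt.comp q (h0.prodMk hx)
  have h3 := Real.contDiff_exp.contDiffAt.comp q
    (((contDiff_logRadius hc).contDiffAt.comp q h0).div_const 2)
  have h4 := contDiff_coeComplex.contDiffAt.comp q hz.fst
  have h5 := contDiff_coeComplex.contDiffAt.comp q (h3.smul hz.snd.fst)
  exact (h4.mul h1).prodMk (h5.mul h2)

/-- Where `preFrame p` does not vanish, the rotation lifts smoothly to a unit quaternion x.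
`fibreCoord` and `fibrePoint` with this x are then mutually inverse trivialisations. -/
theorem isSmoothFibreBundle_principalMap :
    IsSmoothFibreBundle (principalMap hc) principalSet posRotations torusLine := by
  refine ⟨fun m hm => (contDiffAt_principalMap hc hm).contDiffWithinAt,
    fun m hm => principalMap_mem hc hm, ?_⟩
  rintro b₀ -
  obtain ⟨p, hp⟩ := exists_preFrame_ne_zero b₀.2
  have hspec : ∀ m ∈ principalSet ∩ principalMap hc ⁻¹' {b | preFrame p b.2 ≠ 0},
      m ∈ principalSet ∧ ‖frameSection p (principalMap hc m).2‖ = 1 ∧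
      hopf (frameSection p (principalMap hc m).2) = frameFst hc m ∧
      hopfK (frameSection p (principalMap hc m).2) = direction m := by
    rintro m ⟨hm, hpm⟩
    obtain ⟨-, h1, h2⟩ := frame_eq_of_principalMap hc hm rfl
    obtain ⟨h3, h4⟩ := frameSection_spec (principalMap_mem hc hm).2 hpm
    exact ⟨hm, norm_frameSection hpm, h3.trans h1.symm, h4.trans h2.symm⟩
  refine ⟨{b | preFrame p b.2 ≠ 0},
    isOpen_ne.preimage ((contDiff_preFrame (n := 0) p).continuous.comp continuous_snd), hp,
    fun m => fibreCoord hc m (frameSection p (principalMap hc m).2),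
    fun q => fibrePoint hc (Real.log (q.1.1 / 3)) (frameSection p q.1.2) q.2, ?_, ?_, ?_, ?_, ?_, ?_⟩
  · intro m hm
    obtain ⟨hmP, -⟩ := hspec m hm
    have hx : ContDiffAt ℝ ∞ (fun m => frameSection p (principalMap hc m).2) m :=
      ContDiffAt.comp m (g := frameSection p) (contDiffAt_frameSection hm.2)
        (contDiffAt_principalMap hc hmP).snd
    exact (contDiffAt_fibreCoord hc hmP hx).contDiffWithinAt
  · rintro ⟨b, z⟩ ⟨⟨hb, hpb⟩, -⟩
    have h3 : b.1 / 3 ≠ 0 := by have : 0 < b.1 := hb.1; positivity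
    have hx : ContDiffAt ℝ ∞ (fun q : (ℝ × (Fin 3 → Fin 3 → ℝ)) × ℂ × ℂ × ℝ =>
        frameSection p q.1.2) (b, z) :=
      ContDiffAt.comp (b, z) (g := frameSection p) (contDiffAt_frameSection hpb)
        (ContDiff.contDiffAt (by fun_prop))
    exact (contDiffAt_fibrePoint hc (ContDiffAt.log (contDiffAt_fst.fst.div_const 3) h3) hx
      contDiffAt_snd).contDiffWithinAt
  · intro m hm
    obtain ⟨hmP, hx, h1, h2⟩ := hspec m hm
    exact fibreCoord_mem hc hmP hx h1 h2
  · rintro ⟨b, z⟩ ⟨⟨hb, hpb⟩, hz⟩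
    have hx := norm_frameSection hpb
    obtain ⟨h1, h2⟩ := frameSection_spec hb.2 hpb
    refine ⟨fibrePoint_mem hc hx hz, ?_⟩
    change preFrame p (principalMap hc (fibrePoint hc _ _ _)).2 ≠ 0
    rw [principalMap_fibrePoint hc hb hx h1 h2 hz]
    exact hpb
  · intro m hm
    obtain ⟨hmP, hx, h1, h2⟩ := hspec m hm
    exact fibrePoint_fibreCoord hc hmP hx h1 h2
  · rintro b ⟨hb, hpb⟩ z hz
    have hx := norm_frameSection hpb
    obtain ⟨h1, h2⟩ := frameSection_spec hb.2 hpb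
    simp only
    rw [principalMap_fibrePoint hc hb hx h1 h2 hz]
    exact ⟨rfl, fibreCoord_fibrePoint hc hx hz⟩

end Fibration

/-! ### The fibres of the principal set -/

/-- A multiple of the cross product of the generators of the torus action. -/
def crossField (c : ℝ) (m : H2) : H2 :=
  (-2 : ℝ) • angularField c m + (3 * weight c m * hopfInner m) • radialField m

theorem crossField_fst (c : ℝ) (m : H2) :
    (crossField c m).1 = m.1 * ((-2 * ‖m.2‖ ^ 2) • hopfCross m) := by
  simp only [crossField, angularField, radialField, Prod.fst_add, Prod.smul_fst, smul_zero,
    add_zero, smul_smul, mul_smul_comm]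

theorem crossField_snd (c : ℝ) (m : H2) :
    (crossField c m).2 = m.2 * ((2 * ‖m.2‖ ^ 2 + 3 * c) • hopfCross m +
      (3 * weight c m * hopfInner m) • (1 : ℍ[ℝ])) := by
  simp only [crossField, angularField, radialField, Prod.snd_add, Prod.smul_snd, smul_smul,
    mul_add, mul_smul_comm, mul_one]
  congr 2
  ring

theorem crossField_mem_TM (c : ℝ) (m : H2) : crossField c m ∈ TM m :=
  add_mem ((TM m).smul_mem _ (angularField_mem_TM c m)) ((TM m).smul_mem _ (radialField_mem_TM m))

/-- Comparing the metric products of the angular and radial fields with `phi_torus` identifies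
`crossField` as a positive multiple of the cross product U₁ × U₂; the factor clears denominators. -/
theorem metric_crossField {c : ℝ} (hc : 0 < c) {m : H2} (hm : m ∈ principalSet) {X : H2}
    (hX : X ∈ TM m) : metric c m (crossField c m) X =
      √3 * weight c m ^ (2 / 3 : ℝ) * ‖m.2‖ ^ 2 * phi c m (U₁ m) (U₂ m) X := by
  obtain ⟨hM, hN⟩ := mem_principalSet.1 hm
  obtain ⟨p, hp, hp0⟩ := exists_tangent hM hX
  have hw := weight_pos hc m
  have h23 : weight c m ^ (2 / 3 : ℝ) = weight c m * weight c m ^ (-(1 / 3) : ℝ) := by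
    rw [← Real.rpow_one_add' hw.le] <;> norm_num
  have h1 := phi_torus (c := c) hM hp (snd_scaled m X) (snd_ne_zero hN)
  have h2 : (star m.2 * X.2).re = ⟪m.2, X.2⟫_ℝ := by rw [inner_expand]; simp
  have hs : √3 ^ 2 = (3 : ℝ) := Real.sq_sqrt (by norm_num)
  rw [crossField, metric_add_left, metric_smul_left, metric_smul_left,
    metric_angularField hc hM hp (snd_scaled m X), metric_radialField hc hM hX, ← h2]
  rw [mul_assoc (√3 * _), h1, h23]
  linear_combination -4 * weight c m * weight c m ^ (-(1 / 3) : ℝ) *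
    (-(‖m.2‖ ^ 2 * ⟪hopfCross m, p⟫_ℝ) + (star m.2 * X.2).re * hopfInner m +
      ⟪hopfCross m, star m.2 * X.2⟫_ℝ) * hs

theorem isCross_crossField {c : ℝ} (hc : 0 < c) {m : H2} (hm : m ∈ principalSet) :
    IsCross c m (U₁ m) (U₂ m)
      ((√3 * weight c m ^ (2 / 3 : ℝ) * ‖m.2‖ ^ 2)⁻¹ • crossField c m) := by
  have hw := weight_pos hc m
  have ha := norm_pos_iff.2 (snd_ne_zero (mem_principalSet.1 hm).2)
  refine ⟨(TM m).smul_mem _ (crossField_mem_TM c m), fun Z hZ => ?_⟩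
  rw [metric_smul_left, metric_crossField hc hm hZ, inv_mul_cancel_left₀ (by positivity)]

theorem phi_crossField {c : ℝ} {m : H2} (hm : m ∈ principalSet) :
    phi c m (U₁ m) (U₂ m) (crossField c m) = 4 * √3 *
      ((4 * ‖m.2‖ ^ 2 + 3 * c) * ‖hopfCross m‖ ^ 2 + 3 * weight c m * hopfInner m ^ 2) := by
  obtain ⟨hM, hN⟩ := mem_principalSet.1 hm
  have hr : ‖m.2‖ ^ 2 ≠ 0 := by simpa using snd_ne_zero hN
  have h := phi_torus (c := c) hM (crossField_fst c m) (z := ‖m.2‖ ^ 2 •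
    ((2 * ‖m.2‖ ^ 2 + 3 * c) • hopfCross m + (3 * weight c m * hopfInner m) • (1 : ℍ[ℝ])))
    (by rw [crossField_snd, mul_smul_comm (‖m.2‖ ^ 2)]) (snd_ne_zero hN)
  refine mul_left_cancel₀ hr ?_
  have h1 : ⟪hopfCross m, (1 : ℍ[ℝ])⟫_ℝ = 0 := by rw [inner_expand]; simp
  rw [h]
  simp only [inner_smul_right, inner_add_right, h1, real_inner_self_eq_norm_sq]
  simp
  ring

/-- The Gram matrix is block diagonal because the cross product is orthogonal to the orbit, so its
determinant is the torus block times the squared length of `crossField`. -/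
theorem isAssociativePlane_span_crossField {c : ℝ} (hc : 0 < c) {m : H2} (hm : m ∈ principalSet) :
    IsAssociativePlane c m (Submodule.span ℝ (Set.range ![U₁ m, U₂ m, crossField c m])) := by
  obtain ⟨hM, hN⟩ := mem_principalSet.1 hm
  have hw := weight_pos hc m
  have hr : ‖m.2‖ ^ 2 ≠ 0 := by simpa using snd_ne_zero hN
  have hN2 : 0 < ‖hopfCross m‖ ^ 2 := by have := norm_pos_iff.2 hN; positivity
  have h23 : weight c m ^ (2 / 3 : ℝ) = weight c m * weight c m ^ (-(1 / 3) : ℝ) := by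
    rw [← Real.rpow_one_add' hw.le] <;> norm_num
  have hw3 : weight c m ^ (2 / 3 : ℝ) * (weight c m ^ (-(1 / 3) : ℝ)) ^ 2 = 1 := by
    rw [← Real.rpow_natCast, ← Real.rpow_mul hw.le, ← Real.rpow_add hw]; norm_num
  have hphi := phi_crossField (c := c) hm
  have hs : √3 ^ 2 = (3 : ℝ) := Real.sq_sqrt (by norm_num)
  refine isAssociativePlane_of_gram hc hM (b := ![U₁ m, U₂ m, crossField c m]) ?_ ?_ ?_ rfl
  · intro l
    fin_cases l
    exacts [U₁_mem_TM m, U₂_mem_TM m, crossField_mem_TM c m]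
  · have o1 : U₁ m ∈ orbitTangent m := Submodule.subset_span (Or.inl (Or.inl rfl))
    have o2 : U₂ m ∈ orbitTangent m := Submodule.subset_span (Or.inl (Or.inr rfl))
    have ho : ∀ Y ∈ orbitTangent m, metric c m (crossField c m) Y = 0 := fun Y hY => by
      rw [crossField, metric_add_left, metric_smul_left, metric_smul_left,
        metric_angularField_orbit hc hM hY, metric_radialField_orbit hc hM hY]
      ring
    have g20 := ho _ o1
    have g21 := ho _ o2
    have g02 := (metric_comm c m (U₁ m) (crossField c m)).trans g20
    have g12 := (metric_comm c m (U₂ m) (crossField c m)).trans g21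
    have g22 := metric_crossField hc hm (crossField_mem_TM c m)
    have g00 : metric c m (U₁ m) (U₁ m) =
        3 * weight c m ^ (2 / 3 : ℝ) + weight c m ^ (-(1 / 3) : ℝ) * ‖m.2‖ ^ 2 := by
      rw [metric_tangent hc hM (U₁_fst hM) (U₁_fst hM) (hopf_re _)]
      simp only [U₁, zero_sub, inner_neg_left, inner_neg_right, inner_smul_left, inner_smul_right,
        real_inner_self_eq_norm_sq, norm_mul, norm_hopf, show ‖m.1‖ = 1 from hM]
      simp
      ring
    have g11 : metric c m (U₂ m) (U₂ m) = 4 * weight c m ^ (-(1 / 3) : ℝ) * ‖m.2‖ ^ 2 := by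
      rw [metric_tangent hc hM (p := 0) (q := 0) (by simp [U₂]) (by simp [U₂]) rfl]
      simp only [mul_zero, smul_zero, sub_zero, real_inner_self_eq_norm_sq, U₂, norm_mul, norm_unit]
      simp
    have hin : ⟪m.2 * hopf m.1, (U₂ m).2⟫_ℝ = hopfInner m := by
      refine mul_left_cancel₀ hr ?_
      rw [← inner_smul_right, U₂_snd, inner_mul_left_mul_left, hopfInner]
    have g01 : metric c m (U₁ m) (U₂ m) = -(2 * weight c m ^ (-(1 / 3) : ℝ) * hopfInner m) := by
      rw [metric_tangent hc hM (U₁_fst hM) (q := 0) (by simp [U₂]) (hopf_re _)]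
      have : (U₁ m).2 = 0 := rfl
      simp only [mul_zero, smul_zero, sub_zero, this, zero_sub, inner_neg_left, inner_smul_left,
        hin]
      simp
      ring
    have g10 := (metric_comm c m (U₂ m) (U₁ m)).trans g01
    have hC := norm_hopfCross_sq_add hM
    change phi c m (U₁ m) (U₂ m) (crossField c m) ^ 2 = _
    rw [Matrix.det_fin_three]
    change _ = metric c m (U₁ m) (U₁ m) * metric c m (U₂ m) (U₂ m) *
        metric c m (crossField c m) (crossField c m) -
      metric c m (U₁ m) (U₁ m) * metric c m (U₂ m) (crossField c m) *
        metric c m (crossField c m) (U₂ m) -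
      metric c m (U₁ m) (U₂ m) * metric c m (U₂ m) (U₁ m) *
        metric c m (crossField c m) (crossField c m) +
      metric c m (U₁ m) (U₂ m) * metric c m (U₂ m) (crossField c m) *
        metric c m (crossField c m) (U₁ m) +
      metric c m (U₁ m) (crossField c m) * metric c m (U₂ m) (U₁ m) *
        metric c m (crossField c m) (U₂ m) -
      metric c m (U₁ m) (crossField c m) * metric c m (U₂ m) (U₂ m) *
        metric c m (crossField c m) (U₁ m)
    rw [g00, g01, g02, g10, g11, g12, g20, g21, g22]
    obtain ⟨Q, hQ⟩ : ∃ Q, Q = phi c m (U₁ m) (U₂ m) (crossField c m) := ⟨_, rfl⟩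
    rw [← hQ] at hphi ⊢
    -- This is |U₁ × U₂|² = |U₁|²|U₂|² - ⟨U₁, U₂⟩² in terms of the invariants; |n|² is eliminated by
    -- Lagrange's identity.
    have key : Q = √3 * weight c m ^ (2 / 3 : ℝ) * ‖m.2‖ ^ 2 *
        ((3 * weight c m ^ (2 / 3 : ℝ) + weight c m ^ (-(1 / 3) : ℝ) * ‖m.2‖ ^ 2) *
          (4 * weight c m ^ (-(1 / 3) : ℝ) * ‖m.2‖ ^ 2) -
          (2 * weight c m ^ (-(1 / 3) : ℝ) * hopfInner m) ^ 2) := by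
      obtain ⟨s, hsd⟩ : ∃ s, s = weight c m ^ (-(1 / 3) : ℝ) := ⟨_, rfl⟩
      rw [h23, ← hsd] at hw3 ⊢
      rw [hphi, eq_sub_of_add_eq hC]
      simp only [weight] at hw3 ⊢
      linear_combination -(√3 * ‖m.2‖ ^ 2 * (12 * (c + ‖m.2‖ ^ 2) * ‖m.2‖ ^ 2 + 4 * ‖m.2‖ ^ 4 -
        4 * hopfInner m ^ 2)) * hw3
    linear_combination Q * key
  · change phi c m (U₁ m) (U₂ m) (crossField c m) ≠ 0
    rw [hphi]
    positivity

/-! ### Velocities of the parametrized fibres -/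

section Fibre

variable {c : ℝ} (hc : 0 < c) {k : ℝ} {x : ℍ[ℝ]}

theorem hasDerivAt_expK_mul {f : ℝ → ℝ} {f' s : ℝ} (hf : HasDerivAt f f' s) (hx : ‖x‖ = 1) :
    HasDerivAt (fun s => expK (f s) * x) (f' • (expK (f s) * x * hopfK x)) s := by
  have h := ((hasDerivAt_expK (f s)).scomp s hf).mul_const x
  refine h.congr_deriv ?_
  rw [smul_mul_assoc, unit_two_mul_expK, mul_assoc, mul_assoc, ← unit_two_mul_eq hx]

theorem hasDerivAt_coe {f : ℝ → ℂ} {f' : ℂ} {s : ℝ} (hf : HasDerivAt f f' s) :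
    HasDerivAt (fun s => ((f s : ℂ) : ℍ[ℝ])) (f' : ℍ[ℝ]) s :=
  (LinearMap.toContinuousLinearMap (E := ℂ) (F' := ℍ[ℝ])
    { toFun := fun z => (z : ℍ[ℝ]), map_add' := fun _ _ => by simp
      map_smul' := fun _ _ => by ext <;> simp }).hasFDerivAt.comp_hasDerivAt s hf

theorem coe_smul_I_mul (α : ℝ) (z : ℂ) :
    ((α * Complex.I * z : ℂ) : ℍ[ℝ]) = α • (unit 0 * (z : ℍ[ℝ])) := by
  ext <;> simp

/-- The speed of the parametrization of the fibres relative to `crossField`. -/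
def fibreSpeed (c : ℝ) (m : H2) : ℝ :=
  (2 * (4 * ‖m.2‖ ^ 2 + 3 * c) * (1 + cotTheta m ^ 2) * ‖hopfCross m‖)⁻¹

theorem fibreSpeed_ne_zero (hc : 0 < c) {m : H2} (hm : m ∈ principalSet) : fibreSpeed c m ≠ 0 := by
  have := norm_pos_iff.2 (mem_principalSet.1 hm).2
  unfold fibreSpeed
  positivity

/-- `logRadius` and `angleSpeed` were chosen to make this hold: the derivative in the parameter t is
a multiple of `crossField`, and the circle parameters contribute the generators of the torus. -/
theorem hasDerivAt_fibrePoint (hx : ‖x‖ = 1) {z : ℝ → ℂ × ℂ × ℝ} {α β τ : ℝ}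
    (h0 : z 0 ∈ torusLine) (hz : HasDerivAt z
      (α * Complex.I * (z 0).1, β * Complex.I * (z 0).2.1, τ) 0) {m : H2}
    (hm : fibrePoint hc k x (z 0) = m) :
    HasDerivAt (fun s => fibrePoint hc k x (z s))
      (α • U₁ m + β • U₂ m + (τ * fibreSpeed c m) • crossField c m) 0 := by
  obtain ⟨y, hy⟩ : ∃ y, y = logRadius hc (k, (z 0).2.2) := ⟨_, rfl⟩
  have hr : ‖m.2‖ ^ 2 = Real.exp y := by rw [hy, ← hm, norm_fibrePoint_snd_sq hc hx h0]
  have hmP : m ∈ principalSet := hm ▸ fibrePoint_mem hc hx h0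
  have hn : 0 < ‖hopfCross m‖ := norm_pos_iff.2 (mem_principalSet.1 hmP).2
  have hcot : cotTheta m = (z 0).2.2 := by rw [← hm, cotTheta_fibrePoint hc hx h0]
  have hC : hopfInner m = ‖hopfCross m‖ * (z 0).2.2 := by
    rw [← hcot, cotTheta, mul_div_cancel₀ _ hn.ne']
  have hN : hopfCross m = ‖hopfCross m‖ • hopfK x := by
    rw [← direction_fibrePoint hc (k := k) hx h0, hm, direction, smul_smul,
      mul_inv_cancel₀ hn.ne', one_smul]
  obtain ⟨h1, h2, h3⟩ : HasDerivAt (fun s => (z s).1) (α * Complex.I * (z 0).1) 0 ∧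
      HasDerivAt (fun s => (z s).2.1) (β * Complex.I * (z 0).2.1) 0 ∧
      HasDerivAt (fun s => (z s).2.2) τ 0 := ⟨hz.fst, hz.snd.fst, hz.snd.snd⟩
  have hψ : HasDerivAt (fun s => fibreAngle hc (k, (z s).2.2))
      (angleSpeed hc (k, (z 0).2.2) * τ) 0 := (hasDerivAt_fibreAngle hc k _).comp 0 h3
  have hθ : HasDerivAt (fun s => arccot (z s).2.2) (-(1 / (1 + (z 0).2.2 ^ 2)) * τ) 0 :=
    (hasDerivAt_arccot _).comp 0 h3
  have hδ : HasDerivAt (fun s => (fibreAngle hc (k, (z s).2.2) - arccot (z s).2.2) / 2)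
      ((angleSpeed hc (k, (z 0).2.2) * τ - -(1 / (1 + (z 0).2.2 ^ 2)) * τ) / 2) 0 :=
    (hψ.sub hθ).div_const 2
  obtain ⟨σ, hσ⟩ : ∃ σ, σ = 3 * (c + Real.exp y) * (z 0).2.2 /
      ((4 * Real.exp y + 3 * c) * (1 + (z 0).2.2 ^ 2)) * τ / 2 := ⟨_, rfl⟩
  have hρ : HasDerivAt (fun s => Real.exp (logRadius hc (k, (z s).2.2) / 2))
      (Real.exp (y / 2) * σ) 0 := by
    rw [hσ, hy]
    exact (((hasDerivAt_logRadius hc k _).comp 0 h3).div_const 2).exp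
  have hW : HasDerivAt (fun s => ((Real.exp (logRadius hc (k, (z s).2.2) / 2) • (z s).2.1 : ℂ) : ℍ[ℝ]))
      ((Real.exp (y / 2) • (β * Complex.I * (z 0).2.1) +
        (Real.exp (y / 2) * σ) • (z 0).2.1 : ℂ) : ℍ[ℝ]) 0 := by
    have h := hρ.smul h2
    rw [← hy] at h
    exact hasDerivAt_coe h
  have hX := hasDerivAt_expK_mul (hψ.div_const 2) hx
  have hY := hasDerivAt_expK_mul hδ hx
  have hd := ((hasDerivAt_coe h1).mul hX).prodMk (hW.mul hY)
  refine hd.congr_deriv ?_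
  have hm1 : m.1 = ((z 0).1 : ℍ[ℝ]) * (expK (fibreAngle hc (k, (z 0).2.2) / 2) * x) := by
    rw [← hm]; rfl
  have hm2 : m.2 = ((Real.exp (y / 2) • (z 0).2.1 : ℂ) : ℍ[ℝ]) *
      (expK ((fibreAngle hc (k, (z 0).2.2) - arccot (z 0).2.2) / 2) * x) := by
    rw [← hm, hy]; rfl
  have hsm : ∀ (r : ℝ) (w : ℂ), ((r • w : ℂ) : ℍ[ℝ]) = r • (w : ℍ[ℝ]) := fun r w => by ext <;> simp
  obtain ⟨t, ht⟩ : ∃ t, t = (z 0).2.2 := ⟨_, rfl⟩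
  have hexp := Real.exp_pos y
  refine Prod.ext ?_ ?_
  · have e1 : (α • U₁ m + β • U₂ m + (τ * fibreSpeed c m) • crossField c m).1 =
        α • (unit 0 * m.1) + (τ * fibreSpeed c m * (-2 * ‖m.2‖ ^ 2 * ‖hopfCross m‖)) •
          (m.1 * hopfK x) := by
      simp only [Prod.fst_add, Prod.smul_fst, crossField_fst, U₁, U₂, smul_zero, add_zero]
      conv_lhs => rw [hN]
      simp only [mul_smul_comm, smul_smul]
    rw [e1]
    simp only
    rw [coe_smul_I_mul, smul_mul_assoc, mul_assoc (unit 0), ← hm1, mul_smul_comm, ← mul_assoc,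
      ← hm1]
    -- In the S³-component, half of `angleSpeed` must equal -2r²|n| times `fibreSpeed`.
    congr 2
    rw [fibreSpeed, hr, hcot, angleSpeed, ← hy]
    simp only [← ht]
    field_simp
  · have e1 : (α • U₁ m + β • U₂ m + (τ * fibreSpeed c m) • crossField c m).2 =
        β • (unit 0 * m.2) + ((τ * fibreSpeed c m * (3 * weight c m * hopfInner m)) • m.2 +
          (τ * fibreSpeed c m * ((2 * ‖m.2‖ ^ 2 + 3 * c) * ‖hopfCross m‖)) •
          (m.2 * hopfK x)) := by
      simp only [Prod.snd_add, Prod.smul_snd, crossField_snd, U₁, U₂, smul_zero, zero_add]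
      conv_lhs => rw [hN]
      simp only [mul_smul_comm, smul_smul, mul_add, mul_one, smul_add]
      congr 1
      rw [add_comm]
    have hadd : ∀ w w' : ℂ, ((w + w' : ℂ) : ℍ[ℝ]) = (w : ℍ[ℝ]) + (w' : ℍ[ℝ]) := fun w w' => by simp
    rw [e1]
    simp only
    rw [← hy, mul_smul_comm, ← mul_assoc _ _ (hopfK x), ← hm2, hadd, hsm, hsm, coe_smul_I_mul, add_mul,
      add_assoc]
    rw [hsm, smul_mul_assoc] at hm2
    congr 1
    · rw [hm2, smul_mul_assoc, smul_mul_assoc, mul_smul_comm, smul_comm, mul_assoc (unit 0)]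
    · congr 1
      -- Radial component: σ is the rate of change of log r.
      · rw [hm2, smul_mul_assoc, smul_smul, mul_comm (Real.exp (y / 2))]
        congr 1
        rw [hσ, fibreSpeed, hr, hcot, hC, weight, hr]
        simp only [← ht]
        field_simp
      -- Component along a ν: half of the rate of change of the difference of the two angles.
      · congr 1
        rw [fibreSpeed, hr, hcot, angleSpeed, ← hy]
        simp only [← ht]
        field_simp
        ring

end Fibre

/-- Constancy of |f|² makes f' f̄ imaginary at 0. -/
theorem exists_eq_I_mul {f : ℝ → ℂ} {f' : ℂ} (hf : HasDerivAt f f' 0)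
    (h1 : ∀ᶠ s in 𝓝 (0 : ℝ), ‖f s‖ = 1) : ∃ α : ℝ, f' = α * Complex.I * f 0 := by
  have h2 : HasDerivAt (fun s => ‖f s‖ ^ 2) 0 0 :=
    (hasDerivAt_const (0 : ℝ) (1 : ℝ)).congr_of_eventuallyEq (by
      filter_upwards [h1] with s hs
      rw [hs, one_pow])
  have h3 := hf.norm_sq.unique h2
  rw [Complex.inner] at h3
  have h0 : ‖f 0‖ = 1 := h1.self_of_nhds
  have h4 : f 0 * (starRingEnd ℂ) (f 0) = 1 := by
    rw [Complex.mul_conj, Complex.normSq_eq_norm_sq, h0]; norm_num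
  refine ⟨(f' * (starRingEnd ℂ) (f 0)).im, ?_⟩
  have h5 : (((f' * (starRingEnd ℂ) (f 0)).im : ℂ)) * Complex.I = f' * (starRingEnd ℂ) (f 0) := by
    apply Complex.ext
    · simp at h3 ⊢; linarith
    · simp
  rw [h5, mul_assoc, mul_comm _ (f 0), h4, mul_one]

theorem cotTheta_eq {m : H2} (hm : m ∈ principalSet) :
    cotTheta m = Real.cos (theta m) / Real.sin (theta m) := by
  have hr : ‖m.2‖ ^ 2 ≠ 0 := by simpa using snd_ne_zero (mem_principalSet.1 hm).2
  rw [cos_theta hm, sin_theta hm, div_div_div_cancel_right₀ hr, cotTheta]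

theorem cos_arccot_cotTheta {m : H2} (hm : m ∈ principalSet) :
    Real.cos (arccot (cotTheta m)) = hopfInner m / ‖m.2‖ ^ 2 := by
  have hn := norm_ne_zero_iff.2 (mem_principalSet.1 hm).2
  have hs := (sqrt_one_add_sq_pos (cotTheta m)).ne'
  rw [norm_sq_eq_mul_sqrt hm, cos_arccot, ← div_div, ← cotTheta]

theorem level_eq_muNorm {c : ℝ} (hc : 0 < c) {m : H2} (hm : m ∈ principalSet) :
    level c m = muNorm c (proj m) := by
  rw [← norm_mu_eq_muNorm hc hm, norm_mu hc (mem_principalSet.1 hm).1]; rfl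

/-! ### Tangent spaces, horizontality and closedness of the principal fibres -/

section Fibre

variable {c : ℝ} (hc : 0 < c) {k : ℝ} {x : ℍ[ℝ]}

theorem act_fibrePoint (l₁ l₂ : Circle) (z : ℂ × ℂ × ℝ) :
    act (l₁, l₂, 1) (fibrePoint hc k x z) = fibrePoint hc k x (l₁ * z.1, l₂ * z.2.1, z.2.2) := by
  have hmul : ∀ w w' : ℂ, ((w * w' : ℂ) : ℍ[ℝ]) = (w : ℍ[ℝ]) * (w' : ℍ[ℝ]) := fun w w' => by
    simp
  refine Prod.ext ?_ ?_
  · rw [act_fst]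
    simp only [fibrePoint, hmul, mul_assoc]
    simp
  · rw [act_snd]
    simp only [fibrePoint, ← mul_smul_comm, hmul, mul_assoc]
    simp

theorem coe_mul_self_mem_torusLine (l₁ l₂ : Circle) {z : ℂ × ℂ × ℝ} (hz : z ∈ torusLine) :
    ((l₁ : ℂ) * z.1, (l₂ : ℂ) * z.2.1, z.2.2) ∈ torusLine :=
  ⟨by rw [norm_mul, hz.1, Circle.norm_coe, one_mul], by rw [norm_mul, hz.2, Circle.norm_coe, one_mul]⟩

theorem exists_circle_mul_eq {z w : ℂ} (hz : ‖z‖ = 1) (hw : ‖w‖ = 1) :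
    ∃ l : Circle, (l : ℂ) * z = w :=
  exists_circle_mul (norm_ne_zero_iff.1 (by rw [hz]; exact one_ne_zero)) (hz.trans hw.symm)

variable {L : Set H2}

/-- A curve in L has a smooth coordinate curve in T² × ℝ, whose velocity is rotational in the two
circles. Conversely every such velocity is attained by an explicit curve of exponentials, and
`fibreSpeed` is nonzero. -/
theorem tangentTo_fibre (hx : ‖x‖ = 1) (h1 : ∀ z ∈ torusLine, fibrePoint hc k x z ∈ L)
    (h2 : ∀ m ∈ L, m ∈ principalSet ∧ fibreCoord hc m x ∈ torusLine ∧
      fibrePoint hc k x (fibreCoord hc m x) = m) {m : H2} (hm : m ∈ L) :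
    tangentTo L m = Submodule.span ℝ (Set.range ![U₁ m, U₂ m, crossField c m]) := by
  obtain ⟨hmP, hz0, hpt⟩ := h2 m hm
  have hsp := fibreSpeed_ne_zero hc hmP
  apply le_antisymm
  · refine Submodule.span_le.2 ?_
    rintro X ⟨γ, hγ, hL, rfl, rfl⟩
    have hd : HasDerivAt γ (deriv γ 0) 0 := (hγ.differentiableAt (by simp)).hasDerivAt
    have hz : ContDiffAt ℝ ∞ (fun s => fibreCoord hc (γ s) x) 0 :=
      (contDiffAt_fibreCoord hc hmP contDiffAt_const).comp (0 : ℝ) hγ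
    obtain ⟨w, hw⟩ : ∃ w, HasDerivAt (fun s => fibreCoord hc (γ s) x) w 0 :=
      ⟨_, (hz.differentiableAt (by simp)).hasDerivAt⟩
    have hmem : ∀ᶠ s in 𝓝 (0 : ℝ), fibreCoord hc (γ s) x ∈ torusLine := by
      filter_upwards [hL] with s hs using (h2 _ hs).2.1
    obtain ⟨α, hα⟩ := exists_eq_I_mul hw.fst (hmem.mono fun s hs => hs.1)
    obtain ⟨β, hβ⟩ := exists_eq_I_mul hw.snd.fst (hmem.mono fun s hs => hs.2)
    have hw' : w = (α * Complex.I * (fibreCoord hc (γ 0) x).1,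
        β * Complex.I * (fibreCoord hc (γ 0) x).2.1, w.2.2) :=
      Prod.ext hα (Prod.ext hβ rfl)
    rw [hw'] at hw
    have h3 := hasDerivAt_fibrePoint hc hx hz0 hw hpt
    have h4 := h3.unique (hd.congr_of_eventuallyEq (by
      filter_upwards [hL] with s hs using (h2 _ hs).2.2))
    rw [← h4]
    refine add_mem (add_mem ?_ ?_) ?_ <;> refine Submodule.smul_mem _ _ (Submodule.subset_span ?_)
    exacts [⟨0, rfl⟩, ⟨1, rfl⟩, ⟨2, rfl⟩]
  · have key : ∀ α β τ : ℝ,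
        α • U₁ m + β • U₂ m + (τ * fibreSpeed c m) • crossField c m ∈ tangentTo L m := by
      intro α β τ
      obtain ⟨z₀, hz₀⟩ : ∃ z, z = fibreCoord hc m x := ⟨_, rfl⟩
      rw [← hz₀] at hz0 hpt
      obtain ⟨ζ, hζ⟩ : ∃ ζ : ℝ → ℂ × ℂ × ℝ, ζ = fun s =>
          (z₀.1 * Complex.exp ((α * s : ℝ) * Complex.I),
            z₀.2.1 * Complex.exp ((β * s : ℝ) * Complex.I), z₀.2.2 + s * τ) := ⟨_, rfl⟩
      have hζ0 : ζ 0 = z₀ := by rw [hζ]; simp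
      have hζmem : ∀ s, ζ s ∈ torusLine := fun s => by
        rw [hζ]
        exact ⟨norm_mul_exp hz0.1 _, norm_mul_exp hz0.2 _⟩
      have hζs : ContDiff ℝ ∞ ζ := by rw [hζ]; fun_prop
      have hexp : ∀ (a : ℝ) (w : ℂ), HasDerivAt (fun s : ℝ => w * Complex.exp ((a * s : ℝ) * Complex.I))
          (a * Complex.I * w) 0 := fun a w => by
        have e1 : HasDerivAt (fun s : ℝ => ((a * s : ℝ) : ℂ) * Complex.I) (a * Complex.I) 0 := by
          have := ((Complex.ofRealCLM.hasDerivAt (x := a * 0)).scomp 0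
            ((hasDerivAt_id (0 : ℝ)).const_mul a)).mul_const Complex.I
          simpa using this
        simpa [mul_comm] using e1.cexp.const_mul w
      have hζd : HasDerivAt ζ (α * Complex.I * (ζ 0).1, β * Complex.I * (ζ 0).2.1, τ) 0 := by
        rw [hζ0, hζ]
        refine (hexp α _).prodMk ((hexp β _).prodMk ?_)
        simpa using ((hasDerivAt_id (0 : ℝ)).mul_const τ).const_add z₀.2.2
      have hd := hasDerivAt_fibrePoint hc (k := k) (m := m) hx (hζmem 0) hζd (by rw [hζ0]; exact hpt)
      refine Submodule.subset_span ⟨fun s => fibrePoint hc k x (ζ s),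
        contDiffAt_fibrePoint hc contDiffAt_const contDiffAt_const hζs.contDiffAt,
        Filter.Eventually.of_forall fun s => h1 _ (hζmem s), ?_, hd.deriv⟩
      change fibrePoint hc k x (ζ 0) = m
      rw [hζ0, hpt]
    refine Submodule.span_le.2 ?_
    rintro _ ⟨l, rfl⟩
    fin_cases l
    · simpa using key 1 0 0
    · simpa using key 0 1 0
    · have := key 0 0 (fibreSpeed c m)⁻¹
      rw [inv_mul_cancel₀ hsp] at this
      simpa using this

/-- Horizontality uses only that H contains the torus directions and U₁ × U₂. Points of L over the
same base point share the parameter t, so they differ by the two circle coordinates. Every point of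
the level curve is reached because t ranges over all of ℝ. -/
theorem isHorizontalLift_fibre (hx : ‖x‖ = 1) (hT : IsT2Invariant L)
    (h1 : ∀ z ∈ torusLine, fibrePoint hc k x z ∈ L)
    (h2 : ∀ m ∈ L, m ∈ principalSet ∧ fibreCoord hc m x ∈ torusLine ∧
      fibrePoint hc k x (fibreCoord hc m x) = m) {H : H2 → Submodule ℝ H2}
    (hH : IsConnection c H) :
    IsHorizontalLift H {b | b ∈ B ∧ muNorm c b = 3 * Real.exp k} L := by
  refine ⟨fun m hm => (h2 m hm).1, hT, ?_, ?_, ?_⟩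
  · ext b
    constructor
    · rintro ⟨m, hm, rfl⟩
      obtain ⟨hmP, hz, hpt⟩ := h2 m hm
      refine ⟨proj_mem_B hmP, ?_⟩
      rw [← level_eq_muNorm hc hmP, ← hpt, level_fibrePoint hc hx hz]
    · rintro ⟨hb, hmu⟩
      rw [← proj_image_principalSet] at hb
      obtain ⟨m, hm, rfl⟩ := hb
      have hz : ((1, 1, cotTheta m) : ℂ × ℂ × ℝ) ∈ torusLine := by simp [torusLine]
      refine ⟨_, h1 _ hz, ?_⟩
      have hlev : Real.log (level c m / 3) = k := by
        rw [level_eq_muNorm hc hm, hmu, mul_div_cancel_left₀ _ (by norm_num), Real.log_exp]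
      have hP := fibrePoint_mem hc (k := k) hx hz
      refine Prod.ext ?_ ?_
      · change theta _ = theta m
        rw [theta_eq, theta_eq, ← cos_arccot_cotTheta hm, ← cos_arccot_cotTheta hP,
          cotTheta_fibrePoint hc hx hz]
      · change ‖(fibrePoint hc k x _).2‖ = ‖m.2‖
        rw [norm_fibrePoint_snd hc hx hz, ← hlev, exp_logRadius hc hm]
  · intro m hm n hn hmn
    obtain ⟨hmP, hz, hpt⟩ := h2 m hm
    obtain ⟨hnP, hz', hpt'⟩ := h2 n hn
    have hθ : theta m = theta n := congrArg Prod.fst hmn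
    have ht : (fibreCoord hc m x).2.2 = (fibreCoord hc n x).2.2 := by
      change cotTheta m = cotTheta n
      rw [cotTheta_eq hmP, cotTheta_eq hnP, hθ]
    obtain ⟨l₁, hl₁⟩ := exists_circle_mul_eq hz.1 hz'.1
    obtain ⟨l₂, hl₂⟩ := exists_circle_mul_eq hz.2 hz'.2
    refine ⟨l₁, l₂, ?_⟩
    rw [← hpt, act_fibrePoint, hl₁, hl₂, ht]
    exact hpt'.symm
  · intro m hm
    have hmP := (h2 m hm).1
    obtain ⟨hinf, -, -, hcross⟩ := hH.2 m hmP
    have htor : torusTangent m ≤ H m := by rw [← hinf]; exact inf_le_left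
    rw [tangentTo_fibre hc hx h1 h2 hm, Submodule.span_le]
    rintro _ ⟨l, rfl⟩
    fin_cases l
    · exact htor (Submodule.subset_span (Or.inl rfl))
    · exact htor (Submodule.subset_span (Or.inr rfl))
    · have hw := weight_pos hc m
      have ha := norm_pos_iff.2 (snd_ne_zero (mem_principalSet.1 hmP).2)
      have h := (H m).smul_mem (√3 * weight c m ^ (2 / 3 : ℝ) * ‖m.2‖ ^ 2)
        (hcross _ (isCross_crossField hc hmP))
      rwa [smul_smul, mul_inv_cancel₀ (by positivity), one_smul] at h

theorem principal_fibre_properties {y : ℝ × (Fin 3 → Fin 3 → ℝ)} (hy : y ∈ posRotations)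
    (hL : L = principalSet ∩ principalMap hc ⁻¹' {y}) :
    IsT2Invariant L ∧ IsAssociative c L ∧ Diffeomorphic L torusLine ∧
      (∀ H, IsConnection c H → IsHorizontalLift H {b | b ∈ B ∧ muNorm c b = y.1} L) ∧
      IsClosed L ∧ Disjoint L zeroSection := by
  obtain ⟨p, hp⟩ := exists_preFrame_ne_zero y.2
  obtain ⟨x, hxd⟩ : ∃ x, x = frameSection p y.2 := ⟨_, rfl⟩
  have hx : ‖x‖ = 1 := hxd ▸ norm_frameSection hp
  obtain ⟨hu, hn⟩ := frameSection_spec hy.2 hp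
  rw [← hxd] at hu hn
  obtain ⟨k, hk⟩ : ∃ k, k = Real.log (y.1 / 3) := ⟨_, rfl⟩
  have hy1 : 0 < y.1 := hy.1
  have hyk : y.1 = 3 * Real.exp k := by
    rw [hk, Real.exp_log (by positivity), mul_div_cancel₀ _ (by norm_num)]
  have h1 : ∀ z ∈ torusLine, fibrePoint hc k x z ∈ L := fun z hz => by
    rw [hL]
    refine ⟨fibrePoint_mem hc hx hz, ?_⟩
    rw [hk]
    exact principalMap_fibrePoint hc hy hx hu hn hz
  have h2 : ∀ m ∈ L, m ∈ principalSet ∧ fibreCoord hc m x ∈ torusLine ∧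
      fibrePoint hc k x (fibreCoord hc m x) = m := fun m hm => by
    rw [hL] at hm
    obtain ⟨hmP, hmy⟩ := hm
    obtain ⟨e1, e2, e3⟩ := frame_eq_of_principalMap hc hmP hmy
    have hu' := hu.trans e2.symm
    have hn' := hn.trans e3.symm
    refine ⟨hmP, fibreCoord_mem hc hmP hx hu' hn', ?_⟩
    have := fibrePoint_fibreCoord hc hmP hx hu' hn'
    rwa [e1, ← hk] at this
  have hT : IsT2Invariant L := fun l₁ l₂ m hm => by
    obtain ⟨hmP, hz, hpt⟩ := h2 m hm
    rw [← hpt, act_fibrePoint]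
    exact h1 _ (coe_mul_self_mem_torusLine l₁ l₂ hz)
  have hd : Diffeomorphic L torusLine := by
    rw [hL]; exact (isSmoothFibreBundle_principalMap hc).diffeomorphic hy
  refine ⟨hT, ⟨fun m hm => (mem_principalSet.1 (h2 m hm).1).1,
    isEmbeddedSubmanifold_torusLine.of_diffeomorphic hd, fun m hm => ?_⟩, hd, fun H hH => ?_, ?_, ?_⟩
  · rw [tangentTo_fibre hc hx h1 h2 hm]
    exact isAssociativePlane_span_crossField hc (h2 m hm).1
  · rw [hyk]
    exact isHorizontalLift_fibre hc hx hT h1 h2 hH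
  -- On M the equation |μ| = y.1 > 0 is a closed condition that excludes n = 0. The fibre is
  -- therefore closed inside a closed set on which `principalMap` is continuous.
  · have hcont : Continuous (level c) :=
      ((continuous_const.mul (contDiff_weight_rpow (n := 0) hc _).continuous).mul
        (contDiff_hopfCross (n := 0)).continuous.norm)
    have hS : IsClosed {m : H2 | ‖m.1‖ = 1 ∧ level c m = y.1} :=
      (isClosed_eq (by fun_prop) continuous_const).inter (isClosed_eq hcont continuous_const)
    have hsub : {m : H2 | ‖m.1‖ = 1 ∧ level c m = y.1} ⊆ principalSet := by
      rintro m ⟨hm, hl⟩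
      refine mem_principalSet.2 ⟨hm, fun h0 => ?_⟩
      rw [level, h0, norm_zero, mul_zero] at hl
      exact hy1.ne hl
    have hLS : L = {m : H2 | ‖m.1‖ = 1 ∧ level c m = y.1} ∩ principalMap hc ⁻¹' {y} := by
      rw [hL]
      ext m
      refine ⟨fun ⟨hm, hmy⟩ => ⟨⟨(mem_principalSet.1 hm).1, congrArg Prod.fst hmy⟩, hmy⟩,
        fun ⟨hm, hmy⟩ => ⟨hsub hm, hmy⟩⟩
    rw [hLS]
    refine ContinuousOn.preimage_isClosed_of_isClosed (fun m hm => ?_) hS isClosed_singleton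
    exact (contDiffAt_principalMap hc (hsub hm)).continuousAt.continuousWithinAt
  · rw [Set.disjoint_left]
    rintro m hm ⟨-, h0⟩
    exact snd_ne_zero (mem_principalSet.1 (h2 m hm).1).2 h0

end Fibre

end BryantSalamon

end

theorem mainTheorem10 (c : ℝ) (hc : 0 < c) :
    -- the stratification
    (M = principalSet ∪ (stratum 1 ∪ stratum 2 ∪ stratum 3 ∪ stratum 4) ∧
      Disjoint principalSet (stratum 1 ∪ stratum 2 ∪ stratum 3 ∪ stratum 4)) ∧
    -- the base `B` of the principal set and the function `|μ|` on it
    (ContDiffOn ℝ ∞ proj principalSet ∧ proj '' principalSet = B ∧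
      (∀ m ∈ principalSet, ∀ n ∈ principalSet, proj m = proj n ↔ n ∈ orbit m) ∧
      (∀ m ∈ principalSet, (TM m).map (fderiv ℝ proj m : H2 →ₗ[ℝ] ℝ × ℝ) = ⊤) ∧
      IsMultiMomentMap c (mu c) ∧
      (∀ m ∈ principalSet, ‖mu c m‖ = muNorm c (proj m))) ∧
    -- the principal set
    (IsConnection c (metricConnection c) ∧
      ∃ F : H2 → ℝ × (Fin 3 → Fin 3 → ℝ),
        IsSmoothFibreBundle F principalSet posRotations torusLine ∧
        ∀ y ∈ posRotations, ∀ L : Set H2, L = principalSet ∩ F ⁻¹' {y} →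
          IsT2Invariant L ∧ IsAssociative c L ∧ Diffeomorphic L torusLine ∧
          (∀ H, IsConnection c H → IsHorizontalLift H {b | b ∈ B ∧ muNorm c b = y.1} L) ∧
          IsClosed L ∧ Disjoint L zeroSection) ∧
    -- the stratum `S₁`
    (∃ u : H2 → ℝ × EuclideanSpace ℝ (Fin 3),
      IsSmoothFibreBundle u (stratum 1) twoSpheres torusLine ∧
      ∀ y ∈ twoSpheres, ∀ L : Set H2, L = stratum 1 ∩ u ⁻¹' {y} →
        IsT2Invariant L ∧ IsAssociative c L ∧ IsTotallyGeodesic c L ∧ Diffeomorphic L torusLine ∧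
        IsAssociative c (closure L) ∧ Diffeomorphic (closure L) circlePlane) ∧
    -- the stratum `S₂`
    (stratum 2 = zeroSection ∧ IsT2Invariant zeroSection ∧ IsAssociative c zeroSection ∧
      IsTotallyGeodesic c zeroSection ∧ (∃ m ∈ M, zeroSection = orbit m) ∧
      Diffeomorphic zeroSection (unitSphere 3)) ∧
    -- the strata `S₃` and `S₄`
    stratum 3 = ∅ ∧ stratum 4 = ∅ :=
  ⟨M_eq_union,
    ⟨fun _ hm => (contDiffAt_proj hm).contDiffWithinAt, proj_image_principalSet,
      fun _ hm _ hn => proj_eq_iff_mem_orbit hm hn, fun _ hm => fderiv_proj_surjective hm,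
      isMultiMomentMap_mu hc, fun _ hm => norm_mu_eq_muNorm hc hm⟩,
    ⟨isConnection_metricConnection hc, principalMap hc, isSmoothFibreBundle_principalMap hc,
      fun _ hy _ hL => principal_fibre_properties hc hy hL⟩,
    ⟨singularMap, isSmoothFibreBundle_singularMap,
      fun _ hy _ hL => singular_fibre_properties hc hy hL⟩,
    ⟨stratum_two_eq, isT2Invariant_zeroSection, isAssociative_zeroSection hc,
      isTotallyGeodesic_zeroSection hc, zeroSection_eq_orbit, diffeomorphic_zeroSection⟩,
    stratum_three_eq, stratum_four_eq⟩
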